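/- Let $0<\gamma<1$, $0<\gamma'<1/3$, $\beta>0$ and $\lambda,\lambda'>0$. Let $\mathcal P,\mathcal P'$ be independent Poisson point processes on $\mathbb S=\mathbb R\times[0,1]$ with intensity measures $\lambda|\cdot|$ and $\lambda'|\cdot|$, where $|\cdot|$ is Lebesgue measure. Consider the bipartite graph on the vertex sets $\mathcal P$ and $\mathcal P'$ in which $(x,u)\in\mathcal P$ and $(z,w)\in\mathcal P'$ are joined by an edge if and only if $$|x-z|\,u^{\gamma}\,w^{\gamma'}\le\beta .$$ For $n\in\mathbb N$ let $S_n=\sum_{p\in\mathcal P\cap([0,n]\times[0,1])}\deg(p)$ be the number of edges whose $\mathcal P$-endpoint lies in $[0,n]\times[0,1]$, where $\deg(p)$ counts all neighbors of $p$ in $\mathcal P'$. Then every $S_n$ is almost surely finite and integrable, and the following limits hold in distribution as $n\to\infty$. (a) If $\gamma<1/2$, then $n^{-1/2}(S_n-\mathbb E[S_n])\to\mathcal N(0,\sigma^2)$ for some $\sigma\ge0$. (b) If $\gamma\in(1/2,1)$, then $n^{-\gamma}(S_n-\mathbb E[S_n])$ converges to a (non-degenerate) $1/\gamma$-stable random variable.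 Here a real random variable $X$ that is not almost surely constant is called $\alpha$-stable if, for independent copies $X_1,X_2$ of $X$ and all $a,b>0$, there is $d\in\mathbb R$ such that $aX_1+bX_2$ has the same distribution as $(a^\alpha+b^\alpha)^{1/\alpha}X+d$. -/

import Mathlib

open MeasureTheory ProbabilityTheory Filter Topology
open scoped ENNReal NNReal

noncomputable section

/-- A Poisson process with intensity measure `ν`, as a random locally finite set of points:
the number of points in each measurable set `A` is a random variable, it is Poisson distributed
with parameter `ν A` if `ν A < ∞`, and the numbers of points in finitely many pairwise disjoint
sets are independent. -/
structure IsPoissonProcess {Ω E : Type*} [MeasurableSpace Ω] [TopologicalSpace E]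
    [MeasurableSpace E] (P : Ω → Set E) (ν : Measure E) (μ : Measure Ω) : Prop where
  locallyFinite : ∀ ω, ∀ K : Set E, IsCompact K → (P ω ∩ K).Finite
  measurable_count : ∀ A : Set E, MeasurableSet A → Measurable fun ω ↦ (P ω ∩ A).encard
  law_count : ∀ A : Set E, MeasurableSet A → ν A ≠ ∞ →
    μ.map (fun ω ↦ (P ω ∩ A).encard) =
      (poissonMeasure (ν A).toNNReal).map (fun k : ℕ ↦ (k : ℕ∞))
  indep_count : ∀ (k : ℕ) (A : Fin k → Set E), (∀ i, MeasurableSet (A i)) →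
    Pairwise (fun i j ↦ Disjoint (A i) (A j)) →
    iIndepFun (fun i ω ↦ (P ω ∩ A i).encard) μ

/-- The σ-algebra generated by a point process, i.e. by all its counts in measurable sets. -/
@[reducible]
def processSigmaAlgebra {Ω E : Type*} [MeasurableSpace E] (P : Ω → Set E) : MeasurableSpace Ω :=
  ⨆ A : {A : Set E // MeasurableSet A},
    MeasurableSpace.comap (fun ω ↦ (P ω ∩ (A : Set E)).encard) inferInstance

/-- The space `ℝ × [0,1]` of locations and marks; `volume` on it is Lebesgue measure. -/
abbrev Strip : Type := ℝ × unitInterval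

/-- `F((x,u),(z,w)) = |x - z| u^γ w^γ'`. -/
def connF (γ γ' : ℝ) (p p' : Strip) : ℝ :=
  |p.1 - p'.1| * (p.2 : ℝ) ^ γ * (p'.2 : ℝ) ^ γ'

/-- The neighborhood of `p`: all `p'` with `F(p,p') ≤ β`. -/
def nbhd (γ γ' β : ℝ) (p : Strip) : Set Strip := {p' | connF γ γ' p p' ≤ β}

/-- The degree of the vertex `p` in the bipartite graph: the number of points of `Q` that are
connected to `p`. -/
def bipDegree (γ γ' β : ℝ) (Q : Set Strip) (p : Strip) : ℕ∞ := (Q ∩ nbhd γ γ' β p).encard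

/-- The window `[0,n] × [0,1]`. -/
def window (n : ℕ) : Set Strip := {p | p.1 ∈ Set.Icc (0 : ℝ) n}

/-- The number of edges with first endpoint in the window: the sum of the degrees of the points
of `P` in the window, where the neighbors range over all points of `P'`. -/
def edgeCount {Ω : Type*} (γ γ' β : ℝ) (P P' : Ω → Set Strip) (n : ℕ) (ω : Ω) : ℝ≥0∞ :=
  ∑' p : ↥(P ω ∩ window n), (bipDegree γ γ' β (P' ω) p : ℝ≥0∞)

/-- `ν` is the law of a (non-degenerate) `α`-stable random variable: for independent `X₁, X₂`
with law `ν` and `a, b > 0`, the variable `a X₁ + b X₂` has the law of `c X₁ + d` for some real `d`,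
where `c = (a^α + b^α)^(1/α)`. -/
def IsStableLaw (α : ℝ) (ν : Measure ℝ) : Prop :=
  IsProbabilityMeasure ν ∧ (∀ x : ℝ, ν ≠ Measure.dirac x) ∧
    ∀ a b : ℝ, 0 < a → 0 < b → ∃ d : ℝ,
      (ν.map (fun x ↦ a * x)).conv (ν.map (fun x ↦ b * x)) =
        ν.map (fun x ↦ (a ^ α + b ^ α) ^ (1 / α) * x + d)

end

/-! Let `d(q)` be the number of neighbors of `q` in `P ∩ window n`. Integrating out `P'` given `P`
by the exponential formula, the characteristic function at `s` of the centered number of edges is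
the mean over `P` of `exp (A + i s M)`, where `A` is the integral of `exp (i s d(q)) - 1 - i s d(q)`
over the intensity of `P'` and `M` is the centered sum over `P ∩ window n` of the mean degrees. In
both regimes `A` is close in `L¹` to a constant, and since `Re A ≤ 0`, replacing it by this constant
costs at most their `L¹` distance. For `γ < 1/2` and `s = t n^(-1/2)`, the edges across the border
of the window are negligible and the constant comes from a law of large numbers for spatial averages
of the degrees; for `γ > 1/2` and `s = t n^(-γ)`, `A` tends to `0`.

As the mean degree of a vertex with mark `u` is `c u^(-γ)`, `M` is a centered compound Poisson
variable with explicit characteristic function. It is in the Gaussian domain of attraction if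
`u^(-γ)` is in `L²`, i.e. if `γ < 1/2`; if `γ > 1/2`, the substitution `v = n u` shows that it is
asymptotically `1/γ`-stable. -/

/-! ### Poisson random measures -/

lemma hasSum_mul_poisson (r : ℝ≥0) :
    HasSum (fun n : ℕ ↦ Real.exp (-r) * r ^ n / (n.factorial : ℝ) * n) r := by
  have h := (hasSum_one_poissonMeasure r).mul_left (r : ℝ)
  rw [← hasSum_nat_add_iff' 1]
  simp only [Finset.range_one, Finset.sum_singleton, Nat.cast_zero, mul_zero, sub_zero]
  rw [mul_one] at h
  refine h.congr_fun fun n ↦ ?_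
  rw [Nat.factorial_succ]
  push_cast
  field_simp
  ring

lemma hasSum_sq_mul_poisson (r : ℝ≥0) :
    HasSum (fun n : ℕ ↦ Real.exp (-r) * r ^ n / (n.factorial : ℝ) * (n : ℝ) ^ 2) (r ^ 2 + r) := by
  have h := ((hasSum_mul_poisson r).add (hasSum_one_poissonMeasure r)).mul_left (r : ℝ)
  rw [← hasSum_nat_add_iff' 1]
  simp only [Finset.range_one, Finset.sum_singleton, Nat.cast_zero, ne_eq, OfNat.ofNat_ne_zero,
    not_false_eq_true, zero_pow, mul_zero, sub_zero]
  rw [mul_add, mul_one, ← sq] at h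
  refine h.congr_fun fun n ↦ ?_
  rw [Nat.factorial_succ]
  push_cast
  field_simp
  ring

lemma lintegral_poissonMeasure_of_hasSum {r : ℝ≥0} {f : ℕ → ℝ} (hf : ∀ n, 0 ≤ f n) {c : ℝ}
    (h : HasSum (fun n : ℕ ↦ Real.exp (-r) * r ^ n / (n.factorial : ℝ) * f n) c) :
    ∫⁻ n, ENNReal.ofReal (f n) ∂(poissonMeasure r) = ENNReal.ofReal c := by
  have hint : Integrable f (poissonMeasure r) := by
    rw [integrable_poissonMeasure_iff]
    simpa [abs_of_nonneg, hf] using h.summable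
  rw [← ofReal_integral_eq_lintegral_ofReal hint (ae_of_all _ hf), integral_poissonMeasure]
  simp [h.tsum_eq]

lemma lintegral_poissonMeasure_natCast (r : ℝ≥0) :
    ∫⁻ n : ℕ, (n : ℝ≥0∞) ∂(poissonMeasure r) = r := by
  simpa using lintegral_poissonMeasure_of_hasSum (f := fun n : ℕ ↦ (n : ℝ)) (by simp)
    (hasSum_mul_poisson r)

lemma lintegral_poissonMeasure_natCast_sq (r : ℝ≥0) :
    ∫⁻ n : ℕ, (n : ℝ≥0∞) ^ 2 ∂(poissonMeasure r) = r ^ 2 + r := by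
  simpa [ENNReal.ofReal_pow, ENNReal.ofReal_add] using
    lintegral_poissonMeasure_of_hasSum (f := fun n : ℕ ↦ (n : ℝ) ^ 2) (by intro; positivity)
      (hasSum_sq_mul_poisson r)

/-- A Poisson random measure with intensity measure `ν`: a random measure, given as a kernel, whose
masses of disjoint sets are independent, and whose mass of a set `A` with `ν A < ∞` is Poisson
distributed with parameter `ν A`. -/
structure IsPoissonRandomMeasure {Ω E : Type*} [MeasurableSpace Ω] [MeasurableSpace E]
    (N : Kernel Ω E) (ν : Measure E) (μ : Measure Ω) : Prop where
  map_apply : ∀ A : Set E, MeasurableSet A → ν A ≠ ∞ →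
    μ.map (fun ω ↦ N ω A) = (poissonMeasure (ν A).toNNReal).map fun k : ℕ ↦ (k : ℝ≥0∞)
  iIndepFun_fin : ∀ (k : ℕ) (A : Fin k → Set E), (∀ i, MeasurableSet (A i)) →
    Pairwise (fun i j ↦ Disjoint (A i) (A j)) → iIndepFun (fun i ω ↦ N ω (A i)) μ

lemma measure_ext_of_ne_top {E : Type*} [MeasurableSpace E] {ν m m' : Measure E}
    [SigmaFinite ν] (h : ∀ A, MeasurableSet A → ν A ≠ ∞ → m A = m' A) : m = m' := by
  ext A hA
  have hU : A = ⋃ n, A ∩ spanningSets ν n := by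
    rw [← Set.inter_iUnion, iUnion_spanningSets, Set.inter_univ]
  have hmono : Monotone fun n ↦ A ∩ spanningSets ν n :=
    fun _ _ hij ↦ Set.inter_subset_inter_right A (monotone_spanningSets ν hij)
  rw [hU, hmono.measure_iUnion, hmono.measure_iUnion]
  exact iSup_congr fun n ↦ h _ (hA.inter (measurableSet_spanningSets ν n))
    (measure_ne_top_of_subset Set.inter_subset_right (measure_spanningSets_lt_top ν n).ne)

lemma enorm_exp_I_mul_sub_exp_I_mul_le (a b : ℝ) :
    ‖Complex.exp (.I * a) - Complex.exp (.I * b)‖ₑ ≤ ‖a - b‖ₑ := by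
  have h : Complex.exp (.I * a) - Complex.exp (.I * b) =
      Complex.exp (.I * b) * (Complex.exp (.I * (a - b : ℝ)) - 1) := by
    rw [mul_sub, ← Complex.exp_add, mul_one]
    congr 2
    push_cast
    ring
  have h1 : ‖Complex.exp (.I * b)‖ₑ = 1 := by
    rw [enorm_eq_iff_norm_eq (y := (1 : ℂ)) |>.2] <;> simp [mul_comm Complex.I]
  rw [h, enorm_mul, h1, one_mul]
  exact Real.enorm_exp_I_mul_ofReal_sub_one_le

namespace IsPoissonRandomMeasure

variable {Ω E : Type*} [MeasurableSpace Ω] [MeasurableSpace E] {N : Kernel Ω E} {ν : Measure E}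
  {μ : Measure Ω} {A B : Set E}

lemma iIndepFun_apply (hN : IsPoissonRandomMeasure N ν μ) {ι : Type*} {A : ι → Set E}
    (hA : ∀ i, MeasurableSet (A i)) (hd : Pairwise fun i j ↦ Disjoint (A i) (A j)) :
    iIndepFun (fun i ω ↦ N ω (A i)) μ := by
  rw [iIndepFun_iff_finset]
  intro s
  refine (hN.iIndepFun_fin s.card (fun k ↦ A (s.equivFin.symm k)) (fun _ ↦ hA _)
    fun _ _ hij ↦ hd fun h ↦ hij ?_).of_precomp
      (g := s.equivFin.symm) (f := fun i ω ↦ N ω (A i)) s.equivFin.symm.surjective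
  exact s.equivFin.symm.injective (Subtype.ext h)

lemma indepFun_apply (hN : IsPoissonRandomMeasure N ν μ) (hA : MeasurableSet A)
    (hB : MeasurableSet B) (hd : Disjoint A B) :
    IndepFun (fun ω ↦ N ω A) (fun ω ↦ N ω B) μ := by
  have h := hN.iIndepFun_apply (A := fun b : Bool ↦ cond b A B) (by rintro (_ | _) <;> simp [*])
    (by rintro (_ | _) (_ | _) hij <;> simp_all [hd.symm])
  exact h.indepFun (i := true) (j := false) (by simp)

lemma lintegral_apply_of_ne_top (hN : IsPoissonRandomMeasure N ν μ) (hA : MeasurableSet A)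
    (hνA : ν A ≠ ∞) : ∫⁻ ω, N ω A ∂μ = ν A := by
  rw [← lintegral_map (f := fun x ↦ x) measurable_id (N.measurable_coe hA),
    hN.map_apply A hA hνA, lintegral_map (by fun_prop) (by fun_prop),
    lintegral_poissonMeasure_natCast, ENNReal.coe_toNNReal hνA]

lemma lintegral_apply_sq_of_ne_top (hN : IsPoissonRandomMeasure N ν μ) (hA : MeasurableSet A)
    (hνA : ν A ≠ ∞) : ∫⁻ ω, N ω A ^ 2 ∂μ = ν A ^ 2 + ν A := by
  rw [← lintegral_map (f := fun x ↦ x ^ 2) (by fun_prop) (N.measurable_coe hA),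
    hN.map_apply A hA hνA, lintegral_map (by fun_prop) (by fun_prop),
    lintegral_poissonMeasure_natCast_sq, ENNReal.coe_toNNReal hνA]

lemma lintegral_apply_mul_apply_of_disjoint (hN : IsPoissonRandomMeasure N ν μ)
    (hA : MeasurableSet A) (hνA : ν A ≠ ∞) (hB : MeasurableSet B) (hνB : ν B ≠ ∞)
    (hd : Disjoint A B) : ∫⁻ ω, N ω A * N ω B ∂μ = ν A * ν B := by
  rw [← hN.lintegral_apply_of_ne_top hA hνA, ← hN.lintegral_apply_of_ne_top hB hνB]
  exact lintegral_mul_eq_lintegral_mul_lintegral_of_indepFun (N.measurable_coe hA)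
    (N.measurable_coe hB) (hN.indepFun_apply hA hB hd)

lemma lintegral_apply_mul_apply_of_ne_top (hN : IsPoissonRandomMeasure N ν μ)
    (hA : MeasurableSet A) (hνA : ν A ≠ ∞) (hB : MeasurableSet B) (hνB : ν B ≠ ∞) :
    ∫⁻ ω, N ω A * N ω B ∂μ = ν A * ν B + ν (A ∩ B) := by
  have hC := hA.inter hB
  have hνC := measure_ne_top_of_subset (Set.inter_subset_left (t := B)) hνA
  have hνD := measure_ne_top_of_subset (Set.sdiff_subset (t := B)) hνA
  have hνF := measure_ne_top_of_subset (Set.sdiff_subset (t := A)) hνB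
  have hCF : Disjoint (A ∩ B) (B \ A) := Set.disjoint_sdiff_right.mono_left Set.inter_subset_left
  have hDC : Disjoint (A \ B) (A ∩ B) := Set.disjoint_sdiff_left.mono_right Set.inter_subset_right
  have hDF : Disjoint (A \ B) (B \ A) := Set.disjoint_sdiff_left.mono_right Set.sdiff_subset
  have hsplit (m : Measure E) : m A = m (A \ B) + m (A ∩ B) ∧ m B = m (A ∩ B) + m (B \ A) :=
    ⟨(measure_sdiff_add_inter A hB).symm, by rw [Set.inter_comm, measure_inter_add_sdiff B hA]⟩
  have hmul (ω : Ω) : N ω A * N ω B = N ω (A \ B) * N ω (A ∩ B) + N ω (A \ B) * N ω (B \ A) +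
      N ω (A ∩ B) ^ 2 + N ω (A ∩ B) * N ω (B \ A) := by
    rw [(hsplit (N ω)).1, (hsplit (N ω)).2]; ring
  have hmeas {A : Set E} (hA : MeasurableSet A) : Measurable fun ω ↦ N ω A := N.measurable_coe hA
  have := hmeas hC
  have := hmeas (hA.diff hB)
  have := hmeas (hB.diff hA)
  simp_rw [hmul]
  rw [lintegral_add_left (by fun_prop), lintegral_add_left (by fun_prop),
    lintegral_add_left (by fun_prop), hN.lintegral_apply_sq_of_ne_top hC hνC,
    hN.lintegral_apply_mul_apply_of_disjoint (hA.diff hB) hνD hC hνC hDC,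
    hN.lintegral_apply_mul_apply_of_disjoint (hA.diff hB) hνD (hB.diff hA) hνF hDF,
    hN.lintegral_apply_mul_apply_of_disjoint hC hνC (hB.diff hA) hνF hCF,
    (hsplit ν).1, (hsplit ν).2]
  ring

lemma isProbabilityMeasure (hN : IsPoissonRandomMeasure N ν μ) : IsProbabilityMeasure μ :=
  (hN.iIndepFun_apply (A := fun _ : Fin 0 ↦ ∅) (by simp) (by simp)).isProbabilityMeasure

lemma integral_exp_mul_apply (hN : IsPoissonRandomMeasure N ν μ) (hA : MeasurableSet A) {c : ℝ}
    (hνA : c ≠ 0 → ν A ≠ ∞) :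
    ∫ ω, Complex.exp (.I * ((N ω).real A * c : ℝ)) ∂μ =
      Complex.exp (ν.real A * (Complex.exp (.I * c) - 1)) := by
  have := hN.isProbabilityMeasure
  rcases eq_or_ne c 0 with rfl | hc
  · simp
  have hm : Measurable fun ω ↦ N ω A := N.measurable_coe hA
  have h := charFun_map_cast_poissonMeasure (ν A).toNNReal c
  rw [charFun_apply_real, integral_map .of_discrete (by fun_prop)] at h
  simp only [Measure.real]
  rw [← integral_map (φ := fun ω ↦ N ω A)
    (f := fun x : ℝ≥0∞ ↦ Complex.exp (.I * (x.toReal * c : ℝ))) hm.aemeasurable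
    (by fun_prop), hN.map_apply A hA (hνA hc), integral_map .of_discrete (by fun_prop)]
  simp only [Complex.ofReal_natCast, ENNReal.coe_toNNReal_eq_toReal, mul_comm _ Complex.I] at h
  simpa [mul_comm (c : ℂ)] using h

lemma integral_exp_integral_simpleFunc (hN : IsPoissonRandomMeasure N ν μ)
    (φ : SimpleFunc E ℝ) (hφ : Integrable φ ν) (hφN : ∀ᵐ ω ∂μ, Integrable φ (N ω)) :
    ∫ ω, Complex.exp (.I * (∫ x, φ x ∂(N ω) : ℝ)) ∂μ =
      Complex.exp (∫ x, (Complex.exp (.I * φ x) - 1) ∂ν) := by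
  have hfiber : iIndepFun (fun (c : φ.range) ω ↦ N ω (φ ⁻¹' {c.1})) μ :=
    hN.iIndepFun_apply (fun _ ↦ φ.measurableSet_preimage _) fun c d hcd ↦
      Set.disjoint_left.2 fun x hc hd ↦ hcd (Subtype.ext (hc.symm.trans hd))
  have hsum : ∫ x, (Complex.exp (.I * φ x) - 1) ∂ν =
      ∑ c ∈ φ.range, ν.real (φ ⁻¹' {c}) • (Complex.exp (.I * c) - 1) := by
    have h0 : Complex.exp (.I * (0 : ℝ)) - 1 = 0 := by simp
    rw [← SimpleFunc.map_integral φ (fun c : ℝ ↦ Complex.exp (.I * c) - 1) hφ h0,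
      SimpleFunc.integral_eq_integral]
    · rfl
    · exact SimpleFunc.integrable_iff_finMeasSupp.2
        ((SimpleFunc.integrable_iff_finMeasSupp.1 hφ).map h0)
  have hexp : (fun ω ↦ Complex.exp (.I * (∫ x, φ x ∂(N ω) : ℝ))) =ᵐ[μ]
      fun ω ↦ ∏ c : φ.range, Complex.exp (.I * ((N ω (φ ⁻¹' {c.1})).toReal * c : ℝ)) := by
    filter_upwards [hφN] with ω hω
    rw [SimpleFunc.integral_eq_sum φ hω, ← Finset.sum_coe_sort, ← Complex.exp_sum]
    simp [Finset.mul_sum, Measure.real]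
  rw [integral_congr_ae hexp, hfiber.integral_fun_prod_comp
    (f := fun (c : φ.range) x ↦ Complex.exp (.I * (x.toReal * c : ℝ)))
    (fun _ ↦ (N.measurable_coe (φ.measurableSet_preimage _)).aemeasurable)
    (fun _ ↦ by fun_prop), hsum, ← Finset.sum_coe_sort, Complex.exp_sum]
  refine Finset.prod_congr rfl fun c _ ↦ ?_
  have h := hN.integral_exp_mul_apply (φ.measurableSet_preimage {c.1}) (c := c)
    fun hc ↦ (SimpleFunc.measure_preimage_lt_top_of_integrable φ hφ hc).ne
  simpa [Measure.real] using h

variable [SigmaFinite ν] {f g : E → ℝ}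

lemma bind_eq (hN : IsPoissonRandomMeasure N ν μ) : μ.bind N = ν :=
  measure_ext_of_ne_top (ν := ν) fun A hA hνA ↦ by
    rw [Measure.bind_apply hA N.aemeasurable, hN.lintegral_apply_of_ne_top hA hνA]

lemma lintegral_lintegral (hN : IsPoissonRandomMeasure N ν μ) {f : E → ℝ≥0∞}
    (hf : Measurable f) :
    ∫⁻ ω, ∫⁻ x, f x ∂(N ω) ∂μ = ∫⁻ x, f x ∂ν := by
  rw [← Measure.lintegral_bind N.aemeasurable hf.aemeasurable, hN.bind_eq]

lemma ae_integrable (hN : IsPoissonRandomMeasure N ν μ) (hf : Measurable f)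
    (hfν : Integrable f ν) : ∀ᵐ ω ∂μ, Integrable f (N ω) := by
  have h : ∫⁻ ω, ∫⁻ x, ‖f x‖ₑ ∂(N ω) ∂μ ≠ ∞ := by
    rw [hN.lintegral_lintegral hf.enorm]
    exact hfν.2.ne
  filter_upwards [ae_lt_top hf.enorm.lintegral_kernel h] with ω hω
  exact ⟨hf.aestronglyMeasurable, hω⟩

lemma lintegral_enorm_integral_sub_le (hN : IsPoissonRandomMeasure N ν μ) (hf : Measurable f)
    (hfν : Integrable f ν) (hg : Measurable g) (hgν : Integrable g ν) :
    ∫⁻ ω, ‖(∫ x, f x ∂(N ω)) - ∫ x, g x ∂(N ω)‖ₑ ∂μ ≤ ∫⁻ x, ‖f x - g x‖ₑ ∂ν := by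
  rw [← hN.lintegral_lintegral (f := fun x ↦ ‖f x - g x‖ₑ) (hf.sub hg).enorm]
  refine lintegral_mono_ae ?_
  filter_upwards [hN.ae_integrable hf hfν, hN.ae_integrable hg hgν] with ω h1 h2
  rw [← integral_sub h1 h2]
  exact enorm_integral_le_lintegral_enorm _

lemma integral_exp_integral (hN : IsPoissonRandomMeasure N ν μ) (hf : Measurable f)
    (hfν : Integrable f ν) :
    ∫ ω, Complex.exp (.I * (∫ x, f x ∂(N ω) : ℝ)) ∂μ =
      Complex.exp (∫ x, (Complex.exp (.I * f x) - 1) ∂ν) := by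
  have := hN.isProbabilityMeasure
  -- Both sides are continuous in `f` for the norm of `L¹(ν)`.
  set φ : ℕ → SimpleFunc E ℝ :=
    SimpleFunc.approxOn f hf (Set.range f ∪ {0}) 0 (by simp)
  have hφν (n : ℕ) : Integrable (φ n) ν := SimpleFunc.integrable_approxOn_range hf hfν n
  have hφf : Tendsto (fun n ↦ ∫⁻ x, ‖φ n x - f x‖ₑ ∂ν) atTop (𝓝 0) :=
    SimpleFunc.tendsto_approxOn_range_L1_enorm hf hfν
  have hmN {f : E → ℝ} (hf : Measurable f) : Measurable fun ω ↦ ∫ x, f x ∂(N ω) :=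
    hf.stronglyMeasurable.integral_kernel.measurable
  have hintν {f : E → ℝ} (hf : Measurable f) (hfν : Integrable f ν) :
      Integrable (fun x ↦ Complex.exp (.I * f x) - 1) ν :=
    hfν.mono (by fun_prop) (ae_of_all _ fun x ↦ Real.norm_exp_I_mul_ofReal_sub_one_le)
  have hintN {f : E → ℝ} (hf : Measurable f) :
      Integrable (fun ω ↦ Complex.exp (.I * (∫ x, f x ∂(N ω) : ℝ))) μ := by
    have := hmN hf
    refine Integrable.of_bound (Measurable.aestronglyMeasurable (by fun_prop)) 1
      (ae_of_all _ fun ω ↦ ?_)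
    simp [mul_comm Complex.I]
  have hleft := tendsto_integral_of_L1 _ (hintN hf).1 (.of_forall fun n ↦ hintN (φ n).measurable)
    (tendsto_of_tendsto_of_tendsto_of_le_of_le tendsto_const_nhds hφf (fun _ ↦ zero_le)
      fun n ↦ (lintegral_mono fun ω ↦ enorm_exp_I_mul_sub_exp_I_mul_le _ _).trans
        (hN.lintegral_enorm_integral_sub_le (φ n).measurable (hφν n) hf hfν))
  have hright := tendsto_integral_of_L1 _ (hintν hf hfν).1
    (.of_forall fun n ↦ hintν (φ n).measurable (hφν n))
    (tendsto_of_tendsto_of_tendsto_of_le_of_le tendsto_const_nhds hφf (fun _ ↦ zero_le)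
      fun n ↦ lintegral_mono fun x ↦ by
        simpa using enorm_exp_I_mul_sub_exp_I_mul_le (φ n x) (f x))
  refine tendsto_nhds_unique hleft (((Complex.continuous_exp.tendsto _).comp hright).congr
    fun n ↦ ?_)
  exact (hN.integral_exp_integral_simpleFunc (φ n) (hφν n)
    (hN.ae_integrable (φ n).measurable (hφν n))).symm

end IsPoissonRandomMeasure

lemma abs_covariance_le_of_bounded {Ω : Type*} [MeasurableSpace Ω] {μ : Measure Ω}
    [IsProbabilityMeasure μ] {X Y : Ω → ℝ} {c : ℝ} (hX : Integrable X μ) (hY : ∀ ω, |Y ω| ≤ c) :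
    |cov[X, Y; μ]| ≤ 4 * c * ∫ ω, |X ω| ∂μ := by
  have hEX : |∫ ω, X ω ∂μ| ≤ ∫ ω, |X ω| ∂μ := abs_integral_le_integral_abs
  have hEY : |∫ ω, Y ω ∂μ| ≤ c := by
    simpa using norm_integral_le_of_norm_le_const (f := Y) (C := c) (ae_of_all μ hY)
  have hle (ω : Ω) : ‖(X ω - ∫ ω, X ω ∂μ) * (Y ω - ∫ ω, Y ω ∂μ)‖ ≤
      (|X ω| + ∫ ω, |X ω| ∂μ) * (2 * c) := by
    rw [Real.norm_eq_abs, abs_mul]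
    have hX' := (abs_sub (X ω) _).trans (add_le_add_right hEX |X ω|)
    have hY' := (abs_sub (Y ω) _).trans (add_le_add (hY ω) hEY)
    rw [← two_mul] at hY'
    gcongr
  calc |∫ ω, (X ω - ∫ ω, X ω ∂μ) * (Y ω - ∫ ω, Y ω ∂μ) ∂μ|
    _ ≤ ∫ ω, (|X ω| + ∫ ω, |X ω| ∂μ) * (2 * c) ∂μ :=
      norm_integral_le_of_norm_le ((hX.abs.add (integrable_const _)).mul_const _) (ae_of_all _ hle)
    _ = 4 * c * ∫ ω, |X ω| ∂μ := by
      rw [integral_mul_const, integral_add hX.abs (integrable_const _), integral_const]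
      simp only [probReal_univ, one_smul]
      ring

namespace IsPoissonRandomMeasure

variable {Ω E : Type*} [MeasurableSpace Ω] [MeasurableSpace E] {N : Kernel Ω E} {ν : Measure E}
  {μ : Measure Ω} {A B : Set E} {φ : ℝ≥0∞ → ℝ} {c : ℝ}

lemma map_apply_congr (hN : IsPoissonRandomMeasure N ν μ) (hA : MeasurableSet A)
    (hB : MeasurableSet B) (hνA : ν A ≠ ∞) (h : ν A = ν B) :
    μ.map (fun ω ↦ N ω A) = μ.map (fun ω ↦ N ω B) := by
  rw [hN.map_apply A hA hνA, hN.map_apply B hB (h ▸ hνA), h]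

lemma measure_apply_ne_zero_le (hN : IsPoissonRandomMeasure N ν μ) (hA : MeasurableSet A)
    (hνA : ν A ≠ ∞) : μ {ω | N ω A ≠ 0} ≤ ν A := by
  have hm : Measurable fun ω ↦ N ω A := N.measurable_coe hA
  have h0 : MeasurableSet {x : ℝ≥0∞ | x ≠ 0} := (measurableSet_singleton 0).compl
  calc μ {ω | N ω A ≠ 0}
    _ = μ.map (fun ω ↦ N ω A) {x | x ≠ 0} := (Measure.map_apply hm h0).symm
    _ = (poissonMeasure (ν A).toNNReal) {k | (k : ℝ≥0∞) ≠ 0} := by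
      rw [hN.map_apply A hA hνA, Measure.map_apply .of_discrete h0]
      rfl
    _ ≤ (poissonMeasure (ν A).toNNReal) {k | 1 ≤ (k : ℝ≥0∞)} := by
      refine measure_mono fun k hk ↦ ?_
      simpa [Nat.one_le_iff_ne_zero] using hk
    _ ≤ ∫⁻ k : ℕ, (k : ℝ≥0∞) ∂(poissonMeasure (ν A).toNNReal) := by
      simpa using mul_meas_ge_le_lintegral (μ := poissonMeasure (ν A).toNNReal)
        (f := fun k : ℕ ↦ (k : ℝ≥0∞)) .of_discrete 1
    _ = ν A := by rw [lintegral_poissonMeasure_natCast, ENNReal.coe_toNNReal hνA]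

lemma integral_abs_comp_apply_sub_le (hN : IsPoissonRandomMeasure N ν μ) (hA : MeasurableSet A)
    (hB : MeasurableSet B) (hνA : ν A ≠ ∞) (hc : ∀ x, |φ x| ≤ c) :
    ∫ ω, |φ (N ω A) - φ (N ω (A \ B))| ∂μ ≤ 2 * c * ν.real (A ∩ B) := by
  have := hN.isProbabilityMeasure
  have hc0 : 0 ≤ c := (abs_nonneg _).trans (hc 0)
  have hνC := measure_ne_top_of_subset (Set.inter_subset_left (t := B)) hνA
  have hC : MeasurableSet {ω | N ω (A ∩ B) ≠ 0} :=
    N.measurable_coe (hA.inter hB) (measurableSet_singleton 0).compl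
  have hle (ω : Ω) : |φ (N ω A) - φ (N ω (A \ B))| ≤
      {ω | N ω (A ∩ B) ≠ 0}.indicator (fun _ ↦ 2 * c) ω := by
    by_cases h : N ω (A ∩ B) = 0
    · rw [← measure_sdiff_add_inter A hB, h]
      simp [h]
    · rw [Set.indicator_of_mem (by exact h)]
      exact (abs_sub _ _).trans (by linarith [hc (N ω A), hc (N ω (A \ B))])
  calc ∫ ω, |φ (N ω A) - φ (N ω (A \ B))| ∂μ
    _ ≤ ∫ ω, {ω | N ω (A ∩ B) ≠ 0}.indicator (fun _ ↦ 2 * c) ω ∂μ :=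
      integral_mono_of_nonneg (ae_of_all _ fun _ ↦ abs_nonneg _)
        ((integrable_const _).indicator hC) (ae_of_all _ hle)
    _ = 2 * c * μ.real {ω | N ω (A ∩ B) ≠ 0} := by
      rw [integral_indicator_const _ hC, smul_eq_mul, mul_comm]
    _ ≤ 2 * c * ν.real (A ∩ B) := by
      gcongr
      exact ENNReal.toReal_mono hνC (hN.measure_apply_ne_zero_le (hA.inter hB) hνC)

lemma abs_covariance_comp_apply_le (hN : IsPoissonRandomMeasure N ν μ) (hA : MeasurableSet A)
    (hB : MeasurableSet B) (hνA : ν A ≠ ∞) (hνB : ν B ≠ ∞) (hφ : Measurable φ)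
    (hc : ∀ x, |φ x| ≤ c) :
    |cov[fun ω ↦ φ (N ω A), fun ω ↦ φ (N ω B); μ]| ≤ 16 * c ^ 2 * ν.real (A ∩ B) := by
  have := hN.isProbabilityMeasure
  have hc0 : 0 ≤ c := (abs_nonneg _).trans (hc 0)
  have hL {A : Set E} (hA : MeasurableSet A) : MemLp (fun ω ↦ φ (N ω A)) 2 μ :=
    .of_bound (hφ.comp (N.measurable_coe hA)).aestronglyMeasurable c (ae_of_all _ fun _ ↦ hc _)
  have hindep : cov[fun ω ↦ φ (N ω (A \ B)), fun ω ↦ φ (N ω (B \ A)); μ] = 0 :=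
    ((hN.indepFun_apply (hA.diff hB) (hB.diff hA)
      (Set.disjoint_sdiff_left.mono_right Set.sdiff_subset)).comp hφ hφ).covariance_eq_zero
        (hL (hA.diff hB)) (hL (hB.diff hA))
  have hleft := abs_covariance_le_of_bounded
    (((hL hA).sub (hL (hA.diff hB))).integrable one_le_two) fun ω ↦ hc (N ω B)
  have hright := abs_covariance_le_of_bounded
    (((hL hB).sub (hL (hB.diff hA))).integrable one_le_two) fun ω ↦ hc (N ω (A \ B))
  rw [covariance_comm] at hright
  rw [covariance_sub_left (hL hA) (hL (hA.diff hB)) (hL hB)] at hleft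
  rw [covariance_sub_right (hL (hA.diff hB)) (hL hB) (hL (hB.diff hA)), hindep, sub_zero] at hright
  have h4 : 0 ≤ 4 * c := by positivity
  have hl := mul_le_mul_of_nonneg_left (hN.integral_abs_comp_apply_sub_le hA hB hνA hc) h4
  have hr := mul_le_mul_of_nonneg_left (hN.integral_abs_comp_apply_sub_le hB hA hνB hc) h4
  rw [Set.inter_comm] at hr
  simp only [Pi.sub_apply] at hleft hright
  have htri := abs_add_le (cov[fun ω ↦ φ (N ω A), fun ω ↦ φ (N ω B); μ] -
    cov[fun ω ↦ φ (N ω (A \ B)), fun ω ↦ φ (N ω B); μ])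
    cov[fun ω ↦ φ (N ω (A \ B)), fun ω ↦ φ (N ω B); μ]
  rw [sub_add_cancel] at htri
  linarith

end IsPoissonRandomMeasure

lemma covariance_integral_left {Ω Q : Type*} [MeasurableSpace Ω] [MeasurableSpace Q]
    {μ : Measure Ω} [IsProbabilityMeasure μ] {ρ : Measure Q} [IsFiniteMeasure ρ] {f : Ω → Q → ℝ}
    {Y : Ω → ℝ} {c : ℝ} (hf : Measurable f.uncurry) (hfc : ∀ ω q, |f ω q| ≤ c)
    (hY : MemLp Y 2 μ) :
    cov[fun ω ↦ ∫ q, f ω q ∂ρ, Y; μ] = ∫ q, cov[fun ω ↦ f ω q, Y; μ] ∂ρ := by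
  have hL (q : Q) : MemLp (fun ω ↦ f ω q) 2 μ :=
    .of_bound (hf.comp measurable_prodMk_right).aestronglyMeasurable c
      (ae_of_all _ fun ω ↦ hfc ω q)
  have hint : Integrable f.uncurry (μ.prod ρ) :=
    .of_bound hf.aestronglyMeasurable c (ae_of_all _ fun z ↦ hfc z.1 z.2)
  have hY1 := (hY.integrable one_le_two).comp_fst ρ
  have hintY : Integrable (fun z : Ω × Q ↦ f z.1 z.2 * Y z.1) (μ.prod ρ) :=
    hY1.bdd_mul hint.1 (ae_of_all _ fun z ↦ hfc z.1 z.2)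
  have hZ : MemLp (fun ω ↦ ∫ q, f ω q ∂ρ) 2 μ :=
    .of_bound hf.stronglyMeasurable.integral_prod_right.aestronglyMeasurable (c * ρ.real .univ)
      (ae_of_all _ fun ω ↦ norm_integral_le_of_norm_le_const (ae_of_all _ (hfc ω)))
  simp_rw [covariance_eq_sub hZ hY, covariance_eq_sub (hL _) hY, Pi.mul_apply]
  have hEf : Integrable (fun q ↦ ∫ ω, f ω q ∂μ) ρ := hint.integral_prod_right
  have hEfY : Integrable (fun q ↦ ∫ ω, f ω q * Y ω ∂μ) ρ := hintY.integral_prod_right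
  rw [integral_sub hEfY (hEf.mul_const _), integral_mul_const, integral_integral_swap hint,
    ← integral_integral_swap (f := fun ω q ↦ f ω q * Y ω) hintY]
  simp_rw [integral_mul_const]

lemma measurable_kernel_preimage_prodMk {Ω E Q : Type*} [MeasurableSpace Ω] [MeasurableSpace E]
    [MeasurableSpace Q] (N : Kernel Ω E) [IsSFiniteKernel N] {G : Set (E × Q)}
    (hG : MeasurableSet G) :
    Measurable fun z : Ω × Q ↦ N z.1 ((fun x ↦ (x, z.2)) ⁻¹' G) :=
  Kernel.measurable_kernel_prodMk_left (κ := N.prodMkRight Q)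
    (t := {z : (Ω × Q) × E | (z.2, z.1.2) ∈ G}) (hG.preimage (by fun_prop))

lemma lintegral_lintegral_measure_inter {E Q : Type*} [MeasurableSpace E] [MeasurableSpace Q]
    {ν : Measure E} [SFinite ν] {ρ : Measure Q} [SFinite ρ] {G : Set (E × Q)}
    (hG : MeasurableSet G) :
    ∫⁻ q, ∫⁻ q', ν ((fun x ↦ (x, q)) ⁻¹' G ∩ (fun x ↦ (x, q')) ⁻¹' G) ∂ρ ∂ρ =
      ∫⁻ x, ρ (Prod.mk x ⁻¹' G) ^ 2 ∂ν := by
  have hind : Measurable (G.indicator (1 : E × Q → ℝ≥0∞)) := measurable_one.indicator hG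
  have hleft (q q' : Q) : ν ((fun x ↦ (x, q)) ⁻¹' G ∩ (fun x ↦ (x, q')) ⁻¹' G) =
      ∫⁻ x, G.indicator 1 (x, q) * G.indicator 1 (x, q') ∂ν := by
    rw [← lintegral_indicator_one
      ((hG.preimage measurable_prodMk_right).inter (hG.preimage measurable_prodMk_right)),
      Set.inter_indicator_one]
    rfl
  have hright (x : E) : ρ (Prod.mk x ⁻¹' G) = ∫⁻ q, G.indicator 1 (x, q) ∂ρ :=
    (lintegral_indicator_one (hG.preimage measurable_prodMk_left)).symm
  have hx (x : E) : Measurable fun q ↦ G.indicator (1 : E × Q → ℝ≥0∞) (x, q) :=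
    hind.comp measurable_prodMk_left
  simp_rw [hleft, hright, sq]
  calc ∫⁻ q, ∫⁻ q', ∫⁻ x, G.indicator 1 (x, q) * G.indicator 1 (x, q') ∂ν ∂ρ ∂ρ
    _ = ∫⁻ q, ∫⁻ x, G.indicator 1 (x, q) * ∫⁻ q', G.indicator 1 (x, q') ∂ρ ∂ν ∂ρ := by
      refine lintegral_congr fun q ↦ ?_
      rw [lintegral_lintegral_swap (Measurable.aemeasurable (by fun_prop))]
      exact lintegral_congr fun x ↦ lintegral_const_mul _ (hx x)
    _ = ∫⁻ x, (∫⁻ q, G.indicator 1 (x, q) ∂ρ) * ∫⁻ q', G.indicator 1 (x, q') ∂ρ ∂ν := by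
      rw [lintegral_lintegral_swap (f := fun q x ↦ G.indicator 1 (x, q) *
        ∫⁻ q', G.indicator 1 (x, q') ∂ρ) (Measurable.aemeasurable (by fun_prop))]
      exact lintegral_congr fun x ↦ lintegral_mul_const _ (hx x)

namespace IsPoissonRandomMeasure

variable {Ω E Q : Type*} [MeasurableSpace Ω] [MeasurableSpace E] [MeasurableSpace Q]
  {N : Kernel Ω E} {ν : Measure E} [SFinite ν] {μ : Measure Ω} {φ : ℝ≥0∞ → ℝ} {c : ℝ}

lemma evariance_integral_comp_apply_le [IsSFiniteKernel N] (hN : IsPoissonRandomMeasure N ν μ)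
    {ρ : Measure Q} [IsFiniteMeasure ρ] {G : Set (E × Q)} (hG : MeasurableSet G)
    (hνG : ∀ᵐ q ∂ρ, ν ((fun x ↦ (x, q)) ⁻¹' G) ≠ ∞) (hφ : Measurable φ) (hc : ∀ x, |φ x| ≤ c) :
    evariance (fun ω ↦ ∫ q, φ (N ω ((fun x ↦ (x, q)) ⁻¹' G)) ∂ρ) μ ≤
      ENNReal.ofReal (16 * c ^ 2) * ∫⁻ x, ρ (Prod.mk x ⁻¹' G) ^ 2 ∂ν := by
  have := hN.isProbabilityMeasure
  set B : Q → Set E := fun q ↦ (fun x ↦ (x, q)) ⁻¹' G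
  set f : Ω → Q → ℝ := fun ω q ↦ φ (N ω (B q))
  have hB (q : Q) : MeasurableSet (B q) := hG.preimage measurable_prodMk_right
  have hf : Measurable f.uncurry := hφ.comp (measurable_kernel_preimage_prodMk N hG)
  have hL (q : Q) : MemLp (fun ω ↦ f ω q) 2 μ :=
    .of_bound (hf.comp measurable_prodMk_right).aestronglyMeasurable c
      (ae_of_all _ fun _ ↦ hc _)
  have hZ : MemLp (fun ω ↦ ∫ q, f ω q ∂ρ) 2 μ :=
    .of_bound hf.stronglyMeasurable.integral_prod_right.aestronglyMeasurable (c * ρ.real .univ)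
      (ae_of_all _ fun ω ↦ norm_integral_le_of_norm_le_const (ae_of_all _ fun _ ↦ hc _))
  have hcov : ∀ᵐ q ∂ρ, ∀ᵐ q' ∂ρ, ‖cov[fun ω ↦ f ω q, fun ω ↦ f ω q'; μ]‖ₑ ≤
      ENNReal.ofReal (16 * c ^ 2) * ν (B q ∩ B q') := by
    filter_upwards [hνG] with q hq
    filter_upwards [hνG] with q' hq'
    rw [← ENNReal.ofReal_toReal (measure_ne_top_of_subset Set.inter_subset_left hq),
      ← ENNReal.ofReal_mul (by positivity), Real.enorm_eq_ofReal_abs]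
    exact ENNReal.ofReal_le_ofReal
      (hN.abs_covariance_comp_apply_le (hB q) (hB q') hq hq' hφ hc)
  calc evariance (fun ω ↦ ∫ q, f ω q ∂ρ) μ
    _ = ENNReal.ofReal (∫ q, ∫ q', cov[fun ω ↦ f ω q, fun ω ↦ f ω q'; μ] ∂ρ ∂ρ) := by
      rw [← ofReal_variance hZ, ← covariance_self hZ.1.aemeasurable,
        covariance_integral_left hf (fun _ _ ↦ hc _) hZ]
      congr! 3 with q
      rw [covariance_comm, covariance_integral_left hf (fun _ _ ↦ hc _) (hL q)]
      simp_rw [covariance_comm]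
    _ ≤ ∫⁻ q, ∫⁻ q', ‖cov[fun ω ↦ f ω q, fun ω ↦ f ω q'; μ]‖ₑ ∂ρ ∂ρ := by
      refine (ENNReal.ofReal_le_ofReal (le_abs_self _)).trans ?_
      rw [← Real.enorm_eq_ofReal_abs]
      exact (enorm_integral_le_lintegral_enorm _).trans
        (lintegral_mono fun q ↦ enorm_integral_le_lintegral_enorm _)
    _ ≤ ∫⁻ q, ∫⁻ q', ENNReal.ofReal (16 * c ^ 2) * ν (B q ∩ B q') ∂ρ ∂ρ :=
      lintegral_mono_ae (hcov.mono fun q hq ↦ lintegral_mono_ae hq)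
    _ = ENNReal.ofReal (16 * c ^ 2) * ∫⁻ x, ρ (Prod.mk x ⁻¹' G) ^ 2 ∂ν := by
      simp_rw [lintegral_const_mul' _ _ ENNReal.ofReal_ne_top]
      rw [lintegral_lintegral_measure_inter hG]

end IsPoissonRandomMeasure

/-! ### Characteristic functions of bipartite Poisson functionals -/

/-- The compensated exponential `x ↦ exp (i x) - 1 - i x`, in terms of which the characteristic
functions of centered Poisson integrals are expressed. -/
noncomputable def compExp (x : ℝ) : ℂ := Complex.exp (.I * x) - 1 - .I * x

@[fun_prop]
lemma continuous_compExp : Continuous compExp := by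
  unfold compExp
  fun_prop

@[fun_prop]
lemma measurable_compExp : Measurable compExp := continuous_compExp.measurable

@[simp] lemma compExp_zero : compExp 0 = 0 := by simp [compExp]

lemma re_compExp (x : ℝ) : (compExp x).re = Real.cos x - 1 := by
  simp [compExp, mul_comm Complex.I, Complex.exp_ofReal_mul_I_re]

lemma re_compExp_nonpos (x : ℝ) : (compExp x).re ≤ 0 := by
  linarith [re_compExp x, Real.cos_le_one x]

lemma norm_compExp_sub_le (x y : ℝ) : ‖compExp x - compExp y‖ ≤ max |x| |y| * |x - y| := by
  have hderiv (v : ℝ) : HasDerivAt compExp (.I * (Complex.exp (.I * v) - 1)) v := by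
    have h : HasDerivAt (fun v : ℝ ↦ (.I * v : ℂ)) .I v := by
      simpa using (Complex.ofRealCLM.hasDerivAt (x := v)).const_mul Complex.I
    refine ((h.cexp.sub_const 1).sub h).congr_deriv ?_
    ring
  refine (convex_uIcc y x).norm_image_sub_le_of_norm_hasDerivWithin_le
    (fun v _ ↦ (hderiv v).hasDerivWithinAt) (fun v hv ↦ ?_) Set.left_mem_uIcc Set.right_mem_uIcc
  calc ‖.I * (Complex.exp (.I * v) - 1)‖ ≤ |v| := by
        simpa using Real.norm_exp_I_mul_ofReal_sub_one_le (x := v)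
    _ ≤ max |x| |y| := by
        rcases Set.mem_uIcc.1 hv with h | h
        · exact (abs_le_max_abs_abs h.1 h.2).trans_eq (max_comm _ _)
        · exact abs_le_max_abs_abs h.1 h.2

lemma norm_compExp_le_sq (x : ℝ) : ‖compExp x‖ ≤ x ^ 2 := by
  simpa [sq] using norm_compExp_sub_le x 0

lemma norm_compExp_le (x : ℝ) : ‖compExp x‖ ≤ 2 * |x| := by
  calc ‖compExp x‖ ≤ ‖Complex.exp (.I * x) - 1‖ + ‖.I * (x : ℂ)‖ := norm_sub_le _ _
    _ ≤ |x| + |x| := add_le_add Real.norm_exp_I_mul_ofReal_sub_one_le (by simp)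
    _ = 2 * |x| := (two_mul _).symm

lemma enorm_exp_sub_exp_le_of_re_nonpos {z w : ℂ} (hz : z.re ≤ 0) (hw : w.re ≤ 0) :
    ‖Complex.exp z - Complex.exp w‖ₑ ≤ ‖z - w‖ₑ := by
  rw [enorm_le_iff_norm_le]
  simpa using (convex_halfSpace_re_le 0).norm_image_sub_le_of_norm_hasDerivWithin_le (C := 1)
    (fun v _ ↦ (Complex.hasDerivAt_exp v).hasDerivWithinAt)
    (fun v hv ↦ by simpa [Complex.norm_exp] using hv) hw hz

lemma re_integral_nonpos {α : Type*} [MeasurableSpace α] {ρ : Measure α} {f : α → ℂ}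
    (hf : ∀ x, (f x).re ≤ 0) : (∫ x, f x ∂ρ).re ≤ 0 := by
  by_cases h : Integrable f ρ
  · rw [← RCLike.re_eq_complex_re, ← integral_re h]
    exact integral_nonpos hf
  · simp [integral_undef h]

lemma integral_measureReal_preimage_prodMk {α β : Type*} [MeasurableSpace α] [MeasurableSpace β]
    {μ : Measure α} {ν : Measure β} [SFinite ν] {s : Set (α × β)}
    (hs : MeasurableSet s) (h : (μ.prod ν) s ≠ ∞) :
    ∫ x, ν.real (Prod.mk x ⁻¹' s) ∂μ = (μ.prod ν).real s := by
  rw [Measure.real, Measure.prod_apply hs]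
  exact integral_toReal (measurable_measure_prodMk_left hs).aemeasurable
    (Measure.ae_measure_lt_top hs h)

lemma integral_measureReal_preimage_prodMk_symm {α β : Type*} [MeasurableSpace α]
    [MeasurableSpace β] {μ : Measure α} [SFinite μ] {ν : Measure β} [SFinite ν] {s : Set (α × β)}
    (hs : MeasurableSet s) (h : (μ.prod ν) s ≠ ∞) :
    Integrable (fun y ↦ μ.real ((fun x ↦ (x, y)) ⁻¹' s)) ν ∧
      ∫ y, μ.real ((fun x ↦ (x, y)) ⁻¹' s) ∂ν = (μ.prod ν).real s := by
  have hs' : MeasurableSet (Prod.swap ⁻¹' s : Set (β × α)) := measurable_swap hs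
  have hswap : (ν.prod μ) (Prod.swap ⁻¹' s) = (μ.prod ν) s := by
    rw [← Measure.map_apply measurable_swap hs, Measure.prod_swap]
  rw [← hswap] at h
  refine ⟨Measure.integrable_measure_prodMk_left hs' h, ?_⟩
  rw [Measure.real, ← hswap]
  exact integral_measureReal_preimage_prodMk hs' h

namespace IsPoissonRandomMeasure

variable {Ω Ω' E E' : Type*} [MeasurableSpace Ω] [MeasurableSpace Ω'] [MeasurableSpace E]
  [MeasurableSpace E'] {N : Kernel Ω E} {N' : Kernel Ω' E'}
  {ν : Measure E} {ν' : Measure E'} [SigmaFinite ν] [SigmaFinite ν']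
  {μ : Measure Ω} {μ' : Measure Ω'} {G : Set (E × E')}

lemma integral_exp_integral_eq_mul (hN : IsPoissonRandomMeasure N ν μ) {f : E → ℝ}
    (hf : Measurable f) (hfν : Integrable f ν) :
    ∫ ω, Complex.exp (.I * (∫ x, f x ∂(N ω) : ℝ)) ∂μ =
      Complex.exp (∫ x, compExp (f x) ∂ν) * Complex.exp (.I * (∫ x, f x ∂ν : ℝ)) := by
  rw [hN.integral_exp_integral hf hfν, ← Complex.exp_add, ← integral_complex_ofReal,
    ← integral_const_mul, ← integral_add]
  · simp [compExp]
  · exact (hfν.norm.const_mul 2).mono' (by fun_prop) (ae_of_all _ fun x ↦ norm_compExp_le _)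
  · exact hfν.ofReal.const_mul _

lemma integral_exp_integral_sub (hN : IsPoissonRandomMeasure N ν μ) {f : E → ℝ}
    (hf : Measurable f) (hfν : Integrable f ν) :
    ∫ ω, Complex.exp (.I * ((∫ x, f x ∂(N ω)) - ∫ x, f x ∂ν : ℝ)) ∂μ =
      Complex.exp (∫ x, compExp (f x) ∂ν) := by
  simp_rw [Complex.ofReal_sub, mul_sub, Complex.exp_sub, integral_div]
  rw [hN.integral_exp_integral_eq_mul hf hfν, mul_div_cancel_right₀ _ (Complex.exp_ne_zero _)]

lemma lintegral_prod_apply_left (hN : IsPoissonRandomMeasure N ν μ) (hG : MeasurableSet G) :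
    ∫⁻ ω, ((N ω).prod ν') G ∂μ = (ν.prod ν') G := by
  simp_rw [Measure.prod_apply hG]
  exact hN.lintegral_lintegral (measurable_measure_prodMk_left hG)

lemma lintegral_prod_apply_right [IsSFiniteKernel N'] (hN' : IsPoissonRandomMeasure N' ν' μ')
    (hG : MeasurableSet G) (m : Measure E) [SFinite m] :
    ∫⁻ ω', (m.prod (N' ω')) G ∂μ' = (m.prod ν') G := by
  simp_rw [Measure.prod_apply_symm hG]
  exact hN'.lintegral_lintegral (measurable_measure_prodMk_right hG)

lemma lintegral_parallelComp_apply [IsSFiniteKernel N] [IsSFiniteKernel N']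
    (hN : IsPoissonRandomMeasure N ν μ) (hN' : IsPoissonRandomMeasure N' ν' μ')
    (hG : MeasurableSet G) :
    ∫⁻ z, (N ∥ₖ N') z G ∂(μ.prod μ') = (ν.prod ν') G := by
  have := hN.isProbabilityMeasure
  have := hN'.isProbabilityMeasure
  rw [lintegral_prod _ ((N ∥ₖ N').measurable_coe hG).aemeasurable]
  simp_rw [Kernel.parallelComp_apply, hN'.lintegral_prod_apply_right hG]
  exact hN.lintegral_prod_apply_left hG

lemma integral_exp_mul_prod_apply [IsSFiniteKernel N'] (hN' : IsPoissonRandomMeasure N' ν' μ')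
    (hG : MeasurableSet G) (m : Measure E) [SFinite m] (hm : (m.prod ν') G ≠ ∞) (s : ℝ) :
    ∫ ω', Complex.exp (.I * (s * (m.prod (N' ω')).real G : ℝ)) ∂μ' =
      Complex.exp (∫ q, compExp (s * m.real ((fun x ↦ (x, q)) ⁻¹' G)) ∂ν') *
        Complex.exp (.I * (s * (m.prod ν').real G : ℝ)) := by
  obtain ⟨hint, hmean⟩ := integral_measureReal_preimage_prodMk_symm hG hm
  have hfin : ∀ᵐ ω' ∂μ', (m.prod (N' ω')) G < ∞ := by
    refine ae_lt_top ?_ (by rwa [hN'.lintegral_prod_apply_right hG])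
    simp_rw [Measure.prod_apply_symm hG]
    exact (measurable_measure_prodMk_right hG).lintegral_kernel
  have hmeas : Measurable fun q ↦ m.real ((fun x ↦ (x, q)) ⁻¹' G) :=
    (measurable_measure_prodMk_right hG).ennreal_toReal
  rw [← hmean, ← integral_const_mul,
    ← hN'.integral_exp_integral_eq_mul (hmeas.const_mul s) (hint.const_mul s)]
  refine integral_congr_ae (hfin.mono fun ω' hω' ↦ ?_)
  simp only [integral_const_mul, (integral_measureReal_preimage_prodMk_symm hG hω'.ne).2]

lemma integral_exp_mul_parallelComp_apply [IsSFiniteKernel N] [IsSFiniteKernel N']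
    (hN : IsPoissonRandomMeasure N ν μ) (hN' : IsPoissonRandomMeasure N' ν' μ')
    (hG : MeasurableSet G) (hνG : (ν.prod ν') G ≠ ∞) (s : ℝ) :
    ∫ z, Complex.exp (.I * (s * ((N ∥ₖ N') z).real G : ℝ)) ∂(μ.prod μ') =
      ∫ ω, Complex.exp (∫ q, compExp (s * (N ω).real ((fun x ↦ (x, q)) ⁻¹' G)) ∂ν') *
        Complex.exp (.I * (∫ p, s * ν'.real (Prod.mk p ⁻¹' G) ∂(N ω) : ℝ)) ∂μ := by
  have := hN.isProbabilityMeasure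
  have := hN'.isProbabilityMeasure
  have hfin : ∀ᵐ ω ∂μ, ((N ω).prod ν') G < ∞ := by
    refine ae_lt_top ?_ (by rwa [hN.lintegral_prod_apply_left hG])
    simp_rw [Measure.prod_apply hG]
    exact (measurable_measure_prodMk_left hG).lintegral_kernel
  have hmeas : Measurable fun z ↦ ((N ∥ₖ N') z).real G :=
    ((N ∥ₖ N').measurable_coe hG).ennreal_toReal
  rw [integral_prod]
  · refine integral_congr_ae (hfin.mono fun ω hω ↦ ?_)
    simp only [Kernel.parallelComp_apply, integral_const_mul,
      hN'.integral_exp_mul_prod_apply hG (N ω) hω.ne, integral_measureReal_preimage_prodMk hG hω.ne]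
  · exact .of_bound (Measurable.aestronglyMeasurable (by fun_prop)) 1
      (ae_of_all _ fun z ↦ (Complex.norm_exp_I_mul_ofReal _).le)

lemma integral_exp_mul_parallelComp_apply_sub [IsSFiniteKernel N] [IsSFiniteKernel N']
    (hN : IsPoissonRandomMeasure N ν μ) (hN' : IsPoissonRandomMeasure N' ν' μ')
    (hG : MeasurableSet G) (hνG : (ν.prod ν') G ≠ ∞) (s : ℝ) :
    ∫ z, Complex.exp (.I * (s * (((N ∥ₖ N') z).real G - (ν.prod ν').real G) : ℝ)) ∂(μ.prod μ') =
      ∫ ω, Complex.exp (∫ q, compExp (s * (N ω).real ((fun x ↦ (x, q)) ⁻¹' G)) ∂ν') *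
        Complex.exp (.I * ((∫ p, s * ν'.real (Prod.mk p ⁻¹' G) ∂(N ω)) -
          ∫ p, s * ν'.real (Prod.mk p ⁻¹' G) ∂ν : ℝ)) ∂μ := by
  have hmean : ∫ p, s * ν'.real (Prod.mk p ⁻¹' G) ∂ν = s * (ν.prod ν').real G := by
    rw [integral_const_mul, integral_measureReal_preimage_prodMk hG hνG]
  simp_rw [hmean, mul_sub s, Complex.ofReal_sub, mul_sub Complex.I, Complex.exp_sub,
    ← mul_div_assoc, integral_div]
  rw [hN.integral_exp_mul_parallelComp_apply hN' hG hνG]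

lemma enorm_integral_exp_sub_le [IsSFiniteKernel N] [IsSFiniteKernel N']
    (hN : IsPoissonRandomMeasure N ν μ) (hN' : IsPoissonRandomMeasure N' ν' μ')
    (hG : MeasurableSet G) (hνG : (ν.prod ν') G ≠ ∞) (s : ℝ) {a : ℂ} (ha : a.re ≤ 0) :
    ‖∫ z, Complex.exp (.I * (s * (((N ∥ₖ N') z).real G - (ν.prod ν').real G) : ℝ)) ∂(μ.prod μ') -
        Complex.exp (a + ∫ p, compExp (s * ν'.real (Prod.mk p ⁻¹' G)) ∂ν)‖ₑ ≤
      ∫⁻ ω, ‖∫ q, compExp (s * (N ω).real ((fun x ↦ (x, q)) ⁻¹' G)) ∂ν' - a‖ₑ ∂μ := by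
  have := hN.isProbabilityMeasure
  set A : Ω → ℂ := fun ω ↦ ∫ q, compExp (s * (N ω).real ((fun x ↦ (x, q)) ⁻¹' G)) ∂ν'
  set g : E → ℝ := fun p ↦ s * ν'.real (Prod.mk p ⁻¹' G)
  have hA : Measurable A := StronglyMeasurable.measurable <| StronglyMeasurable.integral_prod_right
    (measurable_compExp.comp
      ((measurable_kernel_preimage_prodMk N hG).ennreal_toReal.const_mul s)).stronglyMeasurable
  have hAre (ω : Ω) : (A ω).re ≤ 0 := re_integral_nonpos fun _ ↦ re_compExp_nonpos _
  have hg : Measurable g := (measurable_measure_prodMk_left hG).ennreal_toReal.const_mul s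
  have hgν : Integrable g ν := (Measure.integrable_measure_prodMk_left hG hνG).const_mul s
  have hY : Measurable fun ω ↦ ∫ p, g p ∂(N ω) := hg.stronglyMeasurable.integral_kernel.measurable
  have hint {Z : Ω → ℂ} (hZ : Measurable Z) (hZre : ∀ ω, (Z ω).re ≤ 0) : Integrable
      (fun ω ↦ Complex.exp (Z ω) * Complex.exp (.I * ((∫ p, g p ∂(N ω)) - ∫ p, g p ∂ν : ℝ))) μ :=
    .of_bound (Measurable.aestronglyMeasurable (by fun_prop)) 1 (ae_of_all _ fun ω ↦ by
      rw [norm_mul, Complex.norm_exp_I_mul_ofReal, mul_one, Complex.norm_exp]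
      exact Real.exp_le_one_iff.2 (hZre ω))
  rw [hN.integral_exp_mul_parallelComp_apply_sub hN' hG hνG, Complex.exp_add,
    ← hN.integral_exp_integral_sub hg hgν, ← integral_const_mul,
    ← integral_sub (hint hA hAre) (hint measurable_const fun _ ↦ ha)]
  refine (enorm_integral_le_lintegral_enorm _).trans (lintegral_mono fun ω ↦ ?_)
  rw [← mul_sub_right_distrib, enorm_mul, Complex.enorm_exp_I_mul_ofReal, mul_one]
  exact enorm_exp_sub_exp_le_of_re_nonpos (hAre ω) ha

end IsPoissonRandomMeasure

lemma sq_natCast_rpow_neg_half (n : ℕ) : ((n : ℝ) ^ (-(1 / 2) : ℝ)) ^ 2 = (n : ℝ)⁻¹ := by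
  rw [← Real.rpow_mul_natCast n.cast_nonneg, ← Real.rpow_neg_one]
  norm_num

lemma norm_compExp_add_sq_le (x : ℝ) :
    ‖compExp x + (x ^ 2 / 2 : ℝ)‖ ≤ |x| ^ 3 * Real.exp |x| := by
  have h := Complex.norm_exp_sub_sum_le_norm_mul_exp (.I * x) 3
  have hsum : compExp x + (x ^ 2 / 2 : ℝ) =
      Complex.exp (.I * x) - ∑ m ∈ Finset.range 3, (.I * x : ℂ) ^ m / m.factorial := by
    simp only [compExp, Finset.sum_range_succ, Finset.sum_range_zero, Nat.factorial, mul_pow,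
      Complex.I_sq]
    push_cast
    ring
  rw [hsum]
  exact h.trans_eq (by simp)

lemma tendsto_natCast_mul_compExp (x : ℝ) :
    Tendsto (fun n : ℕ ↦ n * compExp ((n : ℝ) ^ (-(1 / 2) : ℝ) * x)) atTop
      (𝓝 (-(x ^ 2 / 2 : ℝ))) := by
  have hs : Tendsto (fun n : ℕ ↦ (n : ℝ) ^ (-(1 / 2) : ℝ)) atTop (𝓝 0) :=
    (tendsto_rpow_neg_atTop (by norm_num)).comp tendsto_natCast_atTop_atTop
  have hbound : Tendsto (fun n : ℕ ↦ |x| ^ 3 * (n : ℝ) ^ (-(1 / 2) : ℝ) *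
      Real.exp |(n : ℝ) ^ (-(1 / 2) : ℝ) * x|) atTop (𝓝 0) := by
    have h := (hs.const_mul (|x| ^ 3)).mul ((Real.continuous_exp.tendsto _).comp
      (hs.mul_const x).abs)
    simpa using h
  refine tendsto_iff_norm_sub_tendsto_zero.2 (squeeze_zero_norm' ?_ hbound)
  filter_upwards [eventually_ge_atTop 1] with n hn
  have hn0 : (n : ℝ) ≠ 0 := by positivity
  set s := (n : ℝ) ^ (-(1 / 2) : ℝ)
  have hs2 : n * s ^ 2 = 1 := by rw [sq_natCast_rpow_neg_half, mul_inv_cancel₀ hn0]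
  have hsub : n * compExp (s * x) - -(x ^ 2 / 2 : ℝ) =
      n * (compExp (s * x) + ((s * x) ^ 2 / 2 : ℝ)) := by
    have : x ^ 2 / 2 = n * ((s * x) ^ 2 / 2) := by linear_combination -(x ^ 2 / 2) * hs2
    rw [this]
    push_cast
    ring
  rw [hsub, norm_norm, norm_mul, Complex.norm_natCast]
  calc n * ‖compExp (s * x) + ((s * x) ^ 2 / 2 : ℝ)‖
    _ ≤ n * (|s * x| ^ 3 * Real.exp |s * x|) := by
      gcongr
      exact norm_compExp_add_sq_le _
    _ = |x| ^ 3 * s * Real.exp |s * x| := by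
      rw [abs_mul, abs_of_nonneg (by positivity : 0 ≤ s)]
      linear_combination |x| ^ 3 * s * Real.exp (s * |x|) * hs2

lemma tendsto_lintegral_enorm_natCast_mul_compExp_add {α : Type*} [MeasurableSpace α]
    {ρ : Measure α} {f : α → ℝ} (hf : MemLp f 2 ρ) :
    Tendsto (fun n : ℕ ↦ ∫⁻ x, ‖n * compExp ((n : ℝ) ^ (-(1 / 2) : ℝ) * f x) +
      (f x ^ 2 / 2 : ℝ)‖ₑ ∂ρ) atTop (𝓝 0) := by
  have hfm := hf.1.aemeasurable
  have h2 : Integrable (fun x ↦ 2 * f x ^ 2) ρ := hf.integrable_sq.const_mul 2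
  rw [← lintegral_zero (α := α) (μ := ρ)]
  refine tendsto_lintegral_of_dominated_convergence' (fun x ↦ ‖2 * f x ^ 2‖ₑ)
    (fun n ↦ by fun_prop) (fun n ↦ ae_of_all _ fun x ↦ ?_) h2.2.ne (ae_of_all _ fun x ↦ ?_)
  · rw [enorm_le_iff_norm_le, Real.norm_of_nonneg (by positivity)]
    have hs : n * ((n : ℝ) ^ (-(1 / 2) : ℝ) * f x) ^ 2 ≤ f x ^ 2 := by
      rw [mul_pow, sq_natCast_rpow_neg_half, ← mul_assoc]
      exact mul_le_of_le_one_left (sq_nonneg _) (mul_inv_le_one)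
    calc ‖n * compExp ((n : ℝ) ^ (-(1 / 2) : ℝ) * f x) + (f x ^ 2 / 2 : ℝ)‖
      _ ≤ n * ((n : ℝ) ^ (-(1 / 2) : ℝ) * f x) ^ 2 + f x ^ 2 / 2 := by
        refine (norm_add_le _ _).trans (add_le_add ?_ ?_)
        · rw [norm_mul, Complex.norm_natCast]
          exact mul_le_mul_of_nonneg_left (norm_compExp_le_sq _) n.cast_nonneg
        · rw [Complex.norm_real, Real.norm_of_nonneg (by positivity)]
      _ ≤ 2 * f x ^ 2 := by linarith [sq_nonneg (f x)]
  · have h := ((tendsto_natCast_mul_compExp (f x)).add_const ((f x ^ 2 / 2 : ℝ) : ℂ)).enorm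
    simpa using h

lemma tendsto_natCast_mul_integral_compExp {α : Type*} [MeasurableSpace α]
    {ρ : Measure α} {f : α → ℝ} (hf : MemLp f 2 ρ) :
    Tendsto (fun n : ℕ ↦ n * ∫ x, compExp ((n : ℝ) ^ (-(1 / 2) : ℝ) * f x) ∂ρ) atTop
      (𝓝 (-((∫ x, f x ^ 2 ∂ρ) / 2) : ℝ)) := by
  have hfm := hf.1.aemeasurable
  have hint (s : ℝ) : Integrable (fun x ↦ compExp (s * f x)) ρ := by
    refine (hf.const_mul s).integrable_sq.mono' (AEMeasurable.aestronglyMeasurable (by fun_prop))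
      (ae_of_all _ fun x ↦ norm_compExp_le_sq _)
  have hlim : Integrable (fun x ↦ (-(f x ^ 2 / 2) : ℝ)) ρ := (hf.integrable_sq.div_const 2).neg
  have h := tendsto_integral_of_L1 (fun x ↦ ((-(f x ^ 2 / 2) : ℝ) : ℂ)) hlim.ofReal.1
    (.of_forall fun n : ℕ ↦ (hint ((n : ℝ) ^ (-(1 / 2) : ℝ))).const_mul (n : ℂ))
    ((tendsto_lintegral_enorm_natCast_mul_compExp_add hf).congr fun n ↦ by simp)
  rw [integral_complex_ofReal, integral_neg, integral_div] at h
  simpa only [integral_const_mul] using h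

/-! ### The connection function on the strip -/

/-- The power `w ^ (-a)` of a mark, in `ℝ≥0∞`. At the null mark `w = 0` it has the junk value `0`
if `a ≠ 0`. -/
noncomputable def markPow (a : ℝ) (w : unitInterval) : ℝ≥0∞ := ENNReal.ofReal ((w : ℝ) ^ (-a))

/-- The mean of `markPow a` over a uniform mark; it is infinite if `1 ≤ a`. -/
noncomputable def markInt (a : ℝ) : ℝ≥0∞ := ∫⁻ w, markPow a w

@[fun_prop]
lemma measurable_markPow (a : ℝ) : Measurable (markPow a) := by
  unfold markPow
  fun_prop

lemma ae_mark_pos : ∀ᵐ w : unitInterval, 0 < (w : ℝ) := by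
  have h : ∀ᵐ w : unitInterval, w ≠ 0 := by simp [ae_iff]
  filter_upwards [h] with w hw
  exact unitInterval.pos_iff_ne_zero.2 hw

lemma markPow_mul_markPow {w : unitInterval} (hw : 0 < (w : ℝ)) (a b : ℝ) :
    markPow a w * markPow b w = markPow (a + b) w := by
  rw [markPow, markPow, markPow, ← ENNReal.ofReal_mul (by positivity), ← Real.rpow_add hw]
  ring_nf

lemma lintegral_markPow_mul_markPow (a b : ℝ) :
    ∫⁻ w, markPow a w * markPow b w = markInt (a + b) :=
  lintegral_congr_ae (ae_mark_pos.mono fun _ hw ↦ markPow_mul_markPow hw a b)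

lemma lintegral_unitInterval (f : ℝ → ℝ≥0∞) :
    ∫⁻ w : unitInterval, f w = ∫⁻ w in Set.Ioc 0 1, f w := by
  rw [unitInterval.volume_def, lintegral_subtype_comap measurableSet_Icc,
    Measure.restrict_congr_set Ioc_ae_eq_Icc]

lemma markInt_ne_top {a : ℝ} (ha : a < 1) : markInt a ≠ ∞ := by
  have h := (intervalIntegral.intervalIntegrable_rpow' (a := 0) (b := 1) (r := -a)
    (by linarith)).1.2
  rw [hasFiniteIntegral_iff_ofReal ((ae_restrict_mem measurableSet_Ioc).mono
    fun x hx ↦ Real.rpow_nonneg hx.1.le _)] at h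
  exact (lintegral_unitInterval fun w ↦ ENNReal.ofReal (w ^ (-a))).trans_ne h.ne

/-- A multiple of Lebesgue measure on the strip, the intensity measure of the point processes. -/
noncomputable abbrev stripMeasure (l : ℝ≥0) : Measure Strip := (l : ℝ≥0∞) • volume

instance sigmaFinite_stripMeasure (l : ℝ≥0) : SigmaFinite (stripMeasure l) :=
  inferInstanceAs (SigmaFinite (l • volume))

lemma ae_stripMeasure_mark_pos (l : ℝ≥0) : ∀ᵐ p ∂(stripMeasure l), 0 < (p.2 : ℝ) :=
  Measure.ae_smul_measure (Measure.quasiMeasurePreserving_snd.ae ae_mark_pos) _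

lemma lintegral_stripMeasure (l : ℝ≥0) {f : Strip → ℝ≥0∞} (hf : Measurable f) :
    ∫⁻ p, f p ∂(stripMeasure l) = l * ∫⁻ u, ∫⁻ x, f (x, u) := by
  rw [stripMeasure, lintegral_smul_measure, smul_eq_mul, Measure.volume_eq_prod,
    lintegral_prod_symm' f hf]

lemma measurableSet_window (n : ℕ) : MeasurableSet (window n) :=
  measurableSet_Icc.preimage measurable_fst

lemma map_snd_restrict_window (l : ℝ≥0) (n : ℕ) :
    ((stripMeasure l).restrict (window n)).map Prod.snd = (n * l : ℝ≥0∞) • volume := by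
  have hW : window n = Set.Icc (0 : ℝ) n ×ˢ Set.univ := by
    ext p
    simp [window]
  rw [stripMeasure, Measure.restrict_smul, Measure.map_smul, Measure.volume_eq_prod, hW,
    ← Measure.prod_restrict, Measure.restrict_univ, Measure.map_snd_prod, smul_smul]
  simp [mul_comm]

lemma setLIntegral_window (l : ℝ≥0) (n : ℕ) {h : unitInterval → ℝ≥0∞} (hh : Measurable h) :
    ∫⁻ p in window n, h p.2 ∂(stripMeasure l) = n * l * ∫⁻ u, h u := by
  rw [← lintegral_map hh measurable_snd, map_snd_restrict_window, lintegral_smul_measure,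
    smul_eq_mul]

lemma stripMeasure_window (l : ℝ≥0) (n : ℕ) : stripMeasure l (window n) = n * l := by
  simpa using setLIntegral_window l n (h := fun _ ↦ 1) measurable_const

section Neighborhoods

variable {γ γ' β : ℝ}

lemma measurable_connF (γ γ' : ℝ) : Measurable fun q : Strip × Strip ↦ connF γ γ' q.1 q.2 := by
  unfold connF
  fun_prop

lemma connF_comm (γ γ' : ℝ) (p p' : Strip) : connF γ γ' p p' = connF γ' γ p' p := by
  simp only [connF, abs_sub_comm p.1 p'.1]
  ring

lemma mem_nbhd_comm {p p' : Strip} : p' ∈ nbhd γ γ' β p ↔ p ∈ nbhd γ' γ β p' := by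
  rw [nbhd, nbhd, Set.mem_ofPred_eq, Set.mem_ofPred_eq, connF_comm]

lemma measurableSet_nbhd (p : Strip) : MeasurableSet (nbhd γ γ' β p) :=
  measurableSet_le ((measurable_connF γ γ').comp measurable_prodMk_left) measurable_const

lemma connF_le_iff {p p' : Strip} (hp : 0 < (p.2 : ℝ)) (hp' : 0 < (p'.2 : ℝ)) :
    connF γ γ' p p' ≤ β ↔ |p.1 - p'.1| ≤ β * (p.2 : ℝ) ^ (-γ) * (p'.2 : ℝ) ^ (-γ') := by
  have := Real.rpow_pos_of_pos hp γ
  have := Real.rpow_pos_of_pos hp' γ'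
  rw [connF, Real.rpow_neg hp.le, Real.rpow_neg hp'.le, mul_assoc, mul_assoc, ← mul_inv,
    ← div_eq_mul_inv, le_div_iff₀ (by positivity)]

lemma volume_setOf_mem_nbhd {p : Strip} (hp : 0 < (p.2 : ℝ)) {w : unitInterval}
    (hw : 0 < (w : ℝ)) : volume {z : ℝ | (z, w) ∈ nbhd γ γ' β p} =
      ENNReal.ofReal (2 * β) * markPow γ p.2 * markPow γ' w := by
  have hset : {z : ℝ | (z, w) ∈ nbhd γ γ' β p} =
      Metric.closedBall p.1 (β * (p.2 : ℝ) ^ (-γ) * (w : ℝ) ^ (-γ')) := by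
    ext z
    rw [Metric.mem_closedBall, dist_comm, Real.dist_eq]
    exact connF_le_iff hp hw
  rw [hset, Real.volume_closedBall, markPow, markPow, ← ENNReal.ofReal_mul' (by positivity),
    ← ENNReal.ofReal_mul' (by positivity)]
  ring_nf

lemma setLIntegral_nbhd (l : ℝ≥0) {p : Strip} (hp : 0 < (p.2 : ℝ)) {h : unitInterval → ℝ≥0∞}
    (hh : Measurable h) :
    ∫⁻ p' in nbhd γ γ' β p, h p'.2 ∂(stripMeasure l) =
      ENNReal.ofReal (2 * β) * markPow γ p.2 *
        (l * ∫⁻ w, h w * markPow γ' w) := by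
  have hN := measurableSet_nbhd (γ := γ) (γ' := γ') (β := β) p
  rw [← lintegral_indicator hN, lintegral_stripMeasure l (Measurable.indicator (by fun_prop) hN),
    mul_left_comm (_ * _)]
  congr 1
  rw [← lintegral_const_mul _ (by fun_prop)]
  refine lintegral_congr_ae (ae_mark_pos.mono fun w hw ↦ ?_)
  have hNw : MeasurableSet {z : ℝ | (z, w) ∈ nbhd γ γ' β p} := hN.preimage measurable_prodMk_right
  change ∫⁻ z : ℝ, {z : ℝ | (z, w) ∈ nbhd γ γ' β p}.indicator (fun _ ↦ h w) z =
    ENNReal.ofReal (2 * β) * markPow γ p.2 * (h w * markPow γ' w)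
  rw [lintegral_indicator_const hNw, volume_setOf_mem_nbhd hp hw]
  ring

lemma stripMeasure_nbhd (l : ℝ≥0) {p : Strip} (hp : 0 < (p.2 : ℝ)) :
    stripMeasure l (nbhd γ γ' β p) =
      ENNReal.ofReal (2 * β) * markPow γ p.2 * (l * markInt γ') := by
  simpa [markInt] using setLIntegral_nbhd l hp (h := fun _ ↦ 1) measurable_const

lemma stripMeasure_nbhd_ne_top (l : ℝ≥0) (hγ' : γ' < 1) {p : Strip} (hp : 0 < (p.2 : ℝ)) :
    stripMeasure l (nbhd γ γ' β p) ≠ ∞ := by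
  rw [stripMeasure_nbhd l hp]
  exact ENNReal.mul_ne_top (ENNReal.mul_ne_top ENNReal.ofReal_ne_top ENNReal.ofReal_ne_top)
    (ENNReal.mul_ne_top ENNReal.coe_ne_top (markInt_ne_top hγ'))

lemma lintegral_stripMeasure_window_inter_nbhd_mul (l l' : ℝ≥0) (n : ℕ) {h : unitInterval → ℝ≥0∞}
    (hh : Measurable h) :
    ∫⁻ p', stripMeasure l (window n ∩ nbhd γ' γ β p') * h p'.2 ∂(stripMeasure l') =
      n * (l * ENNReal.ofReal (2 * β) * markInt γ) *
        (l' * ∫⁻ w, h w * markPow γ' w) := by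
  have hmeas : Measurable fun q : Strip × Strip ↦
      (window n).indicator 1 q.1 * (nbhd γ γ' β q.1).indicator (fun p' ↦ h p'.2) q.2 := by
    refine ((measurable_one.indicator (measurableSet_window n)).comp measurable_fst).mul ?_
    exact (hh.comp (measurable_snd.comp measurable_snd)).indicator
      (measurableSet_le (measurable_connF γ γ') measurable_const)
  calc ∫⁻ p', stripMeasure l (window n ∩ nbhd γ' γ β p') * h p'.2 ∂(stripMeasure l')
    _ = ∫⁻ p', ∫⁻ p, (window n).indicator 1 p *
          (nbhd γ γ' β p).indicator (fun p' ↦ h p'.2) p' ∂(stripMeasure l) ∂(stripMeasure l') := by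
      refine lintegral_congr fun p' ↦ ?_
      rw [← lintegral_indicator_one ((measurableSet_window n).inter (measurableSet_nbhd p')),
        ← lintegral_mul_const _ (measurable_one.indicator
          ((measurableSet_window n).inter (measurableSet_nbhd p')))]
      refine lintegral_congr fun p ↦ ?_
      by_cases hpp' : p' ∈ nbhd γ γ' β p <;> by_cases hp : p ∈ window n <;>
        simp [hp, hpp', ← mem_nbhd_comm]
    _ = ∫⁻ p in window n, ∫⁻ p' in nbhd γ γ' β p, h p'.2 ∂(stripMeasure l') ∂(stripMeasure l) := by
      rw [lintegral_lintegral_swap (f := fun p' p ↦ (window n).indicator 1 p *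
        (nbhd γ γ' β p).indicator (fun p' ↦ h p'.2) p') (hmeas.comp measurable_swap).aemeasurable,
        ← lintegral_indicator (measurableSet_window n)]
      refine lintegral_congr fun p ↦ ?_
      by_cases hp : p ∈ window n <;> simp [hp, lintegral_indicator (measurableSet_nbhd p)]
    _ = _ := by
      rw [lintegral_congr_ae (ae_restrict_of_ae ((ae_stripMeasure_mark_pos l).mono
        fun p hp ↦ setLIntegral_nbhd l' hp hh)), lintegral_mul_const _ (by fun_prop),
        setLIntegral_window l n (h := fun u ↦ ENNReal.ofReal (2 * β) * markPow γ u) (by fun_prop),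
        lintegral_const_mul _ (by fun_prop), markInt]
      ring

end Neighborhoods

section Edges

variable {γ γ' β : ℝ}

/-- The edges of the bipartite graph on the whole strip. The section at the second endpoint `q` is
`nbhd γ' γ β q` by definition; the section at the first endpoint `p` is `nbhd γ γ' β p`. -/
def bipEdges (γ γ' β : ℝ) : Set (Strip × Strip) := {q | q.1 ∈ nbhd γ' γ β q.2}

/-- The edges of the bipartite graph on the whole strip with first endpoint in `window n`. -/
def windowEdges (γ γ' β : ℝ) (n : ℕ) : Set (Strip × Strip) :=
  {q | q.1 ∈ window n ∩ nbhd γ' γ β q.2}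

lemma measurableSet_bipEdges : MeasurableSet (bipEdges γ γ' β) :=
  measurableSet_le ((measurable_connF γ' γ).comp measurable_swap) measurable_const

lemma measurableSet_windowEdges (n : ℕ) : MeasurableSet (windowEdges γ γ' β n) :=
  ((measurableSet_window n).preimage measurable_fst).inter measurableSet_bipEdges

lemma prodMk_preimage_bipEdges (p : Strip) : Prod.mk p ⁻¹' bipEdges γ γ' β = nbhd γ γ' β p :=
  Set.ext fun _ ↦ mem_nbhd_comm.symm

lemma prodMk_preimage_windowEdges_of_mem {n : ℕ} {p : Strip} (hp : p ∈ window n) :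
    Prod.mk p ⁻¹' windowEdges γ γ' β n = nbhd γ γ' β p := by
  rw [← prodMk_preimage_bipEdges]
  exact Set.ext fun _ ↦ and_iff_right hp

lemma prodMk_preimage_windowEdges_of_notMem {n : ℕ} {p : Strip} (hp : p ∉ window n) :
    Prod.mk p ⁻¹' windowEdges γ γ' β n = ∅ :=
  Set.eq_empty_of_forall_notMem fun _ hq ↦ hp hq.1

lemma prod_windowEdges_ne_top (hγ : γ < 1) (hγ' : γ' < 1) (l l' : ℝ≥0) (n : ℕ) :
    ((stripMeasure l).prod (stripMeasure l')) (windowEdges γ γ' β n) ≠ ∞ := by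
  have h := lintegral_stripMeasure_window_inter_nbhd_mul (γ := γ) (γ' := γ') (β := β) l l' n
    (h := fun _ ↦ 1) measurable_const
  simp only [mul_one, one_mul] at h
  rw [Measure.prod_apply_symm (measurableSet_windowEdges n)]
  refine h.trans_ne (ENNReal.mul_ne_top ?_ ?_)
  · exact ENNReal.mul_ne_top (ENNReal.natCast_ne_top n)
      (ENNReal.mul_ne_top (by finiteness) (markInt_ne_top hγ))
  · exact ENNReal.mul_ne_top (by finiteness) (markInt_ne_top hγ')

end Edges

/-! ### Edges across the border of the window -/

section BorderEdges

variable {γ γ' β : ℝ}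

/-- The edges of the bipartite graph with exactly one endpoint in `window n`. -/
def borderEdges (γ γ' β : ℝ) (n : ℕ) : Set (Strip × Strip) :=
  {q | q.1 ∈ nbhd γ' γ β q.2 ∧ ¬(q.1 ∈ window n ↔ q.2 ∈ window n)}

lemma measurableSet_borderEdges (n : ℕ) : MeasurableSet (borderEdges γ γ' β n) :=
  measurableSet_bipEdges.inter
    (((measurableSet_window n).preimage measurable_fst).iff
      ((measurableSet_window n).preimage measurable_snd)).compl

/-- The pairs of points of the line at distance at most `r` with exactly one of them in
`[0, n]`. -/
def borderPairs (r : ℝ) (n : ℕ) : Set (ℝ × ℝ) :=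
  {q | |q.1 - q.2| ≤ r ∧ ¬(q.1 ∈ Set.Icc (0 : ℝ) n ↔ q.2 ∈ Set.Icc (0 : ℝ) n)}

lemma measurableSet_abs_sub_le (r : ℝ) : MeasurableSet {q : ℝ × ℝ | |q.1 - q.2| ≤ r} :=
  measurableSet_le (by fun_prop) measurable_const

lemma measurableSet_borderPairs (r : ℝ) (n : ℕ) : MeasurableSet (borderPairs r n) :=
  (measurableSet_abs_sub_le r).inter
    ((measurableSet_Icc.preimage measurable_fst).iff
      (measurableSet_Icc.preimage measurable_snd)).compl

lemma volume_fst_preimage_inter_abs_sub_le {A : Set ℝ} (hA : MeasurableSet A) (r : ℝ) :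
    volume (Prod.fst ⁻¹' A ∩ {q : ℝ × ℝ | |q.1 - q.2| ≤ r}) =
      ENNReal.ofReal (2 * r) * volume A := by
  rw [Measure.volume_eq_prod, Measure.prod_apply
    ((hA.preimage measurable_fst).inter (measurableSet_abs_sub_le r)),
    ← lintegral_indicator_const hA]
  refine lintegral_congr fun x ↦ ?_
  by_cases hx : x ∈ A
  · simp [Set.preimage, Set.inter_def, hx, ← Real.volume_closedBall x r, Metric.closedBall,
      Real.dist_eq, abs_sub_comm x]
  · simp [Set.preimage, Set.inter_def, hx]

lemma volume_snd_preimage_inter_abs_sub_le {A : Set ℝ} (hA : MeasurableSet A) (r : ℝ) :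
    volume (Prod.snd ⁻¹' A ∩ {q : ℝ × ℝ | |q.1 - q.2| ≤ r}) =
      ENNReal.ofReal (2 * r) * volume A := by
  rw [← volume_fst_preimage_inter_abs_sub_le hA, Measure.volume_eq_prod,
    ← Measure.measurePreserving_swap.measure_preimage
    (((hA.preimage measurable_fst).inter (measurableSet_abs_sub_le r)).nullMeasurableSet)]
  simp [Set.preimage, Set.inter_def, abs_sub_comm]

lemma volume_borderPairs_le_mul (r : ℝ) (n : ℕ) :
    volume (borderPairs r n) ≤ n * (2 * ENNReal.ofReal (2 * r)) := by
  have hsub : borderPairs r n ⊆ Prod.fst ⁻¹' Set.Icc (0 : ℝ) n ∩ {q | |q.1 - q.2| ≤ r} ∪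
      Prod.snd ⁻¹' Set.Icc (0 : ℝ) n ∩ {q | |q.1 - q.2| ≤ r} := by
    rintro q ⟨hr, hq⟩
    simp only [Set.mem_union, Set.mem_inter_iff, Set.mem_preimage, Set.mem_ofPred_eq]
    tauto
  refine (measure_mono hsub).trans ((measure_union_le _ _).trans_eq ?_)
  rw [volume_fst_preimage_inter_abs_sub_le measurableSet_Icc,
    volume_snd_preimage_inter_abs_sub_le measurableSet_Icc, Real.volume_Icc, sub_zero,
    ENNReal.ofReal_natCast]
  ring

lemma volume_borderPairs_le (r : ℝ) (n : ℕ) :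
    volume (borderPairs r n) ≤ 2 * ENNReal.ofReal (2 * r) ^ 2 := by
  have hsub : borderPairs r n ⊆
      Prod.fst ⁻¹' (Set.Icc (-r) r ∪ Set.Icc (n - r) (n + r)) ∩ {q | |q.1 - q.2| ≤ r} := by
    rintro q ⟨hr, hq⟩
    refine ⟨?_, hr⟩
    simp only [Set.mem_preimage, Set.mem_union, Set.mem_Icc] at hq ⊢
    rw [abs_le] at hr
    by_contra! h
    grind
  have hvol : volume (Set.Icc (-r) r ∪ Set.Icc (n - r) (n + r)) ≤ 2 * ENNReal.ofReal (2 * r) := by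
    refine (measure_union_le _ _).trans_eq ?_
    rw [Real.volume_Icc, Real.volume_Icc]
    ring_nf
  refine (measure_mono hsub).trans ?_
  rw [volume_fst_preimage_inter_abs_sub_le (measurableSet_Icc.union measurableSet_Icc)]
  exact (mul_le_mul_right hvol _).trans_eq (by ring)

lemma setOf_mem_borderEdges {u w : unitInterval} (hu : 0 < (u : ℝ)) (hw : 0 < (w : ℝ)) (n : ℕ)
    (z : ℝ) : {x : ℝ | ((x, u), (z, w)) ∈ borderEdges γ γ' β n} =
      (fun x ↦ (x, z)) ⁻¹' borderPairs (β * (u : ℝ) ^ (-γ) * (w : ℝ) ^ (-γ')) n := by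
  ext x
  refine and_congr_left fun _ ↦ ?_
  rw [← mem_nbhd_comm]
  exact connF_le_iff (p := (x, u)) (p' := (z, w)) hu hw

lemma measurable_volume_borderPairs {α : Type*} [MeasurableSpace α] {r : α → ℝ}
    (hr : Measurable r) (n : ℕ) : Measurable fun a ↦ volume (borderPairs (r a) n) := by
  refine (measurable_measure_prodMk_left
    (s := {z : ℝ × ℝ × ℝ | z.2 ∈ borderPairs z.1 n}) ?_).comp hr
  have hle : MeasurableSet {z : ℝ × ℝ × ℝ | |z.2.1 - z.2.2| ≤ z.1} :=
    measurableSet_le (by fun_prop) (by fun_prop)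
  exact hle.inter ((measurableSet_Icc.preimage (measurable_fst.comp measurable_snd)).iff
      (measurableSet_Icc.preimage (measurable_snd.comp measurable_snd))).compl

lemma stripMeasure_preimage_borderEdges (l : ℝ≥0) (n : ℕ) (q : Strip) :
    stripMeasure l ((fun p ↦ (p, q)) ⁻¹' borderEdges γ γ' β n) =
      l * ∫⁻ u, volume {x : ℝ | ((x, u), q) ∈ borderEdges γ γ' β n} := by
  rw [stripMeasure, Measure.smul_apply, smul_eq_mul, Measure.volume_eq_prod,
    Measure.prod_apply_symm ((measurableSet_borderEdges n).preimage measurable_prodMk_right)]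
  rfl

lemma lintegral_stripMeasure_borderEdges_mul (l l' : ℝ≥0) (n : ℕ) {h : unitInterval → ℝ≥0∞}
    (hh : Measurable h) :
    ∫⁻ q, stripMeasure l ((fun p ↦ (p, q)) ⁻¹' borderEdges γ γ' β n) * h q.2 ∂(stripMeasure l') =
      l' * l * ∫⁻ m : unitInterval × unitInterval,
        volume (borderPairs (β * (m.2 : ℝ) ^ (-γ) * (m.1 : ℝ) ^ (-γ')) n) * h m.1 := by
  have hsec : Measurable fun q : Strip ↦
      stripMeasure l ((fun p ↦ (p, q)) ⁻¹' borderEdges γ γ' β n) * h q.2 :=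
    (measurable_measure_prodMk_right (measurableSet_borderEdges n)).mul (by fun_prop)
  have hvol : Measurable fun m : unitInterval × unitInterval ↦
      volume (borderPairs (β * (m.2 : ℝ) ^ (-γ) * (m.1 : ℝ) ^ (-γ')) n) * h m.1 :=
    (measurable_volume_borderPairs (by fun_prop) n).mul (by fun_prop)
  rw [lintegral_stripMeasure l' hsec, mul_assoc, Measure.volume_eq_prod (α := unitInterval),
    lintegral_prod _ hvol.aemeasurable]
  congr 1
  rw [← lintegral_const_mul' _ _ ENNReal.coe_ne_top]
  refine lintegral_congr_ae (ae_mark_pos.mono fun w hw ↦ ?_)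
  have hw_meas : Measurable fun z : ℝ × unitInterval ↦
      volume {x : ℝ | ((x, z.2), (z.1, w)) ∈ borderEdges γ γ' β n} :=
    measurable_measure_prodMk_right
      (s := {z : ℝ × ℝ × unitInterval | ((z.1, z.2.2), (z.2.1, w)) ∈ borderEdges γ γ' β n})
      ((measurableSet_borderEdges n).preimage (by fun_prop))
  simp only [stripMeasure_preimage_borderEdges]
  rw [lintegral_mul_const _ (hw_meas.lintegral_prod_right'.const_mul _),
    lintegral_const_mul _ hw_meas.lintegral_prod_right', mul_assoc,
    lintegral_lintegral_swap (f := fun z u ↦ volume {x : ℝ | ((x, u), (z, w)) ∈ _})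
      hw_meas.aemeasurable, ← lintegral_mul_const _ hw_meas.lintegral_prod_left']
  congr 1
  refine lintegral_congr_ae (ae_mark_pos.mono fun u hu ↦ ?_)
  simp only [setOf_mem_borderEdges hu hw]
  rw [Measure.volume_eq_prod, Measure.prod_apply_symm (measurableSet_borderPairs _ n)]

lemma tendsto_inv_mul_volume_borderPairs (r : ℝ) :
    Tendsto (fun n : ℕ ↦ (n : ℝ≥0∞)⁻¹ * volume (borderPairs r n)) atTop (𝓝 0) := by
  refine tendsto_of_tendsto_of_tendsto_of_le_of_le tendsto_const_nhds ?_ (fun _ ↦ zero_le)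
    fun n ↦ mul_le_mul_right (volume_borderPairs_le r n) _
  simpa using ENNReal.Tendsto.mul_const ENNReal.tendsto_inv_nat_nhds_zero
    (.inr (by finiteness : 2 * ENNReal.ofReal (2 * r) ^ 2 ≠ ∞))

lemma inv_mul_volume_borderPairs_le (r : ℝ) (n : ℕ) :
    (n : ℝ≥0∞)⁻¹ * volume (borderPairs r n) ≤ 2 * ENNReal.ofReal (2 * r) := by
  calc (n : ℝ≥0∞)⁻¹ * volume (borderPairs r n)
    _ ≤ (n : ℝ≥0∞)⁻¹ * (n * (2 * ENNReal.ofReal (2 * r))) := by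
      gcongr
      exact volume_borderPairs_le_mul r n
    _ ≤ 2 * ENNReal.ofReal (2 * r) := by
      rw [← mul_assoc]
      exact mul_le_of_le_one_left' (ENNReal.inv_mul_le_one _)

lemma tendsto_inv_mul_lintegral_borderEdges (hγ : γ < 1) (l l' : ℝ≥0) {h : unitInterval → ℝ≥0∞}
    (hh : Measurable h) (hh_top : ∀ w, h w ≠ ∞) (hfin : ∫⁻ w, h w * markPow γ' w ≠ ∞) :
    Tendsto (fun n : ℕ ↦ (n : ℝ≥0∞)⁻¹ * ∫⁻ q, stripMeasure l
      ((fun p ↦ (p, q)) ⁻¹' borderEdges γ γ' β n) * h q.2 ∂(stripMeasure l')) atTop (𝓝 0) := by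
  let r (m : unitInterval × unitInterval) : ℝ := β * (m.2 : ℝ) ^ (-γ) * (m.1 : ℝ) ^ (-γ')
  let f (n : ℕ) (m : unitInterval × unitInterval) : ℝ≥0∞ :=
    (n : ℝ≥0∞)⁻¹ * volume (borderPairs (r m) n) * h m.1
  have hvol (n : ℕ) : Measurable fun m ↦ volume (borderPairs (r m) n) :=
    measurable_volume_borderPairs (by fun_prop) n
  have hf (n : ℕ) : Measurable (f n) := ((hvol n).const_mul _).mul (by fun_prop)
  have hr (m : unitInterval × unitInterval) : 2 * ENNReal.ofReal (2 * r m) * h m.1 =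
      2 * ENNReal.ofReal (2 * β) * (h m.1 * markPow γ' m.1 * markPow γ m.2) := by
    rw [show 2 * r m = 2 * β * (m.2 : ℝ) ^ (-γ) * (m.1 : ℝ) ^ (-γ') by ring,
      ENNReal.ofReal_mul' (Real.rpow_nonneg m.1.2.1 _),
      ENNReal.ofReal_mul' (Real.rpow_nonneg m.2.2.1 _), markPow, markPow]
    ring
  have hbound : ∫⁻ m, 2 * ENNReal.ofReal (2 * r m) * h m.1 ≠ ∞ := by
    simp_rw [hr]
    rw [lintegral_const_mul _ (by fun_prop), Measure.volume_eq_prod,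
      lintegral_prod_mul (f := fun w ↦ h w * markPow γ' w) (by fun_prop) (by fun_prop)]
    exact ENNReal.mul_ne_top (by finiteness) (ENNReal.mul_ne_top hfin (markInt_ne_top hγ))
  have hlim : Tendsto (fun n ↦ ∫⁻ m, f n m) atTop (𝓝 0) := by
    simpa using tendsto_lintegral_of_dominated_convergence (F := f) (f := fun _ ↦ 0) _ hf
      (fun n ↦ ae_of_all _ fun m ↦ mul_le_mul_left (inv_mul_volume_borderPairs_le (r m) n) _)
      hbound (ae_of_all _ fun m ↦ by
        simpa using ENNReal.Tendsto.mul_const (tendsto_inv_mul_volume_borderPairs (r m))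
          (.inr (hh_top m.1)))
  have hcoord (n : ℕ) : (n : ℝ≥0∞)⁻¹ * ∫⁻ q, stripMeasure l
      ((fun p ↦ (p, q)) ⁻¹' borderEdges γ γ' β n) * h q.2 ∂(stripMeasure l') =
      l' * l * ∫⁻ m, f n m := by
    rw [lintegral_stripMeasure_borderEdges_mul l l' n hh, mul_left_comm,
      ← lintegral_const_mul (f := fun m ↦ volume (borderPairs (r m) n) * h m.1) _
        ((hvol n).mul (by fun_prop))]
    simp only [f, r, mul_assoc]
  simp_rw [hcoord]
  simpa using ENNReal.Tendsto.const_mul hlim (.inr (by finiteness))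

end BorderEdges

/-! ### Spatial averages of the degrees -/

section Averages

variable {Ω : Type*} [MeasurableSpace Ω] {μ : Measure Ω} {N : Kernel Ω Strip} {γ γ' β : ℝ}
  {l l' : ℝ≥0}

/-- The number of neighbors in `N` of a vertex with location `0` and a given mark. -/
noncomputable def originDegree (γ γ' β : ℝ) (N : Kernel Ω Strip) (z : Ω × unitInterval) : ℝ≥0∞ :=
  N z.1 (nbhd γ' γ β (0, z.2))

lemma measurable_apply_nbhd [IsSFiniteKernel N] :
    Measurable fun z : Ω × Strip ↦ N z.1 (nbhd γ' γ β z.2) :=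
  measurable_kernel_preimage_prodMk N measurableSet_bipEdges

lemma measurable_originDegree [IsSFiniteKernel N] : Measurable (originDegree γ γ' β N) :=
  measurable_apply_nbhd.comp (f := fun z : Ω × unitInterval ↦ (z.1, ((0 : ℝ), z.2)))
    (by fun_prop)

lemma map_apply_nbhd_restrict_window [IsSFiniteKernel N]
    (hN : IsPoissonRandomMeasure N (stripMeasure l) μ) (hγ : γ < 1) (n : ℕ) :
    (μ.prod ((stripMeasure l').restrict (window n))).map (fun z ↦ N z.1 (nbhd γ' γ β z.2)) =
      (n * l' : ℝ≥0∞) • (μ.prod volume).map (originDegree γ γ' β N) := by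
  have := hN.isProbabilityMeasure
  ext s hs
  have hlaw (p : Strip) (hp : 0 < (p.2 : ℝ)) :
      μ {ω | N ω (nbhd γ' γ β p) ∈ s} = μ {ω | originDegree γ γ' β N (ω, p.2) ∈ s} := by
    have h0 : stripMeasure l (nbhd γ' γ β p) = stripMeasure l (nbhd γ' γ β (0, p.2)) := by
      rw [stripMeasure_nbhd l hp, stripMeasure_nbhd l (p := (0, p.2)) hp]
    have h := congrArg (fun m ↦ m s) (hN.map_apply_congr (measurableSet_nbhd p)
      (measurableSet_nbhd (0, p.2)) (stripMeasure_nbhd_ne_top l hγ hp) h0)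
    rwa [Measure.map_apply (N.measurable_coe (measurableSet_nbhd _)) hs,
      Measure.map_apply (N.measurable_coe (measurableSet_nbhd _)) hs] at h
  rw [Measure.map_apply measurable_apply_nbhd hs, Measure.smul_apply, smul_eq_mul,
    Measure.map_apply measurable_originDegree hs,
    Measure.prod_apply_symm (measurable_apply_nbhd hs),
    Measure.prod_apply_symm (measurable_originDegree hs),
    ← setLIntegral_window l' n (measurable_measure_prodMk_right (measurable_originDegree hs))]
  exact lintegral_congr_ae (ae_restrict_of_ae ((ae_stripMeasure_mark_pos l').mono hlaw))

/-- The mean number of neighbors in a Poisson process of density `l` of a vertex with a given mark.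
It agrees with `stripMeasure l (nbhd γ' γ β q)` except at the null mark. -/
noncomputable def meanDegree (γ γ' β : ℝ) (l : ℝ≥0) (w : unitInterval) : ℝ≥0∞ :=
  ENNReal.ofReal (2 * β) * markPow γ' w * (l * markInt γ)

lemma stripMeasure_nbhd_eq_meanDegree (l : ℝ≥0) {q : Strip} (hq : 0 < (q.2 : ℝ)) :
    stripMeasure l (nbhd γ' γ β q) = meanDegree γ γ' β l q.2 :=
  stripMeasure_nbhd l hq

@[fun_prop]
lemma measurable_meanDegree : Measurable (meanDegree γ γ' β l) := by
  unfold meanDegree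
  fun_prop

lemma meanDegree_ne_top (hγ : γ < 1) (w : unitInterval) : meanDegree γ γ' β l w ≠ ∞ :=
  ENNReal.mul_ne_top (ENNReal.mul_ne_top ENNReal.ofReal_ne_top ENNReal.ofReal_ne_top)
    (ENNReal.mul_ne_top ENNReal.coe_ne_top (markInt_ne_top hγ))

lemma lintegral_meanDegree_add_one_mul_markPow_ne_top (hγ : γ < 1) (hγ' : γ' < 1 / 2) :
    ∫⁻ w, (meanDegree γ γ' β l w + 1) * markPow γ' w ≠ ∞ := by
  have hC := ENNReal.mul_ne_top (ENNReal.coe_ne_top (r := l)) (markInt_ne_top hγ)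
  have h (w : unitInterval) : (meanDegree γ γ' β l w + 1) * markPow γ' w =
      ENNReal.ofReal (2 * β) * (l * markInt γ) * (markPow γ' w * markPow γ' w) + markPow γ' w := by
    rw [meanDegree]
    ring
  simp_rw [h]
  rw [lintegral_add_left (by fun_prop), lintegral_const_mul _ (by fun_prop),
    lintegral_markPow_mul_markPow]
  exact ENNReal.add_ne_top.2 ⟨ENNReal.mul_ne_top (ENNReal.mul_ne_top ENNReal.ofReal_ne_top hC)
    (markInt_ne_top (by linarith)), markInt_ne_top (by linarith)⟩

lemma lintegral_originDegree_sq [IsSFiniteKernel N]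
    (hN : IsPoissonRandomMeasure N (stripMeasure l) μ) (hγ : γ < 1) :
    ∫⁻ z, originDegree γ γ' β N z ^ 2 ∂(μ.prod volume) =
      ∫⁻ w, (meanDegree γ γ' β l w ^ 2 + meanDegree γ γ' β l w) := by
  have := hN.isProbabilityMeasure
  rw [lintegral_prod_symm' _ (measurable_originDegree.pow_const 2)]
  refine lintegral_congr_ae (ae_mark_pos.mono fun w hw ↦ ?_)
  simp only [← stripMeasure_nbhd_eq_meanDegree l (q := (0, w)) hw]
  exact hN.lintegral_apply_sq_of_ne_top (measurableSet_nbhd _)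
    (stripMeasure_nbhd_ne_top l hγ (p := (0, w)) hw)

lemma memLp_originDegree [IsSFiniteKernel N] (hN : IsPoissonRandomMeasure N (stripMeasure l) μ)
    (hγ : γ < 1) (hγ' : γ' < 1 / 2) :
    MemLp (fun z ↦ (originDegree γ γ' β N z).toReal) 2 (μ.prod volume) := by
  rw [memLp_two_iff_integrable_sq measurable_originDegree.ennreal_toReal.aestronglyMeasurable]
  simp_rw [← ENNReal.toReal_pow]
  refine integrable_toReal_of_lintegral_ne_top (measurable_originDegree.pow_const 2).aemeasurable ?_
  have hmul (w : unitInterval) : meanDegree γ γ' β l w ^ 2 + meanDegree γ γ' β l w =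
      ENNReal.ofReal (2 * β) * (l * markInt γ) *
        ((meanDegree γ γ' β l w + 1) * markPow γ' w) := by
    rw [meanDegree]
    ring
  simp_rw [lintegral_originDegree_sq hN hγ, hmul]
  rw [lintegral_const_mul _ (by fun_prop)]
  exact ENNReal.mul_ne_top (ENNReal.mul_ne_top ENNReal.ofReal_ne_top
      (ENNReal.mul_ne_top ENNReal.coe_ne_top (markInt_ne_top hγ)))
    (lintegral_meanDegree_add_one_mul_markPow_ne_top hγ hγ')

lemma lintegral_restrict_window_nbhd_sq_le (n : ℕ) :
    ∫⁻ p, (stripMeasure l').restrict (window n) (nbhd γ γ' β p) ^ 2 ∂(stripMeasure l) ≤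
      n * (l * (ENNReal.ofReal (2 * β) * (l' * markInt γ')) ^ 2 * markInt (γ + γ)) := by
  have h := lintegral_stripMeasure_window_inter_nbhd_mul (γ := γ') (γ' := γ) (β := β) l' l n
    (h := fun u ↦ ENNReal.ofReal (2 * β) * markPow γ u * (l' * markInt γ')) (by fun_prop)
  calc ∫⁻ p, (stripMeasure l').restrict (window n) (nbhd γ γ' β p) ^ 2 ∂(stripMeasure l)
    _ ≤ ∫⁻ p, stripMeasure l' (window n ∩ nbhd γ γ' β p) *
          (ENNReal.ofReal (2 * β) * markPow γ p.2 * (l' * markInt γ')) ∂(stripMeasure l) := by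
      refine lintegral_mono_ae ((ae_stripMeasure_mark_pos l).mono fun p hp ↦ ?_)
      rw [Measure.restrict_apply (measurableSet_nbhd p), Set.inter_comm, sq,
        ← stripMeasure_nbhd l' hp]
      gcongr
      exact Set.inter_subset_right
    _ = _ := by
      have hsq (u : unitInterval) : ENNReal.ofReal (2 * β) * markPow γ u * (l' * markInt γ') *
          markPow γ u = ENNReal.ofReal (2 * β) * (l' * markInt γ') *
            (markPow γ u * markPow γ u) := by
        ring
      simp_rw [h, hsq]
      rw [lintegral_const_mul _ (by fun_prop), lintegral_markPow_mul_markPow]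
      ring

lemma lintegral_enorm_sub_integral_le {X : Ω → ℝ} [IsProbabilityMeasure μ]
    (hX : AEStronglyMeasurable X μ) :
    ∫⁻ ω, ‖X ω - μ[X]‖ₑ ∂μ ≤ evariance X μ ^ (1 / 2 : ℝ) := by
  have h := eLpNorm_le_eLpNorm_of_exponent_le (μ := μ) (p := 1) (q := 2) one_le_two
    (hX.sub aestronglyMeasurable_const : AEStronglyMeasurable (fun ω ↦ X ω - μ[X]) μ)
  rw [eLpNorm_one_eq_lintegral_enorm] at h
  refine h.trans_eq ?_
  rw [eLpNorm_eq_lintegral_rpow_enorm_toReal two_ne_zero ENNReal.ofNat_ne_top, evariance]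
  simp

lemma lintegral_setLIntegral_window [IsSFiniteKernel N]
    (hN : IsPoissonRandomMeasure N (stripMeasure l) μ) (hγ : γ < 1) {φ : ℝ≥0∞ → ℝ≥0∞}
    (hφ : Measurable φ) (n : ℕ) :
    ∫⁻ ω, ∫⁻ q in window n, φ (N ω (nbhd γ' γ β q)) ∂(stripMeasure l') ∂μ =
      n * l' * ∫⁻ z, φ (originDegree γ γ' β N z) ∂(μ.prod volume) := by
  rw [← lintegral_prod (fun z : Ω × Strip ↦ φ (N z.1 (nbhd γ' γ β z.2)))
      (hφ.comp measurable_apply_nbhd).aemeasurable,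
    ← lintegral_map hφ measurable_apply_nbhd, map_apply_nbhd_restrict_window hN hγ,
    lintegral_smul_measure, lintegral_map hφ measurable_originDegree, smul_eq_mul]

section Window

variable [IsSFiniteKernel N] {φ : ℝ≥0∞ → ℝ}

lemma integrable_apply_nbhd_window (hN : IsPoissonRandomMeasure N (stripMeasure l) μ) (hγ : γ < 1)
    (hφ : Measurable φ) (hint : Integrable (fun z ↦ φ (originDegree γ γ' β N z)) (μ.prod volume))
    (n : ℕ) : Integrable (fun z ↦ φ (N z.1 (nbhd γ' γ β z.2)))
      (μ.prod ((stripMeasure l').restrict (window n))) := by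
  refine Integrable.comp_measurable (g := φ) (f := fun z : Ω × Strip ↦ N z.1 (nbhd γ' γ β z.2)) ?_
    measurable_apply_nbhd
  rw [map_apply_nbhd_restrict_window hN hγ]
  refine Integrable.smul_measure ?_ (by finiteness)
  rwa [integrable_map_measure hφ.aestronglyMeasurable measurable_originDegree.aemeasurable]

/-- The average over `window n` of a function of the degrees, where `l'` is the density of the
vertices with neighbors in `N`. -/
noncomputable def windowAverage (γ γ' β : ℝ) (l' : ℝ≥0) (N : Kernel Ω Strip) (φ : ℝ≥0∞ → ℝ) (n : ℕ)
    (ω : Ω) : ℝ :=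
  (n : ℝ)⁻¹ * ∫ q in window n, φ (N ω (nbhd γ' γ β q)) ∂(stripMeasure l')

lemma integral_windowAverage (hN : IsPoissonRandomMeasure N (stripMeasure l) μ)
    (hγ : γ < 1) (hφ : Measurable φ)
    (hint : Integrable (fun z ↦ φ (originDegree γ γ' β N z)) (μ.prod volume))
    {n : ℕ} (hn : n ≠ 0) :
    μ[windowAverage γ γ' β l' N φ n] =
      l' * ∫ z, φ (originDegree γ γ' β N z) ∂(μ.prod volume) := by
  have := hN.isProbabilityMeasure
  simp only [windowAverage]
  rw [integral_const_mul, ← integral_prod _ (integrable_apply_nbhd_window hN hγ hφ hint n),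
    ← integral_map measurable_apply_nbhd.aemeasurable hφ.aestronglyMeasurable,
    map_apply_nbhd_restrict_window hN hγ, integral_smul_measure,
    integral_map measurable_originDegree.aemeasurable hφ.aestronglyMeasurable]
  simp [mul_assoc, hn]

lemma lintegral_enorm_windowAverage_le (hN : IsPoissonRandomMeasure N (stripMeasure l) μ)
    (hγ : γ < 1) (hφ : Measurable φ) {n : ℕ} (hn : n ≠ 0) :
    ∫⁻ ω, ‖windowAverage γ γ' β l' N φ n ω‖ₑ ∂μ ≤
      l' * ∫⁻ z, ‖φ (originDegree γ γ' β N z)‖ₑ ∂(μ.prod volume) := by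
  calc ∫⁻ ω, ‖windowAverage γ γ' β l' N φ n ω‖ₑ ∂μ
    _ ≤ ∫⁻ ω, (n : ℝ≥0∞)⁻¹ *
          ∫⁻ q in window n, ‖φ (N ω (nbhd γ' γ β q))‖ₑ ∂(stripMeasure l') ∂μ := by
      refine lintegral_mono fun ω ↦ ?_
      rw [windowAverage, enorm_mul, enorm_inv (by simpa using hn), Real.enorm_natCast]
      gcongr
      exact enorm_integral_le_lintegral_enorm _
    _ = (n : ℝ≥0∞)⁻¹ * (n * l' * ∫⁻ z, ‖φ (originDegree γ γ' β N z)‖ₑ ∂(μ.prod volume)) := by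
      rw [lintegral_const_mul' _ _ (by simpa using hn),
        lintegral_setLIntegral_window hN hγ (φ := fun x ↦ ‖φ x‖ₑ) (by fun_prop)]
    _ = _ := by
      rw [mul_assoc, ENNReal.inv_mul_cancel_left (by simpa using hn) (by simp)]

lemma measurable_windowAverage (hφ : Measurable φ) (n : ℕ) :
    Measurable (windowAverage γ γ' β l' N φ n) :=
  (StronglyMeasurable.integral_prod_right (f := fun ω q ↦ φ (N ω (nbhd γ' γ β q)))
    (hφ.comp measurable_apply_nbhd).stronglyMeasurable).measurable.const_mul _

lemma evariance_windowAverage_le (hN : IsPoissonRandomMeasure N (stripMeasure l) μ)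
    (hγ : γ < 1) (hφ : Measurable φ) {c : ℝ} (hc : ∀ x, |φ x| ≤ c) {n : ℕ} (hn : n ≠ 0) :
    evariance (windowAverage γ γ' β l' N φ n) μ ≤ (n : ℝ≥0∞)⁻¹ * (ENNReal.ofReal (16 * c ^ 2) *
      (l * (ENNReal.ofReal (2 * β) * (l' * markInt γ')) ^ 2 * markInt (γ + γ))) := by
  have : IsFiniteMeasure ((stripMeasure l').restrict (window n)) :=
    isFiniteMeasure_restrict.2 (by rw [stripMeasure_window]; finiteness)
  have hvar := hN.evariance_integral_comp_apply_le (ρ := (stripMeasure l').restrict (window n))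
    (measurableSet_bipEdges (γ := γ) (γ' := γ') (β := β))
    (ae_restrict_of_ae ((ae_stripMeasure_mark_pos l').mono fun q hq ↦
      stripMeasure_nbhd_ne_top l hγ hq)) hφ hc
  simp_rw [prodMk_preimage_bipEdges] at hvar
  have hscale : ENNReal.ofReal ((n : ℝ)⁻¹ ^ 2) = (n : ℝ≥0∞)⁻¹ * (n : ℝ≥0∞)⁻¹ := by
    rw [ENNReal.ofReal_pow (by positivity), ENNReal.ofReal_inv_of_pos (by positivity),
      ENNReal.ofReal_natCast, sq]
  have hn0 : (n : ℝ≥0∞) ≠ 0 := by simpa using hn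
  set C : ℝ≥0∞ := l * (ENNReal.ofReal (2 * β) * (l' * markInt γ')) ^ 2 * markInt (γ + γ)
  calc evariance (windowAverage γ γ' β l' N φ n) μ
    _ ≤ (n : ℝ≥0∞)⁻¹ * (n : ℝ≥0∞)⁻¹ * (ENNReal.ofReal (16 * c ^ 2) * (n * C)) := by
      rw [← hscale]
      refine (evariance_mul _ _ μ).trans_le ?_
      gcongr
      exact hvar.trans (by gcongr; exact lintegral_restrict_window_nbhd_sq_le n)
    _ = (n : ℝ≥0∞)⁻¹ * (ENNReal.ofReal (16 * c ^ 2) * C) := by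
      rw [mul_left_comm _ (n : ℝ≥0∞) C, mul_assoc,
        ENNReal.inv_mul_cancel_left hn0 (ENNReal.natCast_ne_top n)]

lemma tendsto_windowAverage_of_bounded (hN : IsPoissonRandomMeasure N (stripMeasure l) μ)
    (hγ : γ < 1 / 2) (hγ' : γ' < 1) (hφ : Measurable φ) {c : ℝ} (hc : ∀ x, |φ x| ≤ c) :
    Tendsto (fun n ↦ ∫⁻ ω, ‖windowAverage γ γ' β l' N φ n ω -
      l' * ∫ z, φ (originDegree γ γ' β N z) ∂(μ.prod volume)‖ₑ ∂μ) atTop (𝓝 0) := by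
  have := hN.isProbabilityMeasure
  have hint : Integrable (fun z ↦ φ (originDegree γ γ' β N z)) (μ.prod volume) :=
    .of_bound (hφ.comp measurable_originDegree).aestronglyMeasurable c (ae_of_all _ fun z ↦ hc _)
  set C : ℝ≥0∞ := ENNReal.ofReal (16 * c ^ 2) *
    (l * (ENNReal.ofReal (2 * β) * (l' * markInt γ')) ^ 2 * markInt (γ + γ))
  have hC : C ≠ ∞ := by
    have := markInt_ne_top hγ'
    have := markInt_ne_top (show γ + γ < 1 by linarith)
    finiteness
  have hlim : Tendsto (fun n : ℕ ↦ ((n : ℝ≥0∞)⁻¹ * C) ^ (1 / 2 : ℝ)) atTop (𝓝 0) := by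
    have h := (ENNReal.Tendsto.mul_const ENNReal.tendsto_inv_nat_nhds_zero (.inr hC)).ennrpow_const
      (1 / 2)
    simpa using h
  refine tendsto_of_tendsto_of_tendsto_of_le_of_le' tendsto_const_nhds hlim
    (.of_forall fun _ ↦ zero_le) ?_
  filter_upwards [eventually_ne_atTop 0] with n hn
  rw [← integral_windowAverage hN (by linarith) hφ hint hn]
  refine (lintegral_enorm_sub_integral_le
    (measurable_windowAverage hφ n).aestronglyMeasurable).trans ?_
  gcongr
  exact evariance_windowAverage_le hN (by linarith) hφ hc hn

lemma lintegral_enorm_windowAverage_sub_le (hN : IsPoissonRandomMeasure N (stripMeasure l) μ)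
    (hγ : γ < 1) {ψ : ℝ≥0∞ → ℝ} (hφ : Measurable φ) (hψ : Measurable ψ)
    (hφi : Integrable (fun z ↦ φ (originDegree γ γ' β N z)) (μ.prod volume))
    (hψi : Integrable (fun z ↦ ψ (originDegree γ γ' β N z)) (μ.prod volume)) {n : ℕ}
    (hn : n ≠ 0) :
    ∫⁻ ω, ‖windowAverage γ γ' β l' N φ n ω -
        l' * ∫ z, φ (originDegree γ γ' β N z) ∂(μ.prod volume)‖ₑ ∂μ ≤
      ∫⁻ ω, ‖windowAverage γ γ' β l' N ψ n ω -
        l' * ∫ z, ψ (originDegree γ γ' β N z) ∂(μ.prod volume)‖ₑ ∂μ +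
      2 * (l' * ∫⁻ z, ‖φ (originDegree γ γ' β N z) - ψ (originDegree γ γ' β N z)‖ₑ
        ∂(μ.prod volume)) := by
  have := hN.isProbabilityMeasure
  set δ := l' * ∫⁻ z, ‖φ (originDegree γ γ' β N z) - ψ (originDegree γ γ' β N z)‖ₑ
    ∂(μ.prod volume)
  set m : (ℝ≥0∞ → ℝ) → ℝ := fun χ ↦ l' * ∫ z, χ (originDegree γ γ' β N z) ∂(μ.prod volume)
  have hmean : ‖m ψ - m φ‖ₑ ≤ δ := by
    simp only [m, ← mul_sub, ← integral_sub hψi hφi, enorm_mul]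
    refine mul_le_mul' (by simp) ((enorm_integral_le_lintegral_enorm _).trans_eq ?_)
    exact lintegral_congr fun z ↦ enorm_sub_rev _ _
  have hsplit : ∀ᵐ ω ∂μ, ‖windowAverage γ γ' β l' N φ n ω - m φ‖ₑ ≤
      ‖windowAverage γ γ' β l' N ψ n ω - m ψ‖ₑ +
        ‖windowAverage γ γ' β l' N (φ - ψ) n ω‖ₑ + δ := by
    filter_upwards [(integrable_apply_nbhd_window (l' := l') hN hγ hφ hφi n).prod_right_ae,
      (integrable_apply_nbhd_window (l' := l') hN hγ hψ hψi n).prod_right_ae] with ω h1 h2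
    have hlin : windowAverage γ γ' β l' N (φ - ψ) n ω =
        windowAverage γ γ' β l' N φ n ω - windowAverage γ γ' β l' N ψ n ω := by
      rw [windowAverage, windowAverage, windowAverage, ← mul_sub, ← integral_sub h1 h2]
      rfl
    have hdecomp : windowAverage γ γ' β l' N φ n ω - m φ =
        windowAverage γ γ' β l' N ψ n ω - m ψ + windowAverage γ γ' β l' N (φ - ψ) n ω +
          (m ψ - m φ) := by
      rw [hlin]
      ring
    rw [hdecomp]
    exact (enorm_add_le _ _).trans (add_le_add (enorm_add_le _ _) hmean)
  refine (lintegral_mono_ae hsplit).trans ?_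
  rw [lintegral_add_right _ measurable_const,
    lintegral_add_right _ (measurable_windowAverage (hφ.sub hψ) n).enorm, lintegral_const,
    measure_univ, mul_one, add_assoc, two_mul]
  gcongr
  exact lintegral_enorm_windowAverage_le hN hγ (hφ.sub hψ) hn

lemma tendsto_windowAverage (hN : IsPoissonRandomMeasure N (stripMeasure l) μ)
    (hγ : γ < 1 / 2) (hγ' : γ' < 1) (hφ : Measurable φ)
    (hint : Integrable (fun z ↦ φ (originDegree γ γ' β N z)) (μ.prod volume)) :
    Tendsto (fun n ↦ ∫⁻ ω, ‖windowAverage γ γ' β l' N φ n ω -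
      l' * ∫ z, φ (originDegree γ γ' β N z) ∂(μ.prod volume)‖ₑ ∂μ) atTop (𝓝 0) := by
  have := hN.isProbabilityMeasure
  refine ENNReal.tendsto_nhds_zero.2 fun ε hε ↦ ?_
  obtain ⟨δ, hδ, hδε⟩ : ∃ δ ≠ 0, 2 * (l' * δ) ≤ ε / 2 := by
    refine ⟨ε / 2 / (2 * l'),
      (ENNReal.div_pos (ENNReal.half_pos hε.ne').ne' (by finiteness)).ne', ?_⟩
    rw [← mul_assoc]
    exact ENNReal.mul_div_le
  obtain ⟨ψ, hψ, hψi⟩ := (memLp_one_iff_integrable.2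
    ((integrable_map_measure hφ.aestronglyMeasurable measurable_originDegree.aemeasurable).2
      hint)).exists_simpleFunc_eLpNorm_sub_lt ENNReal.one_ne_top hδ
  rw [eLpNorm_one_eq_lintegral_enorm, lintegral_map (hφ.sub ψ.measurable).enorm
    measurable_originDegree] at hψ
  rw [memLp_one_iff_integrable, integrable_map_measure hψi.1
    measurable_originDegree.aemeasurable] at hψi
  obtain ⟨c, hc⟩ := ψ.exists_forall_norm_le
  filter_upwards [eventually_ne_atTop 0, ENNReal.tendsto_nhds_zero.1
    (tendsto_windowAverage_of_bounded (l' := l') hN hγ hγ' ψ.measurable hc) _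
    (ENNReal.half_pos hε.ne')] with n hn h
  calc _ ≤ _ := lintegral_enorm_windowAverage_sub_le hN (by linarith) hφ ψ.measurable hint hψi hn
    _ ≤ ε / 2 + ε / 2 := add_le_add h (le_trans (by gcongr; exact hψ.le) hδε)
    _ = ε := ENNReal.add_halves ε

end Window

end Averages

/-! ### The central limit theorem -/

lemma enorm_integral_sub_integral_le {α : Type*} [MeasurableSpace α] {ρ : Measure α}
    {f g : α → ℂ} (hf : AEStronglyMeasurable f ρ) (hg : AEStronglyMeasurable g ρ) :
    ‖∫ x, f x ∂ρ - ∫ x, g x ∂ρ‖ₑ ≤ ∫⁻ x, ‖f x - g x‖ₑ ∂ρ := by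
  by_cases hfg : Integrable (f - g) ρ
  · by_cases hgi : Integrable g ρ
    · have hfi : Integrable f ρ := by simpa using hfg.add hgi
      rw [← integral_sub hfi hgi]
      exact enorm_integral_le_lintegral_enorm _
    · have hfi : ¬Integrable f ρ := fun h ↦ hgi (by simpa using h.sub hfg)
      simp [integral_undef hfi, integral_undef hgi]
  · rw [show ∫⁻ x, ‖f x - g x‖ₑ ∂ρ = ∞ by
      by_contra h
      exact hfg ⟨hf.sub hg, lt_top_iff_ne_top.2 h⟩]
    exact le_top

lemma memLp_rpow_neg {γ : ℝ} (hγ : γ < 1 / 2) :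
    MemLp (fun u : unitInterval ↦ (u : ℝ) ^ (-γ)) 2 := by
  rw [memLp_two_iff_integrable_sq (Measurable.aestronglyMeasurable (by fun_prop))]
  have h : ∫⁻ u, markPow γ u * markPow γ u ≠ ∞ :=
    (lintegral_markPow_mul_markPow γ γ).trans_ne (markInt_ne_top (by linarith))
  refine (integrable_toReal_of_lintegral_ne_top (by fun_prop) h).congr (ae_of_all _ fun u ↦ ?_)
  simp only [markPow, ENNReal.toReal_mul, sq,
    ENNReal.toReal_ofReal (Real.rpow_nonneg u.2.1 (-γ))]

section MeanDegrees

variable {Ω Ω' : Type*} [MeasurableSpace Ω] [MeasurableSpace Ω'] {μ : Measure Ω} {μ' : Measure Ω'}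
  {N : Kernel Ω Strip} {N' : Kernel Ω' Strip} {γ γ' β : ℝ} {l l' : ℝ≥0}

/-- The mean number of neighbors of a vertex with mark `u` is `degreeConst γ' β l' * u ^ (-γ)`,
where `l'` is the density of the neighbors. -/
noncomputable def degreeConst (γ' β : ℝ) (l' : ℝ≥0) : ℝ :=
  (ENNReal.ofReal (2 * β) * (l' * markInt γ')).toReal

lemma stripMeasure_real_nbhd {p : Strip} (hp : 0 < (p.2 : ℝ)) :
    (stripMeasure l').real (nbhd γ γ' β p) = degreeConst γ' β l' * (p.2 : ℝ) ^ (-γ) := by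
  rw [measureReal_def, stripMeasure_nbhd l' hp, mul_right_comm, ENNReal.toReal_mul, degreeConst,
    markPow, ENNReal.toReal_ofReal (Real.rpow_nonneg hp.le _)]

lemma integral_compExp_section_windowEdges (n : ℕ) (s : ℝ) :
    ∫ p, compExp (s * (stripMeasure l').real (Prod.mk p ⁻¹' windowEdges γ γ' β n))
        ∂(stripMeasure l) =
      n * l * ∫ u : unitInterval, compExp (s * (degreeConst γ' β l' * (u : ℝ) ^ (-γ))) := by
  set f : unitInterval → ℂ := fun u ↦ compExp (s * (degreeConst γ' β l' * (u : ℝ) ^ (-γ)))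
  have hf : Measurable f := by fun_prop
  have hsection : ∀ᵐ p ∂(stripMeasure l),
      compExp (s * (stripMeasure l').real (Prod.mk p ⁻¹' windowEdges γ γ' β n)) =
        (window n).indicator (fun p ↦ f p.2) p := by
    filter_upwards [ae_stripMeasure_mark_pos l] with p hp
    by_cases hpn : p ∈ window n
    · rw [prodMk_preimage_windowEdges_of_mem hpn, stripMeasure_real_nbhd hp,
        Set.indicator_of_mem hpn]
    · simp [prodMk_preimage_windowEdges_of_notMem hpn, hpn, compExp_zero]
  rw [integral_congr_ae hsection, integral_indicator (measurableSet_window n),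
    ← integral_map measurable_snd.aemeasurable hf.aestronglyMeasurable, map_snd_restrict_window,
    integral_smul_measure]
  simp [f]

lemma tendsto_integral_compExp_section_windowEdges (hγ : γ < 1 / 2) (t : ℝ) :
    Tendsto (fun n : ℕ ↦ ∫ p, compExp ((n : ℝ) ^ (-(1 / 2) : ℝ) * t *
      (stripMeasure l').real (Prod.mk p ⁻¹' windowEdges γ γ' β n)) ∂(stripMeasure l)) atTop
      (𝓝 (-(t ^ 2 / 2 *
        (l * ∫ u : unitInterval, (degreeConst γ' β l' * (u : ℝ) ^ (-γ)) ^ 2)) : ℝ)) := by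
  have h := (tendsto_natCast_mul_integral_compExp
    ((memLp_rpow_neg hγ).const_mul (t * degreeConst γ' β l'))).const_mul (l : ℂ)
  convert h using 2 with n
  · rw [integral_compExp_section_windowEdges]
    simp only [mul_assoc]
    ring
  · simp only [mul_pow, integral_const_mul]
    push_cast
    ring

end MeanDegrees

section WindowNeighbors

variable {Ω : Type*} [MeasurableSpace Ω] {μ : Measure Ω} {N : Kernel Ω Strip} {γ γ' β : ℝ}
  {l l' : ℝ≥0}

lemma measurable_apply_window_inter_nbhd [IsSFiniteKernel N] (n : ℕ) :
    Measurable fun z : Ω × Strip ↦ N z.1 (window n ∩ nbhd γ' γ β z.2) :=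
  measurable_kernel_preimage_prodMk N (measurableSet_windowEdges n)

lemma norm_compExp_window_inter_sub_le {m : Measure Strip} {q : Strip}
    (hm : m (nbhd γ' γ β q) ≠ ∞) (s : ℝ) (n : ℕ) :
    ‖compExp (s * m.real (window n ∩ nbhd γ' γ β q)) -
        (window n).indicator (fun q ↦ compExp (s * m.real (nbhd γ' γ β q))) q‖ ≤
      s ^ 2 * (m.real (nbhd γ' γ β q) * m.real ((fun p ↦ (p, q)) ⁻¹' borderEdges γ γ' β n)) := by
  set A := nbhd γ' γ β q
  set D := (fun p ↦ (p, q)) ⁻¹' borderEdges γ γ' β n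
  have hle {x y : ℝ} (hx : |x| ≤ m.real A) (hy : |y| ≤ m.real A) (hxy : |x - y| = m.real D) :
      ‖compExp (s * x) - compExp (s * y)‖ ≤ s ^ 2 * (m.real A * m.real D) := by
    refine (norm_compExp_sub_le _ _).trans ?_
    rw [← mul_sub, abs_mul, abs_mul, abs_mul, hxy, ← mul_max_of_nonneg _ _ (abs_nonneg s),
      ← sq_abs, sq, mul_mul_mul_comm]
    gcongr
    exact max_le hx hy
  have hX : |m.real (window n ∩ A)| ≤ m.real A := by
    rw [abs_of_nonneg measureReal_nonneg]
    exact measureReal_mono Set.inter_subset_right hm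
  by_cases hq : q ∈ window n
  · have hD : D = A \ window n := by
      ext p
      simp [D, A, borderEdges, hq]
    rw [Set.indicator_of_mem hq]
    refine hle hX (abs_of_nonneg measureReal_nonneg).le ?_
    rw [hD, ← measureReal_inter_add_sdiff (s := A) (measurableSet_window n) hm, Set.inter_comm,
      sub_add_cancel_left, abs_neg, abs_of_nonneg measureReal_nonneg]
  · have hD : D = window n ∩ A := by
      ext p
      simp [D, A, borderEdges, hq, and_comm]
    rw [Set.indicator_of_notMem hq, ← compExp_zero, ← mul_zero s]
    refine hle hX (by simp) ?_
    rw [hD, sub_zero, abs_of_nonneg measureReal_nonneg]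

lemma lintegral_enorm_compExp_window_inter_sub_le
    (hN : IsPoissonRandomMeasure N (stripMeasure l) μ) {q : Strip}
    (hq : stripMeasure l (nbhd γ' γ β q) ≠ ∞) (s : ℝ) (n : ℕ) :
    ∫⁻ ω, ‖compExp (s * (N ω).real (window n ∩ nbhd γ' γ β q)) -
        (window n).indicator (fun q ↦ compExp (s * (N ω).real (nbhd γ' γ β q))) q‖ₑ ∂μ ≤
      ENNReal.ofReal (s ^ 2) * (stripMeasure l ((fun p ↦ (p, q)) ⁻¹' borderEdges γ γ' β n) *
        (stripMeasure l (nbhd γ' γ β q) + 1)) := by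
  set A := nbhd γ' γ β q
  set D := (fun p ↦ (p, q)) ⁻¹' borderEdges γ γ' β n
  have hA : MeasurableSet A := measurableSet_nbhd q
  have hD : MeasurableSet D := (measurableSet_borderEdges n).preimage measurable_prodMk_right
  have hDA : D ⊆ A := fun p hp ↦ hp.1
  have hfin : ∀ᵐ ω ∂μ, N ω A < ∞ :=
    ae_lt_top (N.measurable_coe hA) ((hN.lintegral_apply_of_ne_top hA hq).trans_ne hq)
  calc _ ≤ ∫⁻ ω, ENNReal.ofReal (s ^ 2) * (N ω A * N ω D) ∂μ := by
        refine lintegral_mono_ae (hfin.mono fun ω hω ↦ ?_)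
        rw [← ofReal_measureReal hω.ne, ← ofReal_measureReal (measure_ne_top_of_subset hDA hω.ne),
          ← ENNReal.ofReal_mul measureReal_nonneg, ← ENNReal.ofReal_mul (sq_nonneg s),
          ← ofReal_norm]
        exact ENNReal.ofReal_le_ofReal (norm_compExp_window_inter_sub_le hω.ne s n)
    _ = _ := by
      rw [lintegral_const_mul' _ _ ENNReal.ofReal_ne_top,
        hN.lintegral_apply_mul_apply_of_ne_top hA hq hD (measure_ne_top_of_subset hDA hq),
        Set.inter_eq_self_of_subset_right hDA]
      ring

lemma lintegral_enorm_integral_compExp_window_inter_sub_le [IsSFiniteKernel N]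
    (hN : IsPoissonRandomMeasure N (stripMeasure l) μ) (hγ : γ < 1) (s : ℝ) (n : ℕ) :
    ∫⁻ ω, ‖∫ q, compExp (s * (N ω).real (window n ∩ nbhd γ' γ β q)) ∂(stripMeasure l') -
        ∫ q in window n, compExp (s * (N ω).real (nbhd γ' γ β q)) ∂(stripMeasure l')‖ₑ ∂μ ≤
      ENNReal.ofReal (s ^ 2) *
        ∫⁻ q, stripMeasure l ((fun p ↦ (p, q)) ⁻¹' borderEdges γ γ' β n) *
          (meanDegree γ γ' β l q.2 + 1) ∂(stripMeasure l') := by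
  have := hN.isProbabilityMeasure
  have hX : Measurable fun z : Ω × Strip ↦
      compExp (s * (N z.1).real (window n ∩ nbhd γ' γ β z.2)) :=
    measurable_compExp.comp
      ((measurable_apply_window_inter_nbhd n).ennreal_toReal.const_mul s)
  have hY : Measurable fun z : Ω × Strip ↦
      (window n).indicator (fun q ↦ compExp (s * (N z.1).real (nbhd γ' γ β q))) z.2 :=
    (measurable_compExp.comp (measurable_apply_nbhd.ennreal_toReal.const_mul s)).indicator
      ((measurableSet_window n).preimage measurable_snd)
  calc _ ≤ ∫⁻ ω, ∫⁻ q, ‖compExp (s * (N ω).real (window n ∩ nbhd γ' γ β q)) -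
          (window n).indicator (fun q ↦ compExp (s * (N ω).real (nbhd γ' γ β q))) q‖ₑ
            ∂(stripMeasure l') ∂μ := by
        refine lintegral_mono fun ω ↦ ?_
        rw [← integral_indicator (measurableSet_window n)]
        exact enorm_integral_sub_integral_le
          (hX.comp measurable_prodMk_left).aestronglyMeasurable
          (hY.comp measurable_prodMk_left).aestronglyMeasurable
    _ = ∫⁻ q, ∫⁻ ω, ‖compExp (s * (N ω).real (window n ∩ nbhd γ' γ β q)) -
          (window n).indicator (fun q ↦ compExp (s * (N ω).real (nbhd γ' γ β q))) q‖ₑ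
            ∂μ ∂(stripMeasure l') := lintegral_lintegral_swap (hX.sub hY).enorm.aemeasurable
    _ ≤ _ := by
      rw [← lintegral_const_mul' _ _ ENNReal.ofReal_ne_top]
      refine lintegral_mono_ae ((ae_stripMeasure_mark_pos l').mono fun q hq ↦ ?_)
      rw [← stripMeasure_nbhd_eq_meanDegree l hq]
      exact lintegral_enorm_compExp_window_inter_sub_le hN (stripMeasure_nbhd_ne_top l hγ hq) s n

lemma lintegral_enorm_integral_compExp_window_add_le [IsSFiniteKernel N]
    (hN : IsPoissonRandomMeasure N (stripMeasure l) μ) (hγ : γ < 1) (t : ℝ) {n : ℕ} (hn : n ≠ 0) :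
    ∫⁻ ω, ‖∫ q in window n, compExp ((n : ℝ) ^ (-(1 / 2) : ℝ) * t *
          (N ω).real (nbhd γ' γ β q)) ∂(stripMeasure l') +
        (t ^ 2 / 2 * windowAverage γ γ' β l' N (fun x ↦ x.toReal ^ 2) n ω : ℝ)‖ₑ ∂μ ≤
      l' * ∫⁻ z, ‖n * compExp ((n : ℝ) ^ (-(1 / 2) : ℝ) *
          (t * (originDegree γ γ' β N z).toReal)) +
        ((t * (originDegree γ γ' β N z).toReal) ^ 2 / 2 : ℝ)‖ₑ ∂(μ.prod volume) := by
  have := hN.isProbabilityMeasure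
  set f : ℝ≥0∞ → ℂ := fun x ↦ compExp ((n : ℝ) ^ (-(1 / 2) : ℝ) * t * x.toReal)
  set g : ℝ≥0∞ → ℝ := fun x ↦ -((n : ℝ)⁻¹ * ((t * x.toReal) ^ 2 / 2))
  have hfg : Measurable fun x ↦ ‖f x - g x‖ₑ := by fun_prop
  have hG (ω : Ω) : Measurable fun q ↦ N ω (nbhd γ' γ β q) :=
    measurable_apply_nbhd.comp measurable_prodMk_left
  have havg (ω : Ω) : (t ^ 2 / 2 * windowAverage γ γ' β l' N (fun x ↦ x.toReal ^ 2) n ω : ℝ) =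
      -∫ q in window n, (g (N ω (nbhd γ' γ β q)) : ℂ) ∂(stripMeasure l') := by
    rw [integral_complex_ofReal, integral_neg, windowAverage, Complex.ofReal_neg, neg_neg,
      integral_const_mul, integral_div]
    simp only [mul_pow, integral_const_mul]
    congr 1
    ring
  have hscale (x : ℝ≥0∞) : n * ‖f x - g x‖ₑ =
      ‖n * compExp ((n : ℝ) ^ (-(1 / 2) : ℝ) * (t * x.toReal)) +
        ((t * x.toReal) ^ 2 / 2 : ℝ)‖ₑ := by
    have hnorm : (n : ℝ≥0∞) = ‖(n : ℂ)‖ₑ := by simp [← ofReal_norm]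
    have hn' : (n : ℂ) ≠ 0 := by exact_mod_cast hn
    rw [hnorm, ← enorm_mul]
    simp only [f, g, mul_assoc]
    push_cast
    rw [mul_sub, mul_neg, mul_inv_cancel_left₀ hn', sub_neg_eq_add]
  calc _ ≤ ∫⁻ ω, ∫⁻ q in window n, ‖f (N ω (nbhd γ' γ β q)) - g (N ω (nbhd γ' γ β q))‖ₑ
          ∂(stripMeasure l') ∂μ := by
        refine lintegral_mono fun ω ↦ ?_
        rw [havg, ← sub_eq_add_neg]
        exact enorm_integral_sub_integral_le (f := fun q ↦ f (N ω (nbhd γ' γ β q)))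
          (Measurable.comp (g := f) (by fun_prop) (hG ω)).aestronglyMeasurable
          (Measurable.comp (g := fun x ↦ (g x : ℂ)) (by fun_prop) (hG ω)).aestronglyMeasurable
    _ = l' * (n * ∫⁻ z, ‖f (originDegree γ γ' β N z) - g (originDegree γ γ' β N z)‖ₑ
          ∂(μ.prod volume)) := by
        rw [lintegral_setLIntegral_window hN hγ hfg, ← mul_assoc, mul_comm (l' : ℝ≥0∞)]
    _ = _ := by
      rw [← lintegral_const_mul' _ _ (ENNReal.natCast_ne_top n)]
      simp only [hscale]

lemma tendsto_integral_compExp_window_inter_sub [IsSFiniteKernel N]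
    (hN : IsPoissonRandomMeasure N (stripMeasure l) μ) (hγ : γ < 1) (hγ' : γ' < 1 / 2) (t : ℝ) :
    Tendsto (fun n : ℕ ↦
      ∫⁻ ω, ‖∫ q, compExp ((n : ℝ) ^ (-(1 / 2) : ℝ) * t *
          (N ω).real (window n ∩ nbhd γ' γ β q)) ∂(stripMeasure l') -
        ∫ q in window n, compExp ((n : ℝ) ^ (-(1 / 2) : ℝ) * t *
          (N ω).real (nbhd γ' γ β q)) ∂(stripMeasure l')‖ₑ ∂μ) atTop (𝓝 0) := by
  have hborder := ENNReal.Tendsto.const_mul (a := ENNReal.ofReal (t ^ 2))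
    (tendsto_inv_mul_lintegral_borderEdges (γ := γ) (γ' := γ') (β := β) hγ l l'
      (h := fun w ↦ meanDegree γ γ' β l w + 1) (by fun_prop)
      (fun w ↦ ENNReal.add_ne_top.2 ⟨meanDegree_ne_top hγ w, ENNReal.one_ne_top⟩)
      (lintegral_meanDegree_add_one_mul_markPow_ne_top hγ hγ')) (.inr ENNReal.ofReal_ne_top)
  rw [mul_zero] at hborder
  refine tendsto_of_tendsto_of_tendsto_of_le_of_le' tendsto_const_nhds hborder
    (Eventually.of_forall fun _ ↦ zero_le) ((eventually_ne_atTop 0).mono fun n hn ↦ ?_)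
  have hn' : 0 < (n : ℝ) := by positivity
  have h := lintegral_enorm_integral_compExp_window_inter_sub_le (γ' := γ') (β := β) (l' := l')
    hN hγ ((n : ℝ) ^ (-(1 / 2) : ℝ) * t) n
  rwa [mul_pow, sq_natCast_rpow_neg_half, mul_comm (n : ℝ)⁻¹, ENNReal.ofReal_mul (sq_nonneg t),
    ENNReal.ofReal_inv_of_pos hn', ENNReal.ofReal_natCast, mul_assoc] at h

lemma tendsto_setIntegral_compExp_window_add [IsSFiniteKernel N]
    (hN : IsPoissonRandomMeasure N (stripMeasure l) μ) (hγ : γ < 1) (hγ' : γ' < 1 / 2) (t : ℝ) :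
    Tendsto (fun n : ℕ ↦ ∫⁻ ω, ‖∫ q in window n, compExp ((n : ℝ) ^ (-(1 / 2) : ℝ) * t *
          (N ω).real (nbhd γ' γ β q)) ∂(stripMeasure l') +
        (t ^ 2 / 2 * windowAverage γ γ' β l' N (fun x ↦ x.toReal ^ 2) n ω : ℝ)‖ₑ ∂μ)
      atTop (𝓝 0) := by
  have h := ENNReal.Tendsto.const_mul (a := (l' : ℝ≥0∞))
    (tendsto_lintegral_enorm_natCast_mul_compExp_add
      ((memLp_originDegree (β := β) hN hγ hγ').const_mul t)) (.inr ENNReal.coe_ne_top)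
  rw [mul_zero] at h
  exact tendsto_of_tendsto_of_tendsto_of_le_of_le' tendsto_const_nhds h
    (Eventually.of_forall fun _ ↦ zero_le) ((eventually_ne_atTop 0).mono fun n hn ↦
      lintegral_enorm_integral_compExp_window_add_le hN hγ t hn)

lemma measurable_setIntegral_compExp_window [IsSFiniteKernel N] (s : ℝ) (n : ℕ) :
    Measurable fun ω ↦ ∫ q in window n, compExp (s * (N ω).real (nbhd γ' γ β q))
      ∂(stripMeasure l') :=
  (StronglyMeasurable.integral_prod_right
    (f := fun ω q ↦ compExp (s * (N ω).real (nbhd γ' γ β q))) (measurable_compExp.comp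
      (measurable_apply_nbhd.ennreal_toReal.const_mul s)).stronglyMeasurable).measurable

lemma lintegral_enorm_sub_neg_mul_le {A B : Ω → ℂ} {W : Ω → ℝ} (hB : Measurable B)
    (hW : Measurable W) (c w : ℝ) :
    ∫⁻ ω, ‖A ω - (-(c * w) : ℝ)‖ₑ ∂μ ≤
      ∫⁻ ω, ‖A ω - B ω‖ₑ ∂μ + ∫⁻ ω, ‖B ω + (c * W ω : ℝ)‖ₑ ∂μ +
        ‖c‖ₑ * ∫⁻ ω, ‖W ω - w‖ₑ ∂μ := by
  have henorm (x : ℝ) : ‖x‖ₑ = ‖(x : ℂ)‖ₑ := by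
    rw [← ofReal_norm, ← ofReal_norm, Complex.norm_real]
  rw [← lintegral_const_mul _ (by fun_prop), ← lintegral_add_right _ (by fun_prop),
    ← lintegral_add_right _ (by fun_prop)]
  refine lintegral_mono fun ω ↦ ?_
  have hsplit : A ω - (-(c * w) : ℝ) =
      A ω - B ω + (B ω + (c * W ω : ℝ)) - (c * (W ω - w) : ℝ) := by
    push_cast
    ring
  rw [hsplit, ← enorm_mul, henorm]
  exact enorm_sub_le.trans (by gcongr; exact enorm_add_le _ _)

lemma tendsto_integral_compExp_window_inter [IsSFiniteKernel N]
    (hN : IsPoissonRandomMeasure N (stripMeasure l) μ) (hγ : γ < 1 / 2) (hγ' : γ' < 1 / 2) (t : ℝ) :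
    Tendsto (fun n : ℕ ↦
      ∫⁻ ω, ‖∫ q, compExp ((n : ℝ) ^ (-(1 / 2) : ℝ) * t *
          (N ω).real (window n ∩ nbhd γ' γ β q)) ∂(stripMeasure l') -
        (-(t ^ 2 / 2 * (l' * ∫ z, (originDegree γ γ' β N z).toReal ^ 2 ∂(μ.prod volume))) :
          ℝ)‖ₑ ∂μ) atTop (𝓝 0) := by
  have hφ : Measurable fun x : ℝ≥0∞ ↦ x.toReal ^ 2 := by fun_prop
  have hborder := tendsto_integral_compExp_window_inter_sub (γ := γ) (β := β) (l' := l') hN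
    (by linarith) hγ' t
  have hbulk := tendsto_setIntegral_compExp_window_add (γ := γ) (β := β) (l' := l') hN
    (by linarith) hγ' t
  have havg := ENNReal.Tendsto.const_mul (a := ‖t ^ 2 / 2‖ₑ)
    (tendsto_windowAverage (γ := γ) (γ' := γ') (β := β) (l' := l') hN hγ (by linarith) hφ
      (memLp_originDegree hN (by linarith) hγ').integrable_sq) (.inr (by finiteness))
  have hsum := (hborder.add hbulk).add havg
  rw [add_zero, mul_zero, add_zero] at hsum
  exact tendsto_of_tendsto_of_tendsto_of_le_of_le tendsto_const_nhds hsum (fun _ ↦ zero_le)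
    fun n ↦ lintegral_enorm_sub_neg_mul_le (measurable_setIntegral_compExp_window _ n)
      (measurable_windowAverage hφ n) _ _

end WindowNeighbors

section CenteredEdges

variable {Ω Ω' : Type*} [MeasurableSpace Ω] [MeasurableSpace Ω'] {μ : Measure Ω} {μ' : Measure Ω'}
  {N : Kernel Ω Strip} {N' : Kernel Ω' Strip} {γ γ' β : ℝ} {l l' : ℝ≥0}

/-- The centered number of edges with first endpoint in `window n`, for vertex sets given by
Poisson random measures. -/
noncomputable def centeredEdges (γ γ' β : ℝ) (l l' : ℝ≥0) (N : Kernel Ω Strip)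
    (N' : Kernel Ω' Strip) (n : ℕ) (z : Ω × Ω') : ℝ :=
  ((N ∥ₖ N') z).real (windowEdges γ γ' β n) -
    ((stripMeasure l).prod (stripMeasure l')).real (windowEdges γ γ' β n)

lemma measurable_centeredEdges (n : ℕ) :
    Measurable (centeredEdges γ γ' β l l' N N' n) :=
  ((N ∥ₖ N').measurable_coe (measurableSet_windowEdges n)).ennreal_toReal.sub_const _

lemma tendsto_integral_exp_centeredEdges [IsSFiniteKernel N] [IsSFiniteKernel N']
    (hN : IsPoissonRandomMeasure N (stripMeasure l) μ)
    (hN' : IsPoissonRandomMeasure N' (stripMeasure l') μ') (hγ : γ < 1) (hγ' : γ' < 1)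
    {s : ℕ → ℝ} {a b : ℂ} (ha : a.re ≤ 0)
    (hs : Tendsto (fun n ↦ ∫⁻ ω, ‖∫ q, compExp (s n * (N ω).real (window n ∩ nbhd γ' γ β q))
      ∂(stripMeasure l') - a‖ₑ ∂μ) atTop (𝓝 0))
    (hs' : Tendsto (fun n ↦ ∫ p, compExp (s n * (stripMeasure l').real
      (Prod.mk p ⁻¹' windowEdges γ γ' β n)) ∂(stripMeasure l)) atTop (𝓝 b)) :
    Tendsto (fun n ↦ ∫ z, Complex.exp (.I * (s n * centeredEdges γ γ' β l l' N N' n z : ℝ))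
      ∂(μ.prod μ')) atTop (𝓝 (Complex.exp (a + b))) := by
  have hdiff := tendsto_zero_iff_enorm_tendsto_zero.2
    (tendsto_of_tendsto_of_tendsto_of_le_of_le tendsto_const_nhds hs (fun _ ↦ zero_le)
      fun n ↦ hN.enorm_integral_exp_sub_le hN' (measurableSet_windowEdges n)
        (prod_windowEdges_ne_top (β := β) hγ hγ' l l' n) (s n) ha)
  simpa only [centeredEdges, zero_add, Function.comp_apply, sub_add_cancel] using
    hdiff.add ((Complex.continuous_exp.tendsto _).comp (hs'.const_add a))

lemma exists_tendsto_integral_exp_centeredEdges_gaussianReal [IsSFiniteKernel N]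
    [IsSFiniteKernel N'] (hN : IsPoissonRandomMeasure N (stripMeasure l) μ)
    (hN' : IsPoissonRandomMeasure N' (stripMeasure l') μ') (hγ : γ < 1 / 2) (hγ' : γ' < 1 / 2) :
    ∃ σ : ℝ≥0, ∀ t : ℝ, Tendsto (fun n : ℕ ↦ ∫ z, Complex.exp (.I * ((n : ℝ) ^ (-(1 / 2) : ℝ) * t *
      centeredEdges γ γ' β l l' N N' n z : ℝ)) ∂(μ.prod μ')) atTop
      (𝓝 (charFun (gaussianReal 0 (σ ^ 2)) t)) := by
  set v : ℝ := l' * ∫ z, (originDegree γ γ' β N z).toReal ^ 2 ∂(μ.prod volume)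
  set v' : ℝ := l * ∫ u : unitInterval, (degreeConst γ' β l' * (u : ℝ) ^ (-γ)) ^ 2
  have hv : 0 ≤ v := by positivity
  have : 0 ≤ v' := by positivity
  refine ⟨Real.toNNReal √(v + v'), fun t ↦ ?_⟩
  have h := tendsto_integral_exp_centeredEdges hN hN' (by linarith) (by linarith)
    (a := (-(t ^ 2 / 2 * v) : ℝ)) (b := (-(t ^ 2 / 2 * v') : ℝ))
    (by rw [Complex.ofReal_re]; linarith [mul_nonneg (sq_nonneg t) hv])
    (tendsto_integral_compExp_window_inter (β := β) hN hγ hγ' t)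
    (tendsto_integral_compExp_section_windowEdges hγ t)
  have hσ : ((Real.toNNReal √(v + v') ^ 2 : ℝ≥0) : ℝ) = v + v' := by
    rw [NNReal.coe_pow, Real.coe_toNNReal _ (Real.sqrt_nonneg _), Real.sq_sqrt (by positivity)]
  convert h using 2
  rw [charFun_gaussianReal, hσ]
  congr 1
  push_cast
  ring

end CenteredEdges

/-! ### The stable law -/

section Stable

variable {γ : ℝ}

lemma integrableOn_compExp_rpow (hγ : 1 / 2 < γ) (hγ1 : γ < 1) (a : ℝ) :
    IntegrableOn (fun v : ℝ ↦ compExp (a * v ^ (-γ))) (Set.Ioi 0) := by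
  have hm : Measurable fun v : ℝ ↦ compExp (a * v ^ (-γ)) :=
    measurable_compExp.comp (by fun_prop)
  rw [← Set.Ioc_union_Ioi_eq_Ioi zero_le_one]
  refine IntegrableOn.union ?_ ?_
  · have h : IntegrableOn (fun v : ℝ ↦ 2 * |a| * v ^ (-γ)) (Set.Ioc 0 1) :=
      (intervalIntegral.intervalIntegrable_rpow' (by linarith)).1.const_mul _
    refine h.mono' hm.aestronglyMeasurable ?_
    filter_upwards [ae_restrict_mem measurableSet_Ioc] with v hv
    simpa only [abs_mul, abs_of_nonneg (Real.rpow_nonneg hv.1.le _), mul_assoc] using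
      norm_compExp_le (a * v ^ (-γ))
  · have h : IntegrableOn (fun v : ℝ ↦ a ^ 2 * v ^ (-γ * 2)) (Set.Ioi 1) :=
      (integrableOn_Ioi_rpow_of_lt (by linarith) one_pos).const_mul _
    refine h.mono' hm.aestronglyMeasurable ?_
    filter_upwards [ae_restrict_mem measurableSet_Ioi] with v hv
    have hv0 : (0 : ℝ) ≤ v := zero_le_one.trans (le_of_lt hv)
    simpa only [mul_pow, Real.rpow_mul hv0, Real.rpow_two] using norm_compExp_le_sq (a * v ^ (-γ))

/-- The logarithm of the characteristic function of the centered `1/γ`-stable law with jumps of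
size `v ^ (-γ)`, where `v` ranges over a Poisson process of unit intensity on `(0, ∞)`. -/
noncomputable def stableExponent (γ t : ℝ) : ℂ := ∫ v in Set.Ioi (0 : ℝ), compExp (t * v ^ (-γ))

lemma stableExponent_mul (hγ : γ ≠ 0) {a : ℝ} (ha : 0 < a) (t : ℝ) :
    stableExponent γ (a * t) = (a ^ (1 / γ) : ℝ) * stableExponent γ t := by
  set b : ℝ := a ^ (-(1 / γ))
  have hb : 0 < b := Real.rpow_pos_of_pos ha _
  have hbinv : b⁻¹ = a ^ (1 / γ) := by simp only [b, Real.rpow_neg ha.le, inv_inv]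
  have hbγ : b ^ (-γ) = a := by
    rw [← Real.rpow_mul ha.le, neg_mul_neg, one_div_mul_cancel hγ, Real.rpow_one]
  have h := integral_comp_mul_left_Ioi (fun v : ℝ ↦ compExp (t * v ^ (-γ))) 0 hb
  rw [mul_zero, hbinv, Complex.real_smul] at h
  rw [stableExponent, stableExponent, ← h]
  refine setIntegral_congr_fun measurableSet_Ioi fun v hv ↦ ?_
  simp only [Real.mul_rpow hb.le (le_of_lt hv), hbγ]
  congr 1
  ring

lemma stableExponent_zero (γ : ℝ) : stableExponent γ 0 = 0 := by
  simp [stableExponent]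

lemma norm_stableExponent_le (hγ : γ ≠ 0) (t : ℝ) : ‖stableExponent γ t‖ ≤
    |t| ^ (1 / γ) * (‖stableExponent γ 1‖ + ‖stableExponent γ (-1)‖) := by
  have hscale (s : ℝ) (ht : 0 < |t|) :
      ‖stableExponent γ (|t| * s)‖ = |t| ^ (1 / γ) * ‖stableExponent γ s‖ := by
    rw [stableExponent_mul hγ ht, norm_mul, Complex.norm_real, Real.norm_eq_abs,
      abs_of_pos (Real.rpow_pos_of_pos ht _)]
  rcases lt_trichotomy t 0 with ht | rfl | ht
  · have h := hscale (-1) (abs_pos.2 ht.ne)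
    rw [mul_neg_one, abs_of_neg ht, neg_neg, ← abs_of_neg ht] at h
    rw [h]
    gcongr
    exact le_add_of_nonneg_left (norm_nonneg _)
  · rw [stableExponent_zero, norm_zero]
    positivity
  · have h := hscale 1 (abs_pos.2 ht.ne')
    rw [mul_one, abs_of_pos ht] at h
    rw [abs_of_pos ht, h]
    gcongr
    exact le_add_of_nonneg_right (norm_nonneg _)

lemma continuousAt_stableExponent_zero (hγ : 0 < γ) : ContinuousAt (stableExponent γ) 0 := by
  rw [ContinuousAt, stableExponent_zero]
  refine squeeze_zero_norm (norm_stableExponent_le hγ.ne') ?_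
  have h : Continuous fun t : ℝ ↦ |t| ^ (1 / γ) *
      (‖stableExponent γ 1‖ + ‖stableExponent γ (-1)‖) :=
    (continuous_abs.rpow_const fun _ ↦ .inr (by positivity)).mul_const _
  simpa [Real.zero_rpow (inv_ne_zero hγ.ne')] using h.tendsto 0

lemma re_stableExponent_neg (hγ : 1 / 2 < γ) (hγ1 : γ < 1) {c : ℝ} (hc : 0 < c) :
    (stableExponent γ c).re < 0 := by
  have hint := integrableOn_compExp_rpow hγ hγ1 c
  have hre : -(stableExponent γ c).re =
      ∫ v in Set.Ioi (0 : ℝ), -(compExp (c * v ^ (-γ))).re := by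
    rw [integral_neg]
    exact congrArg _ (Complex.reCLM.integral_comp_comm hint).symm
  have hnonneg : 0 ≤ᵐ[volume.restrict (Set.Ioi 0)] fun v : ℝ ↦ -(compExp (c * v ^ (-γ))).re :=
    ae_of_all _ fun v ↦ neg_nonneg.2 (re_compExp_nonpos _)
  rw [← neg_pos, hre,
    setIntegral_pos_iff_support_of_nonneg_ae hnonneg (Complex.reCLM.integrable_comp hint).neg]
  have hlim : Tendsto (fun v : ℝ ↦ c * v ^ (-γ)) atTop (𝓝 0) := by
    simpa using (tendsto_rpow_neg_atTop (by linarith : 0 < γ)).const_mul c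
  obtain ⟨V, hV⟩ := eventually_atTop.1 (hlim.eventually (gt_mem_nhds Real.pi_pos))
  refine lt_of_lt_of_le ?_ (measure_mono (s := Set.Ioi (max V 0)) fun v hv ↦ ?_)
  · simp
  · obtain ⟨hvV, hv0⟩ := max_lt_iff.1 (Set.mem_Ioi.1 hv)
    have hcos := Real.cos_lt_cos_of_nonneg_of_le_pi le_rfl (hV v hvV.le).le
      (mul_pos hc (Real.rpow_pos_of_pos hv0 _))
    rw [Real.cos_zero] at hcos
    refine ⟨?_, hv0⟩
    rw [Function.mem_support, re_compExp]
    linarith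

lemma isStableLaw_of_charFun (hγ : 1 / 2 < γ) (hγ1 : γ < 1) {c l : ℝ} (hc : 0 < c) (hl : 0 < l)
    {ν : Measure ℝ} [IsProbabilityMeasure ν]
    (h : ∀ t, charFun ν t = Complex.exp (l * stableExponent γ (c * t))) :
    IsStableLaw (1 / γ) ν := by
  have hγ0 : γ ≠ 0 := by linarith
  refine ⟨inferInstance, fun x hx ↦ ?_, fun a b ha hb ↦ ⟨0, ?_⟩⟩
  · have hnorm := congrArg norm (h 1)
    rw [hx, charFun_dirac, Complex.norm_exp_ofReal_mul_I, Complex.norm_exp, mul_one,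
      Complex.re_ofReal_mul, eq_comm, Real.exp_eq_one_iff] at hnorm
    exact (mul_neg_of_pos_of_neg hl (re_stableExponent_neg hγ hγ1 hc)).ne hnorm
  · have hab : 0 < a ^ (1 / γ) + b ^ (1 / γ) :=
      add_pos (Real.rpow_pos_of_pos ha _) (Real.rpow_pos_of_pos hb _)
    set k := (a ^ (1 / γ) + b ^ (1 / γ)) ^ (1 / (1 / γ)) with hk
    have hk0 : 0 < k := Real.rpow_pos_of_pos hab _
    have hkγ : k ^ (1 / γ) = a ^ (1 / γ) + b ^ (1 / γ) := by
      rw [hk, ← Real.rpow_mul hab.le, one_div_mul_cancel (one_div_ne_zero hγ0), Real.rpow_one]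
    have (r : ℝ) : IsProbabilityMeasure (ν.map (r * ·)) :=
      Measure.isProbabilityMeasure_map (by fun_prop)
    simp only [add_zero]
    refine Measure.ext_of_charFun (funext fun t ↦ ?_)
    rw [charFun_conv, charFun_map_mul, charFun_map_mul, charFun_map_mul, h, h, h,
      ← Complex.exp_add, mul_left_comm c, mul_left_comm c, mul_left_comm c,
      stableExponent_mul hγ0 ha, stableExponent_mul hγ0 hb, stableExponent_mul hγ0 hk0, hkγ]
    congr 1
    push_cast
    ring

end Stable

lemma IsPoissonRandomMeasure.lintegral_enorm_compExp_mul_apply_le {Ω E : Type*}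
    [MeasurableSpace Ω] [MeasurableSpace E] {N : Kernel Ω E} {ν : Measure E} {μ : Measure Ω}
    (hN : IsPoissonRandomMeasure N ν μ) {A : Set E} (hA : MeasurableSet A) (hνA : ν A ≠ ∞) (s : ℝ) :
    ∫⁻ ω, ‖compExp (s * (N ω).real A)‖ₑ ∂μ ≤
      ENNReal.ofReal (s ^ 2) * (ν A * (ν A + 1)) := by
  have hsq : ∫⁻ ω, N ω A ^ 2 ∂μ = ν A * (ν A + 1) := by
    rw [hN.lintegral_apply_sq_of_ne_top hA hνA]
    ring
  rw [← hsq, ← lintegral_const_mul' _ _ ENNReal.ofReal_ne_top]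
  refine lintegral_mono fun ω ↦ ?_
  rw [← ofReal_norm]
  refine (ENNReal.ofReal_le_ofReal (norm_compExp_le_sq _)).trans ?_
  rw [mul_pow, ENNReal.ofReal_mul (sq_nonneg s), ENNReal.ofReal_pow measureReal_nonneg]
  gcongr
  exact ENNReal.ofReal_toReal_le

section StableLimit

variable {Ω Ω' : Type*} [MeasurableSpace Ω] [MeasurableSpace Ω'] {μ : Measure Ω} {μ' : Measure Ω'}
  {N : Kernel Ω Strip} {N' : Kernel Ω' Strip} {γ γ' β : ℝ} {l l' : ℝ≥0}

lemma markInt_ne_zero (a : ℝ) : markInt a ≠ 0 := by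
  rw [markInt, Ne, lintegral_eq_zero_iff (measurable_markPow a)]
  intro h
  obtain ⟨w, hw0, hw⟩ := (h.and ae_mark_pos).exists
  exact (ENNReal.ofReal_pos.2 (Real.rpow_pos_of_pos hw _)).ne' hw0

lemma degreeConst_pos (hγ' : γ' < 1) (hβ : 0 < β) (hl' : 0 < l') : 0 < degreeConst γ' β l' := by
  refine ENNReal.toReal_pos (mul_ne_zero (by simpa using hβ) (mul_ne_zero ?_ (markInt_ne_zero γ')))
    (ENNReal.mul_ne_top ENNReal.ofReal_ne_top
      (ENNReal.mul_ne_top ENNReal.coe_ne_top (markInt_ne_top hγ')))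
  exact ENNReal.coe_ne_zero.2 hl'.ne'

lemma lintegral_enorm_integral_compExp_window_inter_le [IsSFiniteKernel N]
    (hN : IsPoissonRandomMeasure N (stripMeasure l) μ) (hγ : γ < 1) (s : ℝ) (n : ℕ) :
    ∫⁻ ω, ‖∫ q, compExp (s * (N ω).real (window n ∩ nbhd γ' γ β q)) ∂(stripMeasure l')‖ₑ ∂μ ≤
      ENNReal.ofReal (s ^ 2) * (n * (l * ENNReal.ofReal (2 * β) * markInt γ) *
        (l' * ∫⁻ w, (meanDegree γ γ' β l w + 1) * markPow γ' w)) := by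
  have := hN.isProbabilityMeasure
  have hX : Measurable fun z : Ω × Strip ↦
      compExp (s * (N z.1).real (window n ∩ nbhd γ' γ β z.2)) :=
    measurable_compExp.comp ((measurable_apply_window_inter_nbhd n).ennreal_toReal.const_mul s)
  calc _ ≤ ∫⁻ ω, ∫⁻ q, ‖compExp (s * (N ω).real (window n ∩ nbhd γ' γ β q))‖ₑ
          ∂(stripMeasure l') ∂μ :=
        lintegral_mono fun ω ↦ enorm_integral_le_lintegral_enorm _
    _ = ∫⁻ q, ∫⁻ ω, ‖compExp (s * (N ω).real (window n ∩ nbhd γ' γ β q))‖ₑ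
          ∂μ ∂(stripMeasure l') := lintegral_lintegral_swap hX.enorm.aemeasurable
    _ ≤ ENNReal.ofReal (s ^ 2) * ∫⁻ q, stripMeasure l (window n ∩ nbhd γ' γ β q) *
          (meanDegree γ γ' β l q.2 + 1) ∂(stripMeasure l') := by
      rw [← lintegral_const_mul' _ _ ENNReal.ofReal_ne_top]
      refine lintegral_mono_ae ((ae_stripMeasure_mark_pos l').mono fun q hq ↦ ?_)
      have hle : stripMeasure l (window n ∩ nbhd γ' γ β q) ≤ meanDegree γ γ' β l q.2 :=
        (measure_mono Set.inter_subset_right).trans_eq (stripMeasure_nbhd_eq_meanDegree l hq)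
      refine (hN.lintegral_enorm_compExp_mul_apply_le
        ((measurableSet_window n).inter (measurableSet_nbhd q))
        (ne_top_of_le_ne_top (meanDegree_ne_top hγ _) hle) s).trans ?_
      gcongr
    _ = _ := by
      rw [lintegral_stripMeasure_window_inter_nbhd_mul l l' n
        (h := fun w ↦ meanDegree γ γ' β l w + 1) (by fun_prop)]

lemma tendsto_natCast_rpow_sq_mul (hγ : 1 / 2 < γ) (t : ℝ) :
    Tendsto (fun n : ℕ ↦ ((n : ℝ) ^ (-γ) * t) ^ 2 * n) atTop (𝓝 0) := by
  have h := ((tendsto_rpow_neg_atTop (by linarith : 0 < 2 * γ - 1)).comp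
    tendsto_natCast_atTop_atTop).const_mul (t ^ 2)
  rw [mul_zero] at h
  refine h.congr' ((eventually_ne_atTop 0).mono fun n hn ↦ ?_)
  have hn' : 0 < (n : ℝ) := by positivity
  beta_reduce
  rw [Function.comp_apply, mul_pow, ← Real.rpow_two (_ ^ (-γ)), ← Real.rpow_mul hn'.le,
    show -(2 * γ - 1) = -γ * 2 + 1 by ring, Real.rpow_add_one hn'.ne']
  ring

lemma tendsto_lintegral_enorm_integral_compExp_window_inter [IsSFiniteKernel N]
    (hN : IsPoissonRandomMeasure N (stripMeasure l) μ) (hγ : 1 / 2 < γ) (hγ1 : γ < 1)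
    (hγ' : γ' < 1 / 2) (t : ℝ) :
    Tendsto (fun n : ℕ ↦ ∫⁻ ω, ‖∫ q, compExp ((n : ℝ) ^ (-γ) * t *
      (N ω).real (window n ∩ nbhd γ' γ β q)) ∂(stripMeasure l')‖ₑ ∂μ) atTop (𝓝 0) := by
  set C : ℝ≥0∞ := l * ENNReal.ofReal (2 * β) * markInt γ *
    (l' * ∫⁻ w, (meanDegree γ γ' β l w + 1) * markPow γ' w)
  have hC : C ≠ ∞ := ENNReal.mul_ne_top
    (ENNReal.mul_ne_top (ENNReal.mul_ne_top ENNReal.coe_ne_top ENNReal.ofReal_ne_top)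
      (markInt_ne_top hγ1))
    (ENNReal.mul_ne_top ENNReal.coe_ne_top
      (lintegral_meanDegree_add_one_mul_markPow_ne_top hγ1 hγ'))
  have h := ENNReal.Tendsto.mul_const (b := C)
    (ENNReal.tendsto_ofReal (tendsto_natCast_rpow_sq_mul hγ t)) (.inr hC)
  rw [ENNReal.ofReal_zero, zero_mul] at h
  refine tendsto_of_tendsto_of_tendsto_of_le_of_le tendsto_const_nhds h (fun _ ↦ zero_le)
    fun n ↦ (lintegral_enorm_integral_compExp_window_inter_le hN hγ1 _ n).trans_eq ?_
  rw [ENNReal.ofReal_mul (sq_nonneg _), ENNReal.ofReal_natCast]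
  simp only [C, mul_assoc]

lemma natCast_mul_integral_unitInterval_comp_mul (f : ℝ → ℂ) (n : ℕ) :
    n * ∫ u : unitInterval, f (n * u) = ∫ v in (0 : ℝ)..n, f v := by
  have h := intervalIntegral.smul_integral_comp_mul_left (a := 0) (b := 1) f (n : ℝ)
  rw [mul_zero, mul_one, intervalIntegral.integral_of_le zero_le_one,
    ← integral_Icc_eq_integral_Ioc, ← integral_subtype_comap measurableSet_Icc] at h
  simpa [unitInterval.volume_def] using h

lemma tendsto_integral_compExp_section_windowEdges_stable (hγ : 1 / 2 < γ) (hγ1 : γ < 1) (t : ℝ) :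
    Tendsto (fun n : ℕ ↦ ∫ p, compExp ((n : ℝ) ^ (-γ) * t *
      (stripMeasure l').real (Prod.mk p ⁻¹' windowEdges γ γ' β n)) ∂(stripMeasure l)) atTop
      (𝓝 (l * stableExponent γ (degreeConst γ' β l' * t))) := by
  set f : ℝ → ℂ := fun v ↦ compExp (degreeConst γ' β l' * t * v ^ (-γ))
  refine ((intervalIntegral_tendsto_integral_Ioi 0 (integrableOn_compExp_rpow hγ hγ1 _)
    tendsto_natCast_atTop_atTop).const_mul (l : ℂ)).congr fun n ↦ ?_
  have hscale (u : unitInterval) : f (n * u) =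
      compExp ((n : ℝ) ^ (-γ) * t * (degreeConst γ' β l' * (u : ℝ) ^ (-γ))) := by
    simp only [f, Real.mul_rpow (Nat.cast_nonneg n) u.2.1]
    congr 1
    ring
  rw [integral_compExp_section_windowEdges, ← natCast_mul_integral_unitInterval_comp_mul f]
  simp only [hscale]
  ring

lemma tendsto_integral_exp_centeredEdges_stable [IsSFiniteKernel N] [IsSFiniteKernel N']
    (hN : IsPoissonRandomMeasure N (stripMeasure l) μ)
    (hN' : IsPoissonRandomMeasure N' (stripMeasure l') μ') (hγ : 1 / 2 < γ) (hγ1 : γ < 1)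
    (hγ' : γ' < 1 / 2) (t : ℝ) :
    Tendsto (fun n : ℕ ↦ ∫ z, Complex.exp (.I * ((n : ℝ) ^ (-γ) * t *
      centeredEdges γ γ' β l l' N N' n z : ℝ)) ∂(μ.prod μ')) atTop
      (𝓝 (Complex.exp (l * stableExponent γ (degreeConst γ' β l' * t)))) := by
  simpa using tendsto_integral_exp_centeredEdges hN hN' hγ1 (by linarith) (a := 0) le_rfl
    (by simpa using tendsto_lintegral_enorm_integral_compExp_window_inter (β := β) hN hγ hγ1 hγ' t)
    (tendsto_integral_compExp_section_windowEdges_stable hγ hγ1 t)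

end StableLimit

/-! ### Convergence in distribution -/

section Levy

variable {Ω : Type*} [MeasurableSpace Ω] {μ : Measure Ω}

lemma integral_exp_I_mul_eq_charFun_map {X : Ω → ℝ} (hX : AEMeasurable X μ) (t : ℝ) :
    ∫ ω, Complex.exp (.I * (t * X ω : ℝ)) ∂μ = charFun (μ.map X) t := by
  rw [charFun_apply_real, integral_map hX (by fun_prop)]
  simp only [Complex.ofReal_mul, mul_comm Complex.I]

variable [IsProbabilityMeasure μ]

lemma tendstoInDistribution_of_tendsto_integral_exp {X : ℕ → Ω → ℝ}
    (hX : ∀ n, AEMeasurable (X n) μ) {ν : Measure ℝ} [IsProbabilityMeasure ν]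
    (h : ∀ t : ℝ, Tendsto (fun n ↦ ∫ ω, Complex.exp (.I * (t * X n ω : ℝ)) ∂μ) atTop
      (𝓝 (charFun ν t))) :
    TendstoInDistribution X atTop (id : ℝ → ℝ) (fun _ ↦ μ) ν := by
  refine ⟨hX, aemeasurable_id, ProbabilityMeasure.tendsto_iff_tendsto_charFun.2 fun t ↦ ?_⟩
  simpa only [integral_exp_I_mul_eq_charFun_map (hX _), ProbabilityMeasure.coe_mk,
    Measure.map_id] using h t

lemma exists_charFun_eq_of_tendsto {ρ : ℕ → ProbabilityMeasure ℝ} {f : ℝ → ℂ}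
    (hf : ContinuousAt f 0)
    (h : ∀ t, Tendsto (fun n ↦ charFun (ρ n : Measure ℝ) t) atTop (𝓝 (f t))) :
    ∃ ν : ProbabilityMeasure ℝ, ∀ t, charFun (ν : Measure ℝ) t = f t := by
  have htight := isTightMeasureSet_of_tendsto_charFun (μ := fun n ↦ (ρ n : Measure ℝ)) hf h
  have hcomp : IsCompact (closure (Set.range ρ)) := by
    refine isCompact_closure_of_isTightMeasureSet ?_
    convert htight using 1
    ext x
    simp
  -- by Prokhorov, `ρ` has a limit along a nontrivial ultrafilter, whose charFun must be `f`
  obtain ⟨ν, -, hν⟩ := hcomp.ultrafilter_le_nhds ((Ultrafilter.of atTop).map ρ)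
    (le_principal_iff.2 (mem_map.2 (univ_mem' fun n ↦ subset_closure ⟨n, rfl⟩)))
  refine ⟨ν, fun t ↦ tendsto_nhds_unique ?_ ((h t).mono_left (Ultrafilter.of_le _))⟩
  have hν' : Tendsto ρ (Ultrafilter.of (atTop : Filter ℕ)) (𝓝 ν) := hν
  rw [ProbabilityMeasure.tendsto_iff_forall_integral_rclike_tendsto ℂ] at hν'
  simp_rw [charFun_eq_integral_innerProbChar]
  exact hν' (BoundedContinuousFunction.innerProbChar t)

lemma exists_tendstoInDistribution_of_tendsto_integral_exp {X : ℕ → Ω → ℝ}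
    (hX : ∀ n, AEMeasurable (X n) μ) {f : ℝ → ℂ} (hf : ContinuousAt f 0)
    (h : ∀ t : ℝ, Tendsto (fun n ↦ ∫ ω, Complex.exp (.I * (t * X n ω : ℝ)) ∂μ) atTop (𝓝 (f t))) :
    ∃ ν : ProbabilityMeasure ℝ, (∀ t, charFun (ν : Measure ℝ) t = f t) ∧
      TendstoInDistribution X atTop (id : ℝ → ℝ) (fun _ ↦ μ) (ν : Measure ℝ) := by
  have hρ (n : ℕ) : IsProbabilityMeasure (μ.map (X n)) := Measure.isProbabilityMeasure_map (hX n)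
  obtain ⟨ν, hν⟩ := exists_charFun_eq_of_tendsto (ρ := fun n ↦ ⟨μ.map (X n), hρ n⟩) hf fun t ↦ by
    simpa only [integral_exp_I_mul_eq_charFun_map (hX _), ProbabilityMeasure.coe_mk] using h t
  exact ⟨ν, hν, tendstoInDistribution_of_tendsto_integral_exp hX fun t ↦ by
    simpa only [hν] using h t⟩

lemma tendstoInDistribution_comp {Ω' : Type*} [MeasurableSpace Ω'] {T : Ω → Ω'} (hT : Measurable T)
    {X : ℕ → Ω' → ℝ} (hX : ∀ n, Measurable (X n)) {ν : Measure ℝ} [IsProbabilityMeasure ν]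
    [IsProbabilityMeasure (μ.map T)]
    (h : TendstoInDistribution X atTop (id : ℝ → ℝ) (fun _ ↦ μ.map T) ν) :
    TendstoInDistribution (fun n ↦ X n ∘ T) atTop (id : ℝ → ℝ) (fun _ ↦ μ) ν := by
  refine ⟨fun n ↦ ((hX n).comp hT).aemeasurable, aemeasurable_id, ?_⟩
  simpa only [Measure.map_map (hX _) hT] using h.tendsto

end Levy

section Limits

variable {Ω Ω' : Type*} [MeasurableSpace Ω] [MeasurableSpace Ω'] {μ : Measure Ω} {μ' : Measure Ω'}
  [IsProbabilityMeasure μ] [IsProbabilityMeasure μ']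
  {N : Kernel Ω Strip} {N' : Kernel Ω' Strip} [IsSFiniteKernel N] [IsSFiniteKernel N']
  {γ γ' β : ℝ} {l l' : ℝ≥0}

lemma exists_tendstoInDistribution_gaussianReal
    (hN : IsPoissonRandomMeasure N (stripMeasure l) μ)
    (hN' : IsPoissonRandomMeasure N' (stripMeasure l') μ') (hγ : γ < 1 / 2) (hγ' : γ' < 1 / 2) :
    ∃ σ : ℝ≥0, TendstoInDistribution (fun (n : ℕ) z ↦ (n : ℝ) ^ (-(1 / 2) : ℝ) *
      centeredEdges γ γ' β l l' N N' n z) atTop (id : ℝ → ℝ) (fun _ ↦ μ.prod μ')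
        (gaussianReal 0 (σ ^ 2)) := by
  obtain ⟨σ, h⟩ :=
    exists_tendsto_integral_exp_centeredEdges_gaussianReal (β := β) hN hN' hγ hγ'
  refine ⟨σ, tendstoInDistribution_of_tendsto_integral_exp
    (fun n ↦ ((measurable_centeredEdges n).const_mul _).aemeasurable) fun t ↦ ?_⟩
  simpa only [mul_assoc, mul_left_comm t] using h t

lemma exists_tendstoInDistribution_isStableLaw
    (hN : IsPoissonRandomMeasure N (stripMeasure l) μ)
    (hN' : IsPoissonRandomMeasure N' (stripMeasure l') μ') (hγ : 1 / 2 < γ) (hγ1 : γ < 1)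
    (hγ' : γ' < 1 / 2) (hβ : 0 < β) (hl : 0 < l) (hl' : 0 < l') :
    ∃ ν : ProbabilityMeasure ℝ, IsStableLaw (1 / γ) (ν : Measure ℝ) ∧
      TendstoInDistribution (fun (n : ℕ) z ↦ (n : ℝ) ^ (-γ) *
        centeredEdges γ γ' β l l' N N' n z) atTop (id : ℝ → ℝ) (fun _ ↦ μ.prod μ')
          (ν : Measure ℝ) := by
  set c := degreeConst γ' β l'
  have hc : 0 < c := degreeConst_pos (by linarith) hβ hl'
  have hcont : ContinuousAt (fun t ↦ Complex.exp (l * stableExponent γ (c * t))) 0 := by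
    have h : ContinuousAt (fun t ↦ stableExponent γ (c * t)) 0 :=
      ContinuousAt.comp (g := stableExponent γ)
        (by simpa using continuousAt_stableExponent_zero (by linarith)) (by fun_prop)
    fun_prop
  obtain ⟨ν, hν, hlim⟩ := exists_tendstoInDistribution_of_tendsto_integral_exp
    (fun n ↦ ((measurable_centeredEdges n).const_mul _).aemeasurable) hcont fun t ↦ by
      simpa only [mul_assoc, mul_left_comm t] using
        tendsto_integral_exp_centeredEdges_stable (β := β) hN hN' hγ hγ1 hγ' t
  exact ⟨ν, isStableLaw_of_charFun hγ hγ1 hc hl hν, hlim⟩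

end Limits

/-! ### Point processes as Poisson random measures -/

lemma isSFiniteKernel_of_forall_ne_top {α E : Type*} [MeasurableSpace α] [MeasurableSpace E]
    {κ : Kernel α E} (hκ : ∀ a, κ a Set.univ ≠ ∞) : IsSFiniteKernel κ := by
  classical
  let mass (a : α) : ℕ := ⌊(κ a Set.univ).toReal⌋₊
  have hmass (j : ℕ) : MeasurableSet (mass ⁻¹' {j}) :=
    (κ.measurable_coe .univ).ennreal_toReal.nat_floor (measurableSet_singleton j)
  let η (j : ℕ) : Kernel α E := Kernel.piecewise (hmass j) κ 0
  have hη (j : ℕ) : IsFiniteKernel (η j) := by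
    refine ⟨ENNReal.ofReal (j + 1), by finiteness, fun a ↦ ?_⟩
    rw [Kernel.piecewise_apply']
    split_ifs with ha
    · rw [← ENNReal.ofReal_toReal (hκ a), ← show mass a = j from ha]
      exact ENNReal.ofReal_le_ofReal (Nat.lt_floor_add_one _).le
    · simp
  have hκ_eq : κ = Kernel.sum η := by
    ext a s hs
    rw [Kernel.sum_apply' _ _ hs, tsum_eq_single (mass a) fun j hj ↦ by
      simp [η, Kernel.piecewise_apply', hj.symm]]
    simp [η, Kernel.piecewise_apply']
  rw [hκ_eq]
  infer_instance

lemma isSFiniteKernel_of_iUnion_eq_univ {α E : Type*} [MeasurableSpace α] [MeasurableSpace E]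
    {κ : Kernel α E} {B : ℕ → Set E} (hB : ∀ k, MeasurableSet (B k)) (hB_univ : ⋃ k, B k = Set.univ)
    (hκ : ∀ a k, κ a (B k) ≠ ∞) : IsSFiniteKernel κ := by
  have hD (k : ℕ) : MeasurableSet (disjointed B k) := .disjointed hB k
  have hfin (k : ℕ) : IsSFiniteKernel (κ.restrict (hD k)) :=
    isSFiniteKernel_of_forall_ne_top fun a ↦ by
      rw [Kernel.restrict_apply' _ _ _ .univ, Set.univ_inter]
      exact measure_ne_top_of_subset (disjointed_subset B k) (hκ a k)
  have hκ_eq : κ = Kernel.sum fun k ↦ κ.restrict (hD k) := by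
    ext1 a
    simp only [Kernel.sum_apply, Kernel.restrict_apply]
    rw [← Measure.restrict_iUnion (disjoint_disjointed B) hD, iUnion_disjointed, hB_univ,
      Measure.restrict_univ]
  rw [hκ_eq]
  infer_instance

lemma count_restrict_apply {E : Type*} [MeasurableSpace E] [MeasurableSingletonClass E] {s : Set E}
    (hs : s.Countable) {A : Set E} (hA : MeasurableSet A) :
    Measure.count.restrict s A = ((s ∩ A).encard : ℝ≥0∞) := by
  rw [Measure.restrict_apply hA, Measure.count_apply (hA.inter hs.measurableSet), Set.inter_comm]

section Configurations

/-- The space of locally finite subsets of `E`, with the σ-algebra generated by the numbers of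
points in measurable sets. -/
def PointConfiguration (E : Type*) [TopologicalSpace E] : Type _ :=
  {s : Set E // ∀ K, IsCompact K → (s ∩ K).Finite}

variable {E : Type*} [TopologicalSpace E]

lemma PointConfiguration.countable [SigmaCompactSpace E] (s : PointConfiguration E) :
    s.1.Countable := by
  rw [← Set.inter_univ s.1, ← iUnion_compactCovering, Set.inter_iUnion]
  exact Set.countable_iUnion fun k ↦ (s.2 _ (isCompact_compactCovering E k)).countable

variable [MeasurableSpace E]

noncomputable instance PointConfiguration.instMeasurableSpace :
    MeasurableSpace (PointConfiguration E) :=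
  processSigmaAlgebra Subtype.val

lemma measurable_encard_inter {A : Set E} (hA : MeasurableSet A) :
    Measurable fun s : PointConfiguration E ↦ (s.1 ∩ A).encard :=
  Measurable.of_comap_le <|
    le_iSup (fun A : {A : Set E // MeasurableSet A} ↦
      MeasurableSpace.comap (fun s : PointConfiguration E ↦ (s.1 ∩ (A : Set E)).encard)
        inferInstance) ⟨A, hA⟩

variable [SigmaCompactSpace E] [T2Space E] [OpensMeasurableSpace E]

/-- The kernel sending a configuration to the counting measure on its points. -/
noncomputable def configurationKernel (E : Type*) [TopologicalSpace E] [MeasurableSpace E]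
    [SigmaCompactSpace E] [T2Space E] [OpensMeasurableSpace E] :
    Kernel (PointConfiguration E) E where
  toFun s := Measure.count.restrict s.1
  measurable' := Measure.measurable_of_measurable_coe _ fun A hA ↦ by
    simp_rw [count_restrict_apply (PointConfiguration.countable _) hA]
    exact measurable_from_top.comp (measurable_encard_inter hA)

lemma configurationKernel_apply (s : PointConfiguration E) :
    configurationKernel E s = Measure.count.restrict s.1 := rfl

lemma configurationKernel_apply' (s : PointConfiguration E) {A : Set E} (hA : MeasurableSet A) :
    configurationKernel E s A = ((s.1 ∩ A).encard : ℝ≥0∞) :=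
  count_restrict_apply s.countable hA

instance isSFiniteKernel_configurationKernel : IsSFiniteKernel (configurationKernel E) := by
  have hK (k : ℕ) := (isCompact_compactCovering E k).measurableSet
  refine isSFiniteKernel_of_iUnion_eq_univ hK (iUnion_compactCovering E) fun s k ↦ ?_
  rw [configurationKernel_apply' s (hK k), Ne, ENat.toENNReal_eq_top]
  exact (s.2 _ (isCompact_compactCovering E k)).encard_lt_top.ne

end Configurations

section IsPoissonProcess

variable {Ω E : Type*} [MeasurableSpace Ω] [TopologicalSpace E] [MeasurableSpace E] {μ : Measure Ω}
  {ν : Measure E} {P : Ω → Set E}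

lemma iIndepFun_map {Ω' ι : Type*} [MeasurableSpace Ω'] [Finite ι] [IsProbabilityMeasure μ]
    {T : Ω → Ω'} (hT : Measurable T) {β : ι → Type*} [∀ i, MeasurableSpace (β i)]
    {X : ∀ i, Ω' → β i} (hX : ∀ i, Measurable (X i)) (h : iIndepFun (fun i ↦ X i ∘ T) μ) :
    iIndepFun X (μ.map T) := by
  have := Fintype.ofFinite ι
  have : IsProbabilityMeasure (μ.map T) := Measure.isProbabilityMeasure_map hT.aemeasurable
  rw [iIndepFun_iff_map_fun_eq_pi_map fun i ↦ ((hX i).comp hT).aemeasurable] at h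
  rw [iIndepFun_iff_map_fun_eq_pi_map fun i ↦ (hX i).aemeasurable,
    Measure.map_map (by fun_prop) hT]
  simp_rw [Measure.map_map (hX _) hT]
  exact h

/-- The Poisson process `P` as a random element of the space of configurations. -/
def IsPoissonProcess.configuration (hP : IsPoissonProcess P ν μ) (ω : Ω) : PointConfiguration E :=
  ⟨P ω, hP.locallyFinite ω⟩

lemma IsPoissonProcess.comap_configuration (hP : IsPoissonProcess P ν μ) :
    MeasurableSpace.comap hP.configuration inferInstance = processSigmaAlgebra P := by
  simp only [PointConfiguration.instMeasurableSpace, processSigmaAlgebra,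
    MeasurableSpace.comap_iSup, MeasurableSpace.comap_comp]
  rfl

lemma IsPoissonProcess.measurable_configuration (hP : IsPoissonProcess P ν μ) :
    Measurable hP.configuration := by
  rw [measurable_iff_comap_le, hP.comap_configuration]
  exact iSup_le fun A ↦ (hP.measurable_count A A.2).comap_le

lemma IsPoissonProcess.isPoissonRandomMeasure [SigmaCompactSpace E] [T2Space E]
    [OpensMeasurableSpace E] [IsProbabilityMeasure μ] (hP : IsPoissonProcess P ν μ) :
    IsPoissonRandomMeasure (configurationKernel E) ν (μ.map hP.configuration) := by
  have hcast : Measurable ((↑) : ℕ∞ → ℝ≥0∞) := measurable_from_top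
  have hcount {A : Set E} (hA : MeasurableSet A) :
      (fun s ↦ configurationKernel E s A) ∘ hP.configuration =
        (↑) ∘ fun ω ↦ (P ω ∩ A).encard :=
    funext fun ω ↦ configurationKernel_apply' _ hA
  refine ⟨fun A hA hfin ↦ ?_, fun k A hA hdisj ↦ ?_⟩
  · rw [Measure.map_map (Kernel.measurable_coe _ hA) hP.measurable_configuration, hcount hA,
      ← Measure.map_map hcast (hP.measurable_count A hA), hP.law_count A hA hfin,
      Measure.map_map hcast measurable_from_top]
    rfl
  · refine iIndepFun_map hP.measurable_configuration (fun i ↦ Kernel.measurable_coe _ (hA i)) ?_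
    simp_rw [hcount (hA _)]
    exact (hP.indep_count k A hA hdisj).comp _ fun _ ↦ hcast

lemma IsPoissonProcess.map_configuration_prodMk [IsFiniteMeasure μ] {E' : Type*}
    [TopologicalSpace E'] [MeasurableSpace E'] {P' : Ω → Set E'} {ν' : Measure E'}
    (hP : IsPoissonProcess P ν μ) (hP' : IsPoissonProcess P' ν' μ)
    (hind : Indep (processSigmaAlgebra P) (processSigmaAlgebra P') μ) :
    μ.map (fun ω ↦ (hP.configuration ω, hP'.configuration ω)) =
      (μ.map hP.configuration).prod (μ.map hP'.configuration) := by
  rw [← hP.comap_configuration, ← hP'.comap_configuration] at hind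
  exact (indepFun_iff_map_prod_eq_prod_map_map hP.measurable_configuration.aemeasurable
    hP'.measurable_configuration.aemeasurable).1 hind

end IsPoissonProcess

lemma edgeCount_eq {Ω : Type*} [MeasurableSpace Ω] {μ : Measure Ω} {ν ν' : Measure Strip}
    {P P' : Ω → Set Strip} (hP : IsPoissonProcess P ν μ) (hP' : IsPoissonProcess P' ν' μ)
    (γ γ' β : ℝ) (n : ℕ) (ω : Ω) :
    edgeCount γ γ' β P P' n ω = (configurationKernel Strip ∥ₖ configurationKernel Strip)
      (hP.configuration ω, hP'.configuration ω) (windowEdges γ γ' β n) := by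
  have hsec : (fun p ↦ configurationKernel Strip (hP'.configuration ω)
      (Prod.mk p ⁻¹' windowEdges γ γ' β n)) =
        (window n).indicator fun p ↦ (bipDegree γ γ' β (P' ω) p : ℝ≥0∞) := by
    ext p
    by_cases hp : p ∈ window n
    · rw [Set.indicator_of_mem hp, prodMk_preimage_windowEdges_of_mem hp,
        configurationKernel_apply' _ (measurableSet_nbhd p)]
      rfl
    · rw [Set.indicator_of_notMem hp, prodMk_preimage_windowEdges_of_notMem hp, measure_empty]
  rw [Kernel.parallelComp_apply, Measure.prod_apply (measurableSet_windowEdges n), hsec,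
    lintegral_indicator (measurableSet_window n), configurationKernel_apply,
    Measure.restrict_restrict (measurableSet_window n), Set.inter_comm,
    lintegral_countable _ ((hP.configuration ω).countable.mono Set.inter_subset_left)]
  simp only [Measure.count_singleton, mul_one]
  rfl

section EdgeCount

variable {Ω : Type*} [MeasurableSpace Ω] {μ : Measure Ω} {γ γ' β : ℝ} {l l' : ℝ≥0}
  {P P' : Ω → Set Strip}

lemma measurable_edgeCount {ν ν' : Measure Strip} (hP : IsPoissonProcess P ν μ)
    (hP' : IsPoissonProcess P' ν' μ) (n : ℕ) : Measurable (edgeCount γ γ' β P P' n) := by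
  simp_rw [funext (edgeCount_eq hP hP' γ γ' β n)]
  exact (Kernel.measurable_coe _ (measurableSet_windowEdges n)).comp
    (hP.measurable_configuration.prodMk hP'.measurable_configuration)

variable [IsProbabilityMeasure μ]

lemma lintegral_edgeCount (hP : IsPoissonProcess P (stripMeasure l) μ)
    (hP' : IsPoissonProcess P' (stripMeasure l') μ)
    (hind : Indep (processSigmaAlgebra P) (processSigmaAlgebra P') μ) (n : ℕ) :
    ∫⁻ ω, edgeCount γ γ' β P P' n ω ∂μ =
      ((stripMeasure l).prod (stripMeasure l')) (windowEdges γ γ' β n) := by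
  have hT := hP.measurable_configuration
  have hT' := hP'.measurable_configuration
  have : IsProbabilityMeasure (μ.map hP.configuration) :=
    Measure.isProbabilityMeasure_map hT.aemeasurable
  have : IsProbabilityMeasure (μ.map hP'.configuration) :=
    Measure.isProbabilityMeasure_map hT'.aemeasurable
  have hE := measurableSet_windowEdges (γ := γ) (γ' := γ') (β := β) n
  rw [← hP.isPoissonRandomMeasure.lintegral_parallelComp_apply hP'.isPoissonRandomMeasure hE,
    ← hP.map_configuration_prodMk hP' hind,
    lintegral_map (Kernel.measurable_coe _ hE) (hT.prodMk hT')]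
  simp_rw [edgeCount_eq hP hP']

lemma lintegral_edgeCount_ne_top (hP : IsPoissonProcess P (stripMeasure l) μ)
    (hP' : IsPoissonProcess P' (stripMeasure l') μ)
    (hind : Indep (processSigmaAlgebra P) (processSigmaAlgebra P') μ) (hγ : γ < 1) (hγ' : γ' < 1)
    (n : ℕ) : ∫⁻ ω, edgeCount γ γ' β P P' n ω ∂μ ≠ ∞ :=
  (lintegral_edgeCount hP hP' hind n).trans_ne (prod_windowEdges_ne_top hγ hγ' l l' n)

lemma toReal_edgeCount_sub_integral (hP : IsPoissonProcess P (stripMeasure l) μ)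
    (hP' : IsPoissonProcess P' (stripMeasure l') μ)
    (hind : Indep (processSigmaAlgebra P) (processSigmaAlgebra P') μ) (hγ : γ < 1) (hγ' : γ' < 1)
    (n : ℕ) (ω : Ω) :
    (edgeCount γ γ' β P P' n ω).toReal - ∫ ω', (edgeCount γ γ' β P P' n ω').toReal ∂μ =
      centeredEdges γ γ' β l l' (configurationKernel Strip) (configurationKernel Strip) n
        (hP.configuration ω, hP'.configuration ω) := by
  have hmeas := measurable_edgeCount (γ := γ) (γ' := γ') (β := β) hP hP' n
  rw [integral_toReal hmeas.aemeasurable (ae_lt_top hmeas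
    (lintegral_edgeCount_ne_top hP hP' hind hγ hγ' n)), lintegral_edgeCount hP hP' hind,
    edgeCount_eq hP hP']
  rfl

lemma tendstoInDistribution_edgeCount (hP : IsPoissonProcess P (stripMeasure l) μ)
    (hP' : IsPoissonProcess P' (stripMeasure l') μ)
    (hind : Indep (processSigmaAlgebra P) (processSigmaAlgebra P') μ) (hγ : γ < 1) (hγ' : γ' < 1)
    {a : ℕ → ℝ} {ρ : Measure ℝ} [IsProbabilityMeasure ρ]
    [IsProbabilityMeasure (μ.map hP.configuration)]
    [IsProbabilityMeasure (μ.map hP'.configuration)]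
    (h : TendstoInDistribution (fun n z ↦ a n * centeredEdges γ γ' β l l'
      (configurationKernel Strip) (configurationKernel Strip) n z) atTop (id : ℝ → ℝ)
        (fun _ ↦ (μ.map hP.configuration).prod (μ.map hP'.configuration)) ρ) :
    TendstoInDistribution (fun n ω ↦ a n * ((edgeCount γ γ' β P P' n ω).toReal -
      ∫ ω', (edgeCount γ γ' β P P' n ω').toReal ∂μ)) atTop (id : ℝ → ℝ) (fun _ ↦ μ) ρ := by
  simp_rw [toReal_edgeCount_sub_integral hP hP' hind hγ hγ']
  have hT := hP.measurable_configuration.prodMk hP'.measurable_configuration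
  have := Measure.isProbabilityMeasure_map (μ := μ) hT.aemeasurable
  refine tendstoInDistribution_comp hT (fun n ↦ (measurable_centeredEdges n).const_mul _) ?_
  simpa only [hP.map_configuration_prodMk hP' hind] using h

end EdgeCount

theorem theorem2p2_general {Ω : Type*} [MeasurableSpace Ω] (μ : Measure Ω) [IsProbabilityMeasure μ]
    (γ γ' β lam lam' : ℝ) (hγ1 : γ < 1) (hγ' : γ' < 1 / 2)
    (hβ : 0 < β) (hlam : 0 < lam) (hlam' : 0 < lam')
    (P P' : Ω → Set Strip)
    (hP : IsPoissonProcess P (ENNReal.ofReal lam • volume) μ)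
    (hP' : IsPoissonProcess P' (ENNReal.ofReal lam' • volume) μ)
    (hind : Indep (processSigmaAlgebra P) (processSigmaAlgebra P') μ)
    (S : ℕ → Ω → ℝ) (hS : ∀ n ω, S n ω = (edgeCount γ γ' β P P' n ω).toReal) :
    (∀ n, (∀ᵐ ω ∂μ, edgeCount γ γ' β P P' n ω < ∞) ∧ Integrable (S n) μ) ∧
    (γ < 1 / 2 → ∃ σ : ℝ≥0,
      TendstoInDistribution
        (fun (n : ℕ) ω ↦ (n : ℝ) ^ (-(1 / 2) : ℝ) * (S n ω - ∫ ω', S n ω' ∂μ))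
        atTop (id : ℝ → ℝ) (fun _ ↦ μ) (gaussianReal 0 (σ ^ 2))) ∧
    (1 / 2 < γ → ∃ ν : ProbabilityMeasure ℝ, IsStableLaw (1 / γ) (ν : Measure ℝ) ∧
      TendstoInDistribution
        (fun (n : ℕ) ω ↦ (n : ℝ) ^ (-γ) * (S n ω - ∫ ω', S n ω' ∂μ))
        atTop (id : ℝ → ℝ) (fun _ ↦ μ) (ν : Measure ℝ)) := by
  obtain rfl : S = fun n ω ↦ (edgeCount γ γ' β P P' n ω).toReal := funext₂ hS
  change IsPoissonProcess P (stripMeasure lam.toNNReal) μ at hP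
  change IsPoissonProcess P' (stripMeasure lam'.toNNReal) μ at hP'
  have hγ'1 : γ' < 1 := by linarith
  have := Measure.isProbabilityMeasure_map (μ := μ) hP.measurable_configuration.aemeasurable
  have := Measure.isProbabilityMeasure_map (μ := μ) hP'.measurable_configuration.aemeasurable
  have hN := hP.isPoissonRandomMeasure
  have hN' := hP'.isPoissonRandomMeasure
  refine ⟨fun n ↦ ?_, fun hγ ↦ ?_, fun hγ ↦ ?_⟩
  · have hmeas := measurable_edgeCount (γ := γ) (γ' := γ') (β := β) hP hP' n
    have hfin := lintegral_edgeCount_ne_top (β := β) hP hP' hind hγ1 hγ'1 n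
    exact ⟨ae_lt_top hmeas hfin, integrable_toReal_of_lintegral_ne_top hmeas.aemeasurable hfin⟩
  · obtain ⟨σ, h⟩ := exists_tendstoInDistribution_gaussianReal (β := β) hN hN' hγ hγ'
    exact ⟨σ, tendstoInDistribution_edgeCount hP hP' hind hγ1 hγ'1 h⟩
  · obtain ⟨ν, hν, h⟩ := exists_tendstoInDistribution_isStableLaw hN hN' hγ hγ1 hγ' hβ
      (Real.toNNReal_pos.2 hlam) (Real.toNNReal_pos.2 hlam')
    exact ⟨ν, hν, tendstoInDistribution_edgeCount hP hP' hind hγ1 hγ'1 h⟩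

theorem theorem2p2 {Ω : Type*} [MeasurableSpace Ω] (μ : Measure Ω) [IsProbabilityMeasure μ]
    (γ γ' β lam lam' : ℝ) (hγ : 0 < γ) (hγ1 : γ < 1) (hγ' : 0 < γ') (hγ'3 : γ' < 1 / 3)
    (hβ : 0 < β) (hlam : 0 < lam) (hlam' : 0 < lam')
    (P P' : Ω → Set Strip)
    (hP : IsPoissonProcess P (ENNReal.ofReal lam • volume) μ)
    (hP' : IsPoissonProcess P' (ENNReal.ofReal lam' • volume) μ)
    (hind : Indep (processSigmaAlgebra P) (processSigmaAlgebra P') μ)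
    (S : ℕ → Ω → ℝ) (hS : ∀ n ω, S n ω = (edgeCount γ γ' β P P' n ω).toReal) :
    (∀ n, (∀ᵐ ω ∂μ, edgeCount γ γ' β P P' n ω < ∞) ∧ Integrable (S n) μ) ∧
    (γ < 1 / 2 → ∃ σ : ℝ≥0,
      TendstoInDistribution
        (fun (n : ℕ) ω ↦ (n : ℝ) ^ (-(1 / 2) : ℝ) * (S n ω - ∫ ω', S n ω' ∂μ))
        atTop (id : ℝ → ℝ) (fun _ ↦ μ) (gaussianReal 0 (σ ^ 2))) ∧
    (1 / 2 < γ → ∃ ν : ProbabilityMeasure ℝ, IsStableLaw (1 / γ) (ν : Measure ℝ) ∧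
      TendstoInDistribution
        (fun (n : ℕ) ω ↦ (n : ℝ) ^ (-γ) * (S n ω - ∫ ω', S n ω' ∂μ))
        atTop (id : ℝ → ℝ) (fun _ ↦ μ) (ν : Measure ℝ)) :=
  theorem2p2_general μ γ γ' β lam lam' hγ1 (by linarith) hβ hlam hlam' P P' hP hP' hind S hS
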